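/- Let $M$ be a finite-dimensional smooth manifold without boundary, with tangent bundle $\tau:TM\to M$ and cotangent bundle $\tau^*:T^*M\to M$, and let $k\ge 1$. Let $T^kM$ be the $k$-th order tangent bundle: its points are the $k$-jets $j^k\gamma(0)$ of smooth curves in $M$, and a chart $(x^a)$ of $M$ gives the chart $x^{a,(\alpha)}(j^k\gamma(0))=\frac{d^\alpha}{dt^\alpha}\big|_{0}x^a(\gamma(t))$, $0\le\alpha\le k$, of $T^kM$. Let $T^{(k)}=T\cdots T$ be the $k$-fold iterated tangent functor; $T^jT^{l}N\subset T^{(j+l)}N$ by $j^j_sj^l_tf(s,t)\mapsto j^1_{u_1}\cdots j^1_{u_{j+l}}f(u_1+\dots+u_j,\,u_{j+1}+\dots+u_{j+l})$, and likewise $T^kN\subset T^{(k)}N$ and $T^{2k}N\subset T^kT^kN$ (all jets at $0$). The pairing $\langle\cdot,\cdot\rangle_{T^{(k)}\tau}$ of $T^{(k)}T^*M$ and $T^{(k)}TM$ over $T^{(k)}M$ is the $k$-fold tangent lift of the natural pairing $\langle\cdot,\cdot\rangle_\tau$, and $\langle\cdot,\cdot\rangle_{T^k\tau}$ is its restriction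 to $T^kT^*M\times_{T^kM}T^kTM$. - $\kappa_k:T^kTM\to TT^kM$ is the canonical flip $j^k_{t}j^1_{s}f(t,s)\mapsto j^1_{s}j^k_{t}f(t,s)$, and $\varepsilon_k:T^*T^kM\to T^kT^*M$ is its dual: $\varepsilon_k(\Psi)$ lies over the same point of $T^kM$ as $\Psi$ and $\langle\Psi,\kappa_k(V)\rangle=\langle\varepsilon_k(\Psi),V\rangle_{T^k\tau}$ for all $V\in T^kTM$ over that point. - A vector $\Phi\in T^mT^mT^*M$ is semi-holonomic if $T^mT^m\tau^*(\Phi)=v^{2m}\in T^{2m}M\subset T^mT^mM$; let $v^m\in T^mM$ be the projection of $v^{2m}$, and let $\Phi^{(j,m-j)}\in T^jT^{m-j}T^*M\subset T^{(m)}T^*M$ be the projections of $\Phi$. For such $\Phi$, $\Upsilon_{m,\tau^*}(\Phi)\in T^*M$ is the covector, at the base point of $v^{2m}$, with $$\langle\Upsilon_{m,\tau^*}(\Phi),\xi\rangle_\tau=\Big\langle\sum_{j=0}^m(-1)^j\tbinom mj\Phi^{(j,m-j)},\,j^m\xi\Big\rangle_{T^{(m)}\tau}$$ for all $j^m\xi\in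 T^mTM$ over $v^m$ (where $\xi\in TM$ is the base point of $j^m\xi$), and $\Pi_{m,\tau^*}(\Phi)\in T^mT^*M$ is $$\Pi_{m,\tau^*}(\Phi)=P_m\Big[\sum_{j=0}^m(-1)^j\tbinom{m+1}{j+1}\Phi^{(j,m-j)}\Big],$$ where, for $X\in T^{(m)}T^*M$ over $v^m\in T^mM\subset T^{(m)}M$, $P_m(X)\in T^mT^*M$ is the element over $v^m$ with $\langle P_m(X),V\rangle_{T^m\tau}=\langle X,V\rangle_{T^{(m)}\tau}$ for all $V\in T^mTM$ over $v^m$. Let $L:T^kM\to\mathbb R$ be smooth, put $\Lambda_L=\varepsilon_k\circ dL:T^kM\to T^kT^*M$, and let $\lambda_L:T^kM\to T^{k-1}T^*M$ be the composition of $\Lambda_L$ with the projection $T^kT^*M\to T^{k-1}T^*M$. Let $\gamma:[t_0,t_1]\to M$ be a smooth curve and $\delta\gamma$ a smooth vector field along $\gamma$ (both smooth on an open neighbourhood of $[t_0,t_1]$), let $\delta j^k\gamma=\kappa_k(j^k\delta\gamma)$ be the variation generated by $\delta\gamma$, and define the differential of the action $S_L$ in its direction by $$\langle dS_L(j^k\gamma),\delta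 j^k\gamma\rangle:=\int_{t_0}^{t_1}\langle dL(j^k\gamma(t)),\delta j^k\gamma(t)\rangle\,dt .$$ Define the force and the momentum along $\gamma$ by $$F_{L,\gamma}(t)=\Upsilon_{k,\tau^*}\big(j^k\Lambda_L(j^k\gamma(t))\big),\qquad M_{L,\gamma}(t)=\Pi_{k-1,\tau^*}\big(j^{k-1}\lambda_L(j^k\gamma(t))\big).$$ Then for every $t\in[t_0,t_1]$ the vector $\delta j^k\gamma(t)$ is tangent to $T^kM$ at $j^k\gamma(t)$, $F_{L,\gamma}(t)$ is a covector at $\gamma(t)$ and $M_{L,\gamma}(t)\in T^{k-1}T^*M$ lies over $j^{k-1}\gamma(t)$; the functions $t\mapsto\langle dL(j^k\gamma(t)),\delta j^k\gamma(t)\rangle$ and $t\mapsto\langle F_{L,\gamma}(t),\delta\gamma(t)\rangle_\tau$ are integrable on $[t_0,t_1]$; and $$\langle dS_L(j^k\gamma),\delta j^k\gamma\rangle=\int_{t_0}^{t_1}\langle F_{L,\gamma}(t),\delta\gamma(t)\rangle_\tau\,dt+\langle M_{L,\gamma}(t),j^{k-1}\delta\gamma(t)\rangle_{T^{k-1}\tau}\Big|_{t_0}^{t_1}.$$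 -/

import Mathlib

open scoped Manifold ContDiff Topology
open Set Filter Bundle

noncomputable section

namespace HigherVar

/-! ### Calculus on jets of curves -/

theorem iteratedDeriv_clm_comp {E G : Type*} [NormedAddCommGroup E] [NormedSpace ℝ E]
    [NormedAddCommGroup G] [NormedSpace ℝ G] (l : E →L[ℝ] G) {u : ℝ → E} {t : ℝ}
    (hu : ContDiffAt ℝ ∞ u t) (i : ℕ) :
    iteratedDeriv i (fun s => l (u s)) t = l (iteratedDeriv i u t) := by
  rw [iteratedDeriv_eq_iteratedFDeriv, iteratedDeriv_eq_iteratedFDeriv]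
  have h := l.iteratedFDeriv_comp_left hu (i := i) (by exact_mod_cast le_top)
  have h' : (fun s => l (u s)) = l ∘ u := rfl
  rw [h', h]
  rfl

/-- Post-composition with a smooth map respects equality of derivatives up to order `k`. -/
theorem iteratedDeriv_comp_congr {G : Type*} [NormedAddCommGroup G] [NormedSpace ℝ G] (k : ℕ) :
    ∀ {E : Type*} [NormedAddCommGroup E] [NormedSpace ℝ E] (f : E → G) (u w : ℝ → E),
      (∀ᶠ y in 𝓝 (u 0), ContDiffAt ℝ ∞ f y) → (∀ᶠ t in 𝓝 0, ContDiffAt ℝ ∞ u t) →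
      (∀ᶠ t in 𝓝 0, ContDiffAt ℝ ∞ w t) →
      (∀ i ≤ k, iteratedDeriv i u 0 = iteratedDeriv i w 0) →
      ∀ i ≤ k, iteratedDeriv i (fun t => f (u t)) 0 = iteratedDeriv i (fun t => f (w t)) 0 := by
  induction k with
  | zero =>
    intro E _ _ f u w _ _ _ h i hi
    obtain rfl : i = 0 := by omega
    have := h 0 le_rfl
    simp only [iteratedDeriv_zero] at this ⊢
    rw [this]
  | succ k ih =>
    intro E _ _ f u w hf hu hw h i hi
    have h0 : u 0 = w 0 := by simpa using h 0 (Nat.zero_le _)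
    rcases i with _ | i
    · simp [h0]
    have hi' : i ≤ k := by omega
    set f1 : E × E → G := fun p => fderiv ℝ f p.1 p.2 with hf1
    have key : ∀ v : ℝ → E, v 0 = u 0 → (∀ᶠ t in 𝓝 0, ContDiffAt ℝ ∞ v t) →
        iteratedDeriv (i + 1) (fun t => f (v t)) 0
          = iteratedDeriv i (fun t => f1 (v t, deriv v t)) 0 := by
      intro v hv0 hv
      rw [iteratedDeriv_succ']
      apply Filter.EventuallyEq.iteratedDeriv_eq
      have hc : ContinuousAt v 0 := (hv.self_of_nhds).continuousAt
      have hfv : ∀ᶠ t in 𝓝 0, ContDiffAt ℝ ∞ f (v t) := by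
        apply hc.eventually
        rw [hv0]; exact hf
      filter_upwards [hfv, hv] with t h1 h2
      exact fderiv_comp_deriv t (h1.differentiableAt (by simp)) (h2.differentiableAt (by simp))
    rw [key u rfl hu, key w h0.symm hw]
    have hd : ∀ v : ℝ → E, (∀ᶠ t in 𝓝 0, ContDiffAt ℝ ∞ v t) →
        ∀ᶠ t in 𝓝 0, ContDiffAt ℝ ∞ (fun s => (v s, deriv v s)) t := by
      intro v hv
      filter_upwards [hv.eventually_nhds] with t ht
      have h1 := ht.self_of_nhds
      refine h1.prodMk ?_
      have h2 : ContDiffAt ℝ ∞ (fderiv ℝ v) t := h1.fderiv_right (m := ∞) (by simp)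
      exact h2.clm_apply contDiffAt_const
    have hf1' : ∀ᶠ y in 𝓝 ((u 0, deriv u 0) : E × E), ContDiffAt ℝ ∞ f1 y := by
      have : ∀ᶠ y in 𝓝 ((u 0, deriv u 0) : E × E), ContDiffAt ℝ ∞ f y.1 :=
        continuousAt_fst.eventually hf
      filter_upwards [this] with y hy
      have h2 : ContDiffAt ℝ ∞ (fderiv ℝ f) y.1 := hy.fderiv_right (m := ∞) (by simp)
      exact (h2.comp y contDiffAt_fst).clm_apply contDiffAt_snd
    refine ih f1 (fun t => (u t, deriv u t)) (fun t => (w t, deriv w t)) hf1' (hd u hu) (hd w hw)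
      ?_ i hi'
    intro j hj
    have pair : ∀ v : ℝ → E, (∀ᶠ t in 𝓝 0, ContDiffAt ℝ ∞ v t) →
        iteratedDeriv j (fun t => (v t, deriv v t)) 0
          = (iteratedDeriv j v 0, iteratedDeriv (j + 1) v 0) := by
      intro v hv
      have hs := (hd v hv).self_of_nhds
      refine Prod.ext ?_ ?_
      · exact (iteratedDeriv_clm_comp (ContinuousLinearMap.fst ℝ E E) hs j).symm
      · have := (iteratedDeriv_clm_comp (ContinuousLinearMap.snd ℝ E E) hs j).symm
        rw [iteratedDeriv_succ']
        exact this
    rw [pair u hu, pair w hw, h j (by omega), h (j + 1) (by omega)]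

/-- The polynomial curve `t ↦ ∑ α ≤ k, (t ^ α / α!) yᵅ`. -/
def polyCurve {E : Type*} [NormedAddCommGroup E] [NormedSpace ℝ E] {k : ℕ}
    (y : Fin (k + 1) → E) (t : ℝ) : E :=
  ∑ α : Fin (k + 1), (t ^ (α : ℕ) / ((α : ℕ).factorial : ℝ)) • y α

section poly

variable {E : Type*} [NormedAddCommGroup E] [NormedSpace ℝ E] {k : ℕ}

theorem polyCurve_zero (y : Fin (k + 1) → E) : polyCurve y 0 = y 0 := by
  rw [polyCurve, Finset.sum_eq_single 0]
  · simp
  · intro b _ hb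
    have : (b : ℕ) ≠ 0 := fun h => hb (Fin.ext h)
    simp [this]
  · simp

theorem contDiff_polyCurve :
    ContDiff ℝ ∞ (fun p : (Fin (k + 1) → E) × ℝ => polyCurve p.1 p.2) := by
  unfold polyCurve
  fun_prop

theorem contDiff_polyCurve' (y : Fin (k + 1) → E) : ContDiff ℝ ∞ (polyCurve y) := by
  unfold polyCurve
  fun_prop

theorem iteratedDeriv_polyCurve (y : Fin (k + 1) → E) (α : Fin (k + 1)) :
    iteratedDeriv α (polyCurve y) 0 = y α := by
  have h : polyCurve y = fun t => ∑ β : Fin (k + 1),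
      (fun β : Fin (k + 1) => fun t : ℝ => (t ^ (β : ℕ) / ((β : ℕ).factorial : ℝ)) • y β) β t := rfl
  rw [h, iteratedDeriv_fun_sum (fun i _ => by fun_prop), Finset.sum_eq_single α]
  · have h2 : (fun t : ℝ => (t ^ (α : ℕ) / ((α : ℕ).factorial : ℝ)) • y α)
        = fun t => (ContinuousLinearMap.toSpanSingleton ℝ (y α))
          (t ^ (α : ℕ) / ((α : ℕ).factorial : ℝ)) := by
      ext t; simp
    rw [h2, iteratedDeriv_clm_comp _ (by fun_prop)]
    have h3 : iteratedDeriv (α : ℕ) (fun t : ℝ => t ^ (α : ℕ) / ((α : ℕ).factorial : ℝ)) 0 = 1 := by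
      rw [iteratedDeriv_div_const, iteratedDeriv_fun_pow_zero]
      simp [Nat.factorial_ne_zero]
    rw [h3]; simp
  · intro b _ hb
    have h2 : (fun t : ℝ => (t ^ (b : ℕ) / ((b : ℕ).factorial : ℝ)) • y b)
        = fun t => (ContinuousLinearMap.toSpanSingleton ℝ (y b))
          (t ^ (b : ℕ) / ((b : ℕ).factorial : ℝ)) := by
      ext t; simp
    rw [h2, iteratedDeriv_clm_comp _ (by fun_prop)]
    have h3 : iteratedDeriv (α : ℕ) (fun t : ℝ => t ^ (b : ℕ) / ((b : ℕ).factorial : ℝ)) 0 = 0 := by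
      rw [iteratedDeriv_div_const, iteratedDeriv_fun_pow_zero]
      have : (α : ℕ) ≠ b := fun h => hb (Fin.ext h.symm)
      simp [this]
    rw [h3]; simp
  · simp

/-- The `t`-derivatives of a jointly smooth function are jointly smooth. -/
theorem contDiffOn_iteratedDeriv_param {P G : Type*} [NormedAddCommGroup P] [NormedSpace ℝ P]
    [NormedAddCommGroup G] [NormedSpace ℝ G] {W : Set (P × ℝ)} (hW : IsOpen W) (n : ℕ) :
    ∀ (F : P × ℝ → G), ContDiffOn ℝ ∞ F W →
      ContDiffOn ℝ ∞ (fun p : P × ℝ => iteratedDeriv n (fun t => F (p.1, t)) p.2) W := by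
  induction n with
  | zero => intro F hF; simpa using hF
  | succ n ih =>
    intro F hF
    have hF1 : ContDiffOn ℝ ∞ (fun p : P × ℝ => fderiv ℝ F p (0, 1)) W :=
      (hF.fderiv_of_isOpen hW (m := ∞) (by simp)).clm_apply contDiffOn_const
    refine (ih _ hF1).congr ?_
    intro p hp
    rw [iteratedDeriv_succ']
    apply Filter.EventuallyEq.iteratedDeriv_eq
    have hc : ContinuousAt (fun t : ℝ => (p.1, t)) p.2 := by fun_prop
    have : ∀ᶠ t in 𝓝 p.2, (p.1, t) ∈ W := hc.eventually (hW.mem_nhds hp)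
    filter_upwards [this] with t ht
    have hd : HasFDerivAt F (fderiv ℝ F (p.1, t)) (p.1, t) :=
      ((hF.contDiffAt (hW.mem_nhds ht)).differentiableAt (by simp)).hasFDerivAt
    have hd2 : HasDerivAt (fun t : ℝ => (p.1, t)) ((0 : P), (1 : ℝ)) t :=
      (hasDerivAt_const t p.1).prodMk (hasDerivAt_id t)
    exact (hd.comp_hasDerivAt t hd2).deriv

end poly

/-! ### Velocities -/

/-- `f` is smooth on a neighbourhood of `x`, for `f` defined on a normed space. -/
def SmoothNear {V : Type*} [NormedAddCommGroup V] [NormedSpace ℝ V]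
    {E : Type*} [NormedAddCommGroup E] [NormedSpace ℝ E] {H : Type*} [TopologicalSpace H]
    (I : ModelWithCorners ℝ E H) {N : Type*} [TopologicalSpace N] [ChartedSpace H N]
    (f : V → N) (x : V) : Prop :=
  ∀ᶠ u in 𝓝 x, ContMDiffAt 𝓘(ℝ, V) I ∞ f u

/-- `h` is a smooth real function on a neighbourhood of the point `x` of a manifold. -/
def SmoothFunNear {E : Type*} [NormedAddCommGroup E] [NormedSpace ℝ E] {H : Type*}
    [TopologicalSpace H] (I : ModelWithCorners ℝ E H) {N : Type*} [TopologicalSpace N]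
    [ChartedSpace H N] (h : N → ℝ) (x : N) : Prop :=
  ∀ᶠ y in 𝓝 x, ContMDiffAt I 𝓘(ℝ, ℝ) ∞ h y

section Vel

variable (k : ℕ) {E : Type*} [NormedAddCommGroup E] [NormedSpace ℝ E] {H : Type*}
  [TopologicalSpace H] (I : ModelWithCorners ℝ E H) (N : Type*) [TopologicalSpace N]
  [ChartedSpace H N]

/-- Two curves that are smooth near `0` have the same `k`-jet at `0`: they pass through the same
point, and along both curves every locally smooth real function has the same derivatives at `0`
up to order `k`. -/
def velSetoid : Setoid {γ : ℝ → N // SmoothNear I γ 0} where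
  r γ δ := γ.1 0 = δ.1 0 ∧ ∀ h : N → ℝ, SmoothFunNear I h (γ.1 0) → ∀ α ≤ k,
    iteratedDeriv α (fun t => h (γ.1 t)) 0 = iteratedDeriv α (fun t => h (δ.1 t)) 0
  iseqv :=
    { refl := fun _ => ⟨rfl, fun _ _ _ _ => rfl⟩
      symm := fun {_ _} h => ⟨h.1.symm, fun g hg α hα => (h.2 g (h.1 ▸ hg) α hα).symm⟩
      trans := fun {_ _ _} h h' => ⟨h.1.trans h'.1, fun g hg α hα =>
        (h.2 g hg α hα).trans (h'.2 g (h.1 ▸ hg) α hα)⟩ }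

/-- The `k`-th order tangent bundle `TᵏN`: its points are the `k`-velocities, that is, the `k`-jets
at `0` of smooth curves in `N`. -/
def Vel : Type _ := Quotient (velSetoid k I N)

variable {k I N}

theorem smoothNear_const {V : Type*} [NormedAddCommGroup V] [NormedSpace ℝ V] (x : N) (u : V) :
    SmoothNear I (fun _ : V => x) u :=
  Eventually.of_forall fun _ => contMDiffAt_const

theorem SmoothNear.shift {V : Type*} [NormedAddCommGroup V] [NormedSpace ℝ V] {γ : V → N} {t : V}
    (h : SmoothNear I γ t) : SmoothNear I (fun s => γ (t + s)) 0 := by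
  have hc : ContinuousAt (fun s : V => t + s) 0 := by fun_prop
  have h' : ∀ᶠ s in 𝓝 (0 : V), ContMDiffAt 𝓘(ℝ, V) I ∞ γ (t + s) := by
    apply hc.eventually
    change ∀ᶠ y in 𝓝 (t + 0), ContMDiffAt 𝓘(ℝ, V) I ∞ γ y
    rw [add_zero]
    exact h
  refine h'.mono fun s hs => ?_
  have : ContMDiffAt 𝓘(ℝ, V) 𝓘(ℝ, V) ∞ (fun s : V => t + s) s :=
    (contDiff_const.add contDiff_id).contDiffAt.contMDiffAt
  exact ContMDiffAt.comp s hs this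

/-- The class of a curve that is smooth near `0`. -/
def Vel.mk (γ : {γ : ℝ → N // SmoothNear I γ 0}) : Vel k I N := Quotient.mk _ γ

open Classical in
/-- The `k`-jet `jᵏγ(t)` of the curve `γ` at `t`. It is the class of `s ↦ γ (t + s)`; where `γ` is
not smooth near `t`, it is given the value of the constant jet. -/
def jet (k : ℕ) (I : ModelWithCorners ℝ E H) (γ : ℝ → N) (t : ℝ) : Vel k I N :=
  if h : SmoothNear I γ t then Vel.mk ⟨fun s => γ (t + s), h.shift⟩
  else Vel.mk ⟨fun _ => γ t, smoothNear_const _ _⟩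

namespace Vel

/-- A curve that represents the velocity `v`. -/
def rep (v : Vel k I N) : ℝ → N := (Quotient.out v).1

theorem smooth_rep (v : Vel k I N) : SmoothNear I v.rep 0 := (Quotient.out v).2

/-- The base point of a velocity, i.e. the projection `τᵏ : TᵏN → N`. -/
def base (v : Vel k I N) : N := v.rep 0

/-- The projection `τᵏ_l : TᵏN → TˡN` (used for `l ≤ k`). -/
def proj (l : ℕ) (v : Vel k I N) : Vel l I N := jet l I v.rep 0

/-- The map `Tᵏf : TᵏN → TᵏN'`, sending `jᵏγ` to `jᵏ(f ∘ γ)`. -/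
def map {E' : Type*} [NormedAddCommGroup E'] [NormedSpace ℝ E'] {H' : Type*}
    [TopologicalSpace H'] (I' : ModelWithCorners ℝ E' H') {N' : Type*} [TopologicalSpace N']
    [ChartedSpace H' N'] (f : N → N') (v : Vel k I N) : Vel k I' N' :=
  jet k I' (fun t => f (v.rep t)) 0

theorem jet_rep (v : Vel k I N) : jet k I v.rep 0 = v := by
  rw [jet, dif_pos v.smooth_rep]
  have : (⟨fun s => v.rep (0 + s), v.smooth_rep.shift⟩ : {γ : ℝ → N // SmoothNear I γ 0})
      = Quotient.out v := by
    apply Subtype.ext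
    funext s
    simp [rep]
  rw [this]
  exact Quotient.out_eq v

theorem rep_jet {γ : ℝ → N} (h : SmoothNear I γ 0) :
    (jet k I γ 0).rep 0 = γ 0 ∧ ∀ g : N → ℝ, SmoothFunNear I g (γ 0) → ∀ α ≤ k,
      iteratedDeriv α (fun t => g ((jet k I γ 0).rep t)) 0
        = iteratedDeriv α (fun t => g (γ t)) 0 := by
  have h1 : jet k I γ 0 = Vel.mk ⟨γ, h⟩ := by
    rw [jet, dif_pos h]
    congr 2
    funext s
    simp
  have h2 := Quotient.mk_out (s := velSetoid k I N) ⟨γ, h⟩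
  rw [h1]
  refine ⟨h2.1, fun g hg α hα => h2.2 g ?_ α hα⟩
  have h3 := h2.1
  dsimp only at h3
  rw [h3]
  exact hg

theorem jet_eq_of {γ δ : ℝ → N} (hγ : SmoothNear I γ 0) (hδ : SmoothNear I δ 0)
    (h0 : γ 0 = δ 0) (h : ∀ g : N → ℝ, SmoothFunNear I g (γ 0) → ∀ α ≤ k,
      iteratedDeriv α (fun t => g (γ t)) 0 = iteratedDeriv α (fun t => g (δ t)) 0) :
    jet k I γ 0 = jet k I δ 0 := by
  rw [jet, jet, dif_pos hγ, dif_pos hδ]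
  apply Quotient.sound
  refine ⟨?_, ?_⟩
  · simpa using h0
  · intro g hg α hα
    have := h g (by simpa using hg) α hα
    simpa using this

/-- The adapted coordinates `x^{(α)}`, `0 ≤ α ≤ k`, of a velocity, with respect to the chart of `N`
at `x`: the derivatives of order `α` at `0` of the curve read in that chart. -/
def coords (x : N) (v : Vel k I N) : Fin (k + 1) → E :=
  fun α => iteratedDeriv α (fun t => extChartAt I x (v.rep t)) 0

/-- The velocity with given adapted coordinates with respect to the chart of `N` at `x`. -/
def ofCoords (I : ModelWithCorners ℝ E H) (x : N) (y : Fin (k + 1) → E) : Vel k I N :=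
  jet k I (fun t => (extChartAt I x).symm (polyCurve y t)) 0

section chart

theorem isOpen_chart_trans_base [I.Boundaryless] (x x' : N) :
    IsOpen ((extChartAt I x).symm.trans (extChartAt I x')).source := by
  rw [PartialEquiv.trans_source, PartialEquiv.symm_source]
  exact (continuousOn_extChartAt_symm x).isOpen_inter_preimage (isOpen_extChartAt_target x)
    (isOpen_extChartAt_source x')

variable [IsManifold I ∞ N]

theorem smoothNear_chart {x : N} {γ : ℝ → N} (hγ : SmoothNear I γ 0)
    (hx : γ 0 ∈ (extChartAt I x).source) :
    ∀ᶠ t in 𝓝 0, ContDiffAt ℝ ∞ (fun t => extChartAt I x (γ t)) t := by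
  have hc : ContinuousAt γ 0 := hγ.self_of_nhds.continuousAt
  have h1 : ∀ᶠ t in 𝓝 0, γ t ∈ (extChartAt I x).source :=
    hc.eventually ((isOpen_extChartAt_source x).mem_nhds hx)
  filter_upwards [h1, hγ] with t ht hs
  have : ContMDiffAt I 𝓘(ℝ, E) ∞ (extChartAt I x) (γ t) :=
    contMDiffAt_extChartAt' (by simpa using ht)
  exact (ContMDiffAt.comp t this hs).contDiffAt

theorem coords_jet {x : N} {γ : ℝ → N} (hγ : SmoothNear I γ 0)
    (hx : γ 0 ∈ (extChartAt I x).source) (α : Fin (k + 1)) :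
    coords x (jet k I γ 0) α = iteratedDeriv α (fun t => extChartAt I x (γ t)) 0 := by
  obtain ⟨h0, h⟩ := rep_jet (k := k) hγ
  refine (SeparatingDual.eq_iff_forall_dual_eq (R := ℝ)).2 fun l => ?_
  have hs1 : ContDiffAt ℝ ∞ (fun t => extChartAt I x ((jet k I γ 0).rep t)) 0 :=
    (smoothNear_chart (smooth_rep _) (by rw [h0]; exact hx)).self_of_nhds
  have hs2 : ContDiffAt ℝ ∞ (fun t => extChartAt I x (γ t)) 0 :=
    (smoothNear_chart hγ hx).self_of_nhds
  rw [coords, ← iteratedDeriv_clm_comp l hs1, ← iteratedDeriv_clm_comp l hs2]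
  refine h (fun y => l (extChartAt I x y)) ?_ α (by omega)
  filter_upwards [(isOpen_extChartAt_source x).mem_nhds hx] with y hy
  have h1 : ContMDiffAt I 𝓘(ℝ, E) ∞ (extChartAt I x) y :=
    contMDiffAt_extChartAt' (by simpa using hy)
  exact ContMDiffAt.comp y l.contDiff.contDiffAt.contMDiffAt h1

variable [I.Boundaryless]

theorem smoothNear_symm_polyCurve {x : N} {y : Fin (k + 1) → E}
    (hy : y 0 ∈ (extChartAt I x).target) :
    SmoothNear I (fun t => (extChartAt I x).symm (polyCurve y t)) 0 := by
  have hc : ContinuousAt (polyCurve y) 0 := (contDiff_polyCurve' y).continuous.continuousAt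
  have h1 : ∀ᶠ t in 𝓝 0, polyCurve y t ∈ (extChartAt I x).target := by
    apply hc.eventually
    rw [polyCurve_zero]
    exact (isOpen_extChartAt_target x).mem_nhds hy
  filter_upwards [h1] with t ht
  have h2 : ContMDiffAt 𝓘(ℝ, E) I ∞ (extChartAt I x).symm (polyCurve y t) :=
    (contMDiffOn_extChartAt_symm x).contMDiffAt ((isOpen_extChartAt_target x).mem_nhds ht)
  exact ContMDiffAt.comp t h2 (contDiff_polyCurve' y).contDiffAt.contMDiffAt

theorem base_ofCoords {x : N} {y : Fin (k + 1) → E} (hy : y 0 ∈ (extChartAt I x).target) :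
    (ofCoords I x y).base = (extChartAt I x).symm (y 0) := by
  have := (rep_jet (k := k) (smoothNear_symm_polyCurve hy)).1
  rw [polyCurve_zero] at this
  exact this

theorem coords_ofCoords (x x' : N) {y : Fin (k + 1) → E} (hy : y 0 ∈ (extChartAt I x).target)
    (hx' : (extChartAt I x).symm (y 0) ∈ (extChartAt I x').source) (α : Fin (k + 1)) :
    coords x' (ofCoords I x y) α
      = iteratedDeriv α (fun t => extChartAt I x' ((extChartAt I x).symm (polyCurve y t))) 0 :=
  coords_jet (smoothNear_symm_polyCurve hy) (by rw [polyCurve_zero]; exact hx') α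

theorem ofCoords_coords {x : N} {v : Vel k I N} (hv : v.base ∈ (extChartAt I x).source) :
    ofCoords I x (coords x v) = v := by
  have hz : coords x v 0 = extChartAt I x v.base := by simp [coords, base]
  have ht : coords x v 0 ∈ (extChartAt I x).target := by
    rw [hz]; exact (extChartAt I x).map_source hv
  conv_rhs => rw [← jet_rep v]
  have hb : (extChartAt I x).symm (polyCurve (coords x v) 0) = v.base := by
    rw [polyCurve_zero, hz, (extChartAt I x).left_inv hv]
  refine jet_eq_of (smoothNear_symm_polyCurve ht) v.smooth_rep hb ?_
  intro g hg α hα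
  rw [hb] at hg
  have hrep := smoothNear_chart v.smooth_rep (x := x) hv
  have e1 : iteratedDeriv α (fun t => g (v.rep t)) 0
      = iteratedDeriv α (fun t => g ((extChartAt I x).symm (extChartAt I x (v.rep t)))) 0 := by
    apply Filter.EventuallyEq.iteratedDeriv_eq
    have hc : ContinuousAt v.rep 0 := v.smooth_rep.self_of_nhds.continuousAt
    filter_upwards [hc.eventually ((isOpen_extChartAt_source x).mem_nhds hv)] with t h1
    rw [(extChartAt I x).left_inv h1]
  rw [e1]
  refine iteratedDeriv_comp_congr k (fun y => g ((extChartAt I x).symm y))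
    (polyCurve (coords x v)) (fun t => extChartAt I x (v.rep t)) ?_ ?_ hrep ?_ α hα
  · rw [polyCurve_zero]
    have hc : ContinuousAt (extChartAt I x).symm (coords x v 0) :=
      continuousAt_extChartAt_symm'' ht
    have h1 : ∀ᶠ y in 𝓝 (coords x v 0), ContMDiffAt I 𝓘(ℝ, ℝ) ∞ g ((extChartAt I x).symm y) := by
      apply hc.eventually
      rw [hz, (extChartAt I x).left_inv hv]
      exact hg
    filter_upwards [h1, (isOpen_extChartAt_target x).mem_nhds ht] with y hy hy'
    have h2 : ContMDiffAt 𝓘(ℝ, E) I ∞ (extChartAt I x).symm y :=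
      (contMDiffOn_extChartAt_symm x).contMDiffAt ((isOpen_extChartAt_target x).mem_nhds hy')
    exact (ContMDiffAt.comp y hy h2).contDiffAt
  · exact Eventually.of_forall fun t => (contDiff_polyCurve' _).contDiffAt
  · intro i hi
    exact iteratedDeriv_polyCurve (coords x v) ⟨i, by omega⟩

variable (k I) in
/-- The adapted chart of `TᵏN` given by the chart of `N` at `x`. -/
def chart (x : N) : PartialEquiv (Vel k I N) (Fin (k + 1) → E) where
  toFun := coords x
  invFun := ofCoords I x
  source := {v | v.base ∈ (extChartAt I x).source}
  target := {y | y 0 ∈ (extChartAt I x).target}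
  map_source' := by
    intro v hv
    have hz : coords x v 0 = extChartAt I x v.base := by simp [coords, base]
    rw [mem_ofPred_eq, hz]
    exact (extChartAt I x).map_source hv
  map_target' := by
    intro y hy
    rw [mem_ofPred_eq, base_ofCoords hy]
    exact (extChartAt I x).map_target hy
  left_inv' := fun v hv => ofCoords_coords hv
  right_inv' := by
    intro y hy
    funext α
    rw [coords_ofCoords x x hy ((extChartAt I x).map_target hy)]
    have : (fun t => extChartAt I x ((extChartAt I x).symm (polyCurve y t)))
        =ᶠ[𝓝 0] polyCurve y := by
      have hc : ContinuousAt (polyCurve y) 0 := (contDiff_polyCurve' y).continuous.continuousAt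
      have h1 : ∀ᶠ t in 𝓝 0, polyCurve y t ∈ (extChartAt I x).target := by
        apply hc.eventually
        rw [polyCurve_zero]
        exact (isOpen_extChartAt_target x).mem_nhds hy
      filter_upwards [h1] with t ht
      exact (extChartAt I x).right_inv ht
    rw [this.iteratedDeriv_eq, iteratedDeriv_polyCurve]

theorem chart_trans_source (x x' : N) : ((chart k I x).symm.trans (chart k I x')).source
    = {y | y 0 ∈ ((extChartAt I x).symm.trans (extChartAt I x')).source} := by
  ext y
  simp only [PartialEquiv.trans_source, PartialEquiv.symm_source, mem_inter_iff, mem_preimage,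
    mem_ofPred_eq, chart, PartialEquiv.coe_symm_mk]
  constructor
  · rintro ⟨h1, h2⟩
    refine ⟨h1, ?_⟩
    rwa [base_ofCoords h1] at h2
  · rintro ⟨h1, h2⟩
    refine ⟨h1, ?_⟩
    rwa [base_ofCoords h1]

theorem isOpen_chart_trans_source (x x' : N) :
    IsOpen ((chart k I x).symm.trans (chart k I x')).source := by
  rw [chart_trans_source]
  exact (isOpen_chart_trans_base x x').preimage (continuous_apply 0)

theorem contDiffOn_chart_trans (x x' : N) :
    ContDiffOn ℝ ∞ ((chart k I x).symm.trans (chart k I x'))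
      ((chart k I x).symm.trans (chart k I x')).source := by
  rw [chart_trans_source]
  set S := ((extChartAt I x).symm.trans (extChartAt I x')).source with hS
  have hSo : IsOpen S := isOpen_chart_trans_base x x'
  have hF : ContDiffOn ℝ ∞ (fun z => extChartAt I x' ((extChartAt I x).symm z)) S :=
    contDiffOn_ext_coord_change x' x
  set W : Set ((Fin (k + 1) → E) × ℝ) := {p | polyCurve p.1 p.2 ∈ S} with hW
  have hWo : IsOpen W := hSo.preimage (contDiff_polyCurve (E := E) (k := k)).continuous
  have hG : ContDiffOn ℝ ∞ (fun p : (Fin (k + 1) → E) × ℝ =>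
      extChartAt I x' ((extChartAt I x).symm (polyCurve p.1 p.2))) W :=
    hF.comp contDiff_polyCurve.contDiffOn fun p hp => hp
  rw [contDiffOn_pi]
  intro α
  have h1 := contDiffOn_iteratedDeriv_param hWo α _ hG
  have h2 : ContDiffOn ℝ ∞ (fun y : Fin (k + 1) → E => (y, (0 : ℝ))) {y | y 0 ∈ S} := by
    fun_prop
  refine (h1.comp h2 ?_).congr ?_
  · intro y hy
    change polyCurve y 0 ∈ S
    rw [polyCurve_zero]; exact hy
  · intro y hy
    exact coords_ofCoords x x' hy.1 hy.2 α

variable (k I N) in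
/-- The atlas of the adapted charts. -/
def core : ChartedSpaceCore (Fin (k + 1) → E) (Vel k I N) where
  atlas := range fun x : N => chart k I x
  chartAt v := chart k I v.base
  mem_chart_source v := mem_extChartAt_source (I := I) v.base
  chart_mem_atlas v := ⟨v.base, rfl⟩
  open_source := by
    rintro _ _ ⟨x, rfl⟩ ⟨x', rfl⟩
    exact isOpen_chart_trans_source x x'
  continuousOn_toFun := by
    rintro _ _ ⟨x, rfl⟩ ⟨x', rfl⟩
    exact (contDiffOn_chart_trans x x').continuousOn

instance : TopologicalSpace (Vel k I N) := (core k I N).toTopologicalSpace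

/-- The manifold structure of `TᵏN`, given by the adapted charts. -/
instance : ChartedSpace (Fin (k + 1) → E) (Vel k I N) := (core k I N).toChartedSpace

instance : IsManifold 𝓘(ℝ, Fin (k + 1) → E) ∞ (Vel k I N) := by
  apply isManifold_of_contDiffOn
  intro e e' he he'
  obtain ⟨_, ⟨x, rfl⟩, he⟩ := mem_iUnion₂.1 he
  obtain ⟨_, ⟨x', rfl⟩, he'⟩ := mem_iUnion₂.1 he'
  obtain rfl := mem_singleton_iff.1 he
  obtain rfl := mem_singleton_iff.1 he'
  have h := contDiffOn_chart_trans (k := k) (I := I) x x'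
  refine h.mono fun y hy => ?_
  exact hy.1

end chart

end Vel

end Vel

open Classical in
/-- The unique `x` with `P x`; the value `d` is used only if there is no such `x`, or more than
one. -/
def theUnique {α : Type*} (d : α) (P : α → Prop) : α :=
  if h : ∃! x, P x then h.choose else d

/-! ### Iterated tangent bundles -/

/-- The iterated partial derivative `∂_{i₁} ⋯ ∂_{iₘ} g`, for `l = [i₁, …, iₘ]`. -/
def mixedPartial {k : ℕ} : List (Fin k) → ((Fin k → ℝ) → ℝ) → (Fin k → ℝ) → ℝ
  | [], g => g
  | i :: l, g => fun u => fderiv ℝ (mixedPartial l g) u (Pi.single i 1)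

section ITan

variable (k : ℕ) {E : Type*} [NormedAddCommGroup E] [NormedSpace ℝ E] {H : Type*}
  [TopologicalSpace H] (I : ModelWithCorners ℝ E H) (N : Type*) [TopologicalSpace N]
  [ChartedSpace H N]

/-- Two maps `f, g : ℝᵏ → N`, smooth near `0`, represent the same point
`j¹_{u₁} ⋯ j¹_{uₖ} f(u₁, …, uₖ)` of the iterated tangent bundle: they take the same value at `0`, and
for every locally smooth real function `h` the derivatives of `h ∘ f` and `h ∘ g` at `0` that are of
order at most one in each variable agree. -/
def iterSetoid : Setoid {f : (Fin k → ℝ) → N // SmoothNear I f 0} where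
  r f g := f.1 0 = g.1 0 ∧ ∀ h : N → ℝ, SmoothFunNear I h (f.1 0) → ∀ l : List (Fin k), l.Nodup →
    mixedPartial l (fun u => h (f.1 u)) 0 = mixedPartial l (fun u => h (g.1 u)) 0
  iseqv :=
    { refl := fun _ => ⟨rfl, fun _ _ _ _ => rfl⟩
      symm := fun {_ _} h => ⟨h.1.symm, fun g hg α hα => (h.2 g (h.1 ▸ hg) α hα).symm⟩
      trans := fun {_ _ _} h h' => ⟨h.1.trans h'.1, fun g hg α hα =>
        (h.2 g hg α hα).trans (h'.2 g (h.1 ▸ hg) α hα)⟩ }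

/-- The iterated tangent bundle `T⁽ᵏ⁾N = T ⋯ T N` (`k` times). Its points are written as
`j¹_{u₁} ⋯ j¹_{uₖ} f(u₁, …, uₖ)` at `u = 0`, where `f : ℝᵏ → N` is smooth near `0`. -/
def ITan : Type _ := Quotient (iterSetoid k I N)

variable {k I N}

/-- The class of a map that is smooth near `0`. -/
def ITan.mk (f : {f : (Fin k → ℝ) → N // SmoothNear I f 0}) : ITan k I N := Quotient.mk _ f

open Classical in
/-- The point `j¹_{u₁} ⋯ j¹_{uₖ} f` of `T⁽ᵏ⁾N` at `u = 0` (for `f` smooth near `0`). -/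
def iterJet (I : ModelWithCorners ℝ E H) (f : (Fin k → ℝ) → N) : ITan k I N :=
  if h : SmoothNear I f 0 then ITan.mk ⟨f, h⟩ else ITan.mk ⟨fun _ => f 0, smoothNear_const _ _⟩

namespace ITan

/-- A map that represents `X`. -/
def rep (X : ITan k I N) : (Fin k → ℝ) → N := (Quotient.out X).1

/-- The map `T⁽ᵏ⁾f : T⁽ᵏ⁾N → T⁽ᵏ⁾N'`. -/
def map {E' : Type*} [NormedAddCommGroup E'] [NormedSpace ℝ E'] {H' : Type*}
    [TopologicalSpace H'] (I' : ModelWithCorners ℝ E' H') {N' : Type*} [TopologicalSpace N']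
    [ChartedSpace H' N'] (f : N → N') (X : ITan k I N) : ITan k I' N' :=
  iterJet I' (fun u => f (X.rep u))

end ITan

/-- The inclusion `ιᵏ : TᵏN ⊂ T⁽ᵏ⁾N`, sending `jᵏγ(0)` to the class of
`(u₁, …, uₖ) ↦ γ (u₁ + ⋯ + uₖ)`. -/
def Vel.iota (v : Vel k I N) : ITan k I N := iterJet I (fun u => v.rep (∑ i, u i))

variable [IsManifold I ∞ N] [I.Boundaryless]

/-- The inclusion `ι^{k,k} : T²ᵏN ⊂ TᵏTᵏN`, sending `j²ᵏγ(0)` to `jᵏ_s jᵏ_t γ(s + t)` at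
`s = t = 0`. -/
def Vel.iotaDouble (k : ℕ) (v : Vel (2 * k) I N) :
    Vel k 𝓘(ℝ, Fin (k + 1) → E) (Vel k I N) :=
  jet k _ (fun s => jet k I v.rep s) 0

/-- The projection `Φ ↦ Φ^{(m,n)}` from `TᵏTᵏN` to `TᵐTⁿN` (used for `m, n ≤ k`). -/
def biProj (m n : ℕ) (Φ : Vel k 𝓘(ℝ, Fin (k + 1) → E) (Vel k I N)) :
    Vel m 𝓘(ℝ, Fin (n + 1) → E) (Vel n I N) :=
  (Φ.proj m).map _ (Vel.proj n)

/-- The inclusion `TʲTˡN ⊂ T⁽ᵏ⁾N` for `j + l = k`: the element `jʲ_s jˡ_t f(s, t)` at `s = t = 0` is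
sent to the class of `(u₁, …, uₖ) ↦ f (u₁ + ⋯ + uⱼ, uⱼ₊₁ + ⋯ + uₖ)`. -/
def biIota (k j l : ℕ) (w : Vel j 𝓘(ℝ, Fin (l + 1) → E) (Vel l I N)) : ITan k I N :=
  theUnique (iterJet I fun _ => w.base.base) fun X =>
    ∃ f : ℝ → ℝ → N, SmoothNear I (Function.uncurry f) ((0, 0) : ℝ × ℝ) ∧
      w = jet j _ (fun s => jet l I (f s) 0) 0 ∧
      X = iterJet I (fun u : Fin k → ℝ =>
        f (∑ i : Fin k with i.val < j, u i) (∑ i : Fin k with j ≤ i.val, u i))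

end ITan

/-! ### The cotangent bundle and the lifted pairings -/

section Cotangent

variable {E : Type*} [NormedAddCommGroup E] [NormedSpace ℝ E] {H : Type*}
  [TopologicalSpace H] (I : ModelWithCorners ℝ E H) (M : Type*) [TopologicalSpace M]
  [ChartedSpace H M]

/-- The cotangent bundle `T*M`, as the bundle of continuous linear maps from the tangent bundle to
the trivial line bundle. -/
abbrev CoTan : Type _ := TotalSpace (E →L[ℝ] ℝ) (fun x : M => TangentSpace I x →L[ℝ] ℝ)

variable {M}

/-- The model of `T*M` as a manifold. -/
abbrev coModel : ModelWithCorners ℝ (E × (E →L[ℝ] ℝ)) (ModelProd H (E →L[ℝ] ℝ)) :=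
  I.prod 𝓘(ℝ, E →L[ℝ] ℝ)

variable {I}

/-- The projection `τ : TM → M`. -/
def tau (v : TangentBundle I M) : M := v.proj

/-- The projection `τ* : T*M → M`. -/
def coTau (p : CoTan I M) : M := p.proj

open Classical in
/-- The natural pairing `⟨p, v⟩_τ` of a covector with a vector at the same point. -/
def pairing (p : CoTan I M) (v : TangentBundle I M) : ℝ :=
  if h : v.proj = p.proj then p.2 (h ▸ v.2) else 0

variable [IsManifold I ∞ M]

/-! #### Linear combinations and pairings in the lifted bundles -/

/-- The linear combination `∑ⱼ cⱼ Xⱼ` in the vector bundle `T⁽ᵏ⁾τ* : T⁽ᵏ⁾T*M → T⁽ᵏ⁾M`, for elements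
`Xⱼ` of one fibre: represent the `Xⱼ` by families of covectors `aⱼ(u)` over one map `f(u)` into the
base, and combine these pointwise. -/
def linComb {k n : ℕ} (c : Fin (n + 1) → ℝ) (X : Fin (n + 1) → ITan k (coModel I) (CoTan I M)) :
    ITan k (coModel I) (CoTan I M) :=
  theUnique (X 0) fun Y =>
    ∃ (f : (Fin k → ℝ) → M) (a : Fin (n + 1) → ∀ u, TangentSpace I (f u) →L[ℝ] ℝ),
      (∀ j, SmoothNear (coModel I) (fun u => (⟨f u, a j u⟩ : CoTan I M)) 0) ∧
      (∀ j, X j = iterJet (coModel I) (fun u => (⟨f u, a j u⟩ : CoTan I M))) ∧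
      Y = iterJet (coModel I) (fun u => (⟨f u, ∑ j, c j • a j u⟩ : CoTan I M))

/-- The pairing `⟨X, Y⟩` of `T⁽ᵏ⁾τ*` and `T⁽ᵏ⁾τ` over `T⁽ᵏ⁾M`, the `k`-fold tangent lift of the natural
pairing: represent `X` by covectors `a(u)` and `Y` by vectors `b(u)` over one map `f(u)` into the
base, and take `∂_{u₁} ⋯ ∂_{uₖ} ⟨a(u), b(u)⟩` at `u = 0`. -/
def iterPairing {k : ℕ} (X : ITan k (coModel I) (CoTan I M))
    (Y : ITan k I.tangent (TangentBundle I M)) : ℝ :=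
  theUnique 0 fun r =>
    ∃ (f : (Fin k → ℝ) → M) (a : ∀ u, TangentSpace I (f u) →L[ℝ] ℝ) (b : ∀ u, TangentSpace I (f u)),
      SmoothNear (coModel I) (fun u => (⟨f u, a u⟩ : CoTan I M)) 0 ∧
      SmoothNear I.tangent (fun u => (⟨f u, b u⟩ : TangentBundle I M)) 0 ∧
      X = iterJet (coModel I) (fun u => (⟨f u, a u⟩ : CoTan I M)) ∧
      Y = iterJet I.tangent (fun u => (⟨f u, b u⟩ : TangentBundle I M)) ∧
      r = mixedPartial (List.finRange k) (fun u => a u (b u)) 0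

/-- The pairing of `Tᵏτ*` and `Tᵏτ` over `TᵏM`: the restriction of the pairing of `T⁽ᵏ⁾τ*` and
`T⁽ᵏ⁾τ`. -/
def velPairing {k : ℕ} (w : Vel k (coModel I) (CoTan I M))
    (V : Vel k I.tangent (TangentBundle I M)) : ℝ :=
  iterPairing w.iota V.iota

/-! ### The canonical flip and its dual -/

variable [I.Boundaryless]

/-- The velocity vector `j¹c(t)` of a curve, as an element of the tangent bundle. -/
def velocity {E' : Type*} [NormedAddCommGroup E'] [NormedSpace ℝ E'] {H' : Type*}
    [TopologicalSpace H'] (I' : ModelWithCorners ℝ E' H') {N : Type*} [TopologicalSpace N]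
    [ChartedSpace H' N] (c : ℝ → N) (t : ℝ) : TangentBundle I' N :=
  ⟨c t, mfderiv 𝓘(ℝ, ℝ) I' c t (1 : ℝ)⟩

/-- The canonical flip `κₖ : TᵏTM → TTᵏM`, `jᵏ_t j¹_s f(t, s) ↦ j¹_s jᵏ_t f(t, s)` (at
`s = t = 0`). -/
def canonicalFlip {k : ℕ} (V : Vel k I.tangent (TangentBundle I M)) :
    TangentBundle 𝓘(ℝ, Fin (k + 1) → E) (Vel k I M) :=
  theUnique ⟨V.map I tau, 0⟩ fun X =>
    ∃ f : ℝ → ℝ → M, SmoothNear I (Function.uncurry f) ((0, 0) : ℝ × ℝ) ∧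
      V = jet k I.tangent (fun t => velocity I (fun s => f t s) 0) 0 ∧
      X = velocity _ (fun s => jet k I (fun t => f t s) 0) 0

/-- The dual `εₖ : T*TᵏM → TᵏT*M` of the canonical flip, defined by the equality
`⟨Ψ, κₖ V⟩ = ⟨εₖ Ψ, V⟩` for all `V` in `TᵏTM` over the same `k`-velocity as `Ψ`. -/
def dualFlip {k : ℕ} (Ψ : CoTan 𝓘(ℝ, Fin (k + 1) → E) (Vel k I M)) :
    Vel k (coModel I) (CoTan I M) :=
  theUnique (jet k _ (fun _ => (⟨Ψ.proj.base, 0⟩ : CoTan I M)) 0) fun w =>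
    w.map I coTau = Ψ.proj ∧
    ∀ V : Vel k I.tangent (TangentBundle I M), V.map I tau = Ψ.proj →
      pairing Ψ (canonicalFlip V) = velPairing w V

/-! ### Semi-holonomic vectors and the morphisms `Υ`, `P`, `Π` for the bundle `τ*` -/

/-- The bundle `TᵏTᵏT*M`. -/
abbrev VelVel (k : ℕ) (I : ModelWithCorners ℝ E H) [I.Boundaryless] (M : Type*) [TopologicalSpace M]
    [ChartedSpace H M] [IsManifold I ∞ M] : Type _ :=
  Vel k 𝓘(ℝ, Fin (k + 1) → E × (E →L[ℝ] ℝ)) (Vel k (coModel I) (CoTan I M))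

/-- `Φ` is a semi-holonomic vector lying over the `2k`-velocity `v`. -/
def IsSemiHolonomicOver {k : ℕ} (Φ : VelVel k I M) (v : Vel (2 * k) I M) : Prop :=
  Φ.map 𝓘(ℝ, Fin (k + 1) → E) (Vel.map I coTau) = v.iotaDouble k

/-- `∑ⱼ cⱼ Φ^{(j, k - j)}`, where `j` runs from `0` to `k`, as an element of `T⁽ᵏ⁾T*M`. -/
def combine {k : ℕ} (c : ℕ → ℝ) (Φ : VelVel k I M) : ITan k (coModel I) (CoTan I M) :=
  linComb (fun j : Fin (k + 1) => c j) (fun j => biIota k j (k - j) (biProj j (k - j) Φ))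

/-- The morphism `Υₖ` from semi-holonomic vectors in `TᵏTᵏT*M` to `T*M`. For `Φ` over `v²ᵏ`, it is the
covector at the base point of `v²ᵏ` such that
`⟨Υₖ Φ, ξ⟩ = ⟨∑ⱼ (-1)ʲ (k choose j) Φ^{(j, k - j)}, jᵏξ⟩` for every `jᵏξ` in `TᵏTM` that projects to
the `k`-velocity `vᵏ`. -/
def upsilon {k : ℕ} (Φ : VelVel k I M) : CoTan I M :=
  theUnique Φ.base.base fun p =>
    ∃ v : Vel (2 * k) I M, IsSemiHolonomicOver Φ v ∧ p.proj = v.base ∧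
      ∀ V : Vel k I.tangent (TangentBundle I M), V.map I tau = v.proj k →
        pairing p V.base = iterPairing (combine (fun j => (-1) ^ j * (k.choose j : ℝ)) Φ) V.iota

/-- The projection `Pₖ` to `TᵏT*M` of the semi-holonomic vectors in `T⁽ᵏ⁾T*M`. For `X` over
`vᵏ ∈ TᵏM ⊂ T⁽ᵏ⁾M`, it is the element over `vᵏ` such that `⟨Pₖ X, V⟩ = ⟨X, V⟩` for every `V` in `TᵏTM`
over `vᵏ`. -/
def semiHolProj {k : ℕ} (X : ITan k (coModel I) (CoTan I M)) : Vel k (coModel I) (CoTan I M) :=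
  theUnique (jet k _ (fun _ => X.rep 0) 0) fun w =>
    ∃ v : Vel k I M, X.map I coTau = v.iota ∧ w.map I coTau = v ∧
      ∀ V : Vel k I.tangent (TangentBundle I M), V.map I tau = v →
        velPairing w V = iterPairing X V.iota

/-- The morphism `Πₖ` from semi-holonomic vectors in `TᵏTᵏT*M` to `TᵏT*M`:
`Πₖ Φ = Pₖ (∑ⱼ (-1)ʲ (k + 1 choose j + 1) Φ^{(j, k - j)})`. -/
def momenta {k : ℕ} (Φ : VelVel k I M) : Vel k (coModel I) (CoTan I M) :=
  semiHolProj (combine (fun j => (-1) ^ j * ((k + 1).choose (j + 1) : ℝ)) Φ)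

/-! ### Forces and momenta of a Lagrangian -/

variable {k : ℕ} (L : Vel k I M → ℝ)

/-- The differential `dL : TᵏM → T*TᵏM`. -/
def differential (v : Vel k I M) : CoTan 𝓘(ℝ, Fin (k + 1) → E) (Vel k I M) :=
  ⟨v, mfderiv 𝓘(ℝ, Fin (k + 1) → E) 𝓘(ℝ, ℝ) L v⟩

/-- `Λ_L = εₖ ∘ dL : TᵏM → TᵏT*M`. -/
def bigLambda (v : Vel k I M) : Vel k (coModel I) (CoTan I M) :=
  dualFlip (differential L v)

/-- `λ_L : TᵏM → Tᵏ⁻¹T*M`, the projection of `Λ_L`. -/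
def smallLambda (v : Vel k I M) : Vel (k - 1) (coModel I) (CoTan I M) :=
  (bigLambda L v).proj (k - 1)

/-- The force `F_{L,γ}(t) = Υₖ (jᵏ Λ_L(jᵏγ(t)))`. -/
def force (γ : ℝ → M) (t : ℝ) : CoTan I M :=
  upsilon (jet k _ (fun s => bigLambda L (jet k I γ s)) t)

/-- The momentum `M_{L,γ}(t) = Πₖ₋₁ (jᵏ⁻¹ λ_L(jᵏγ(t)))`. -/
def momentum (γ : ℝ → M) (t : ℝ) : Vel (k - 1) (coModel I) (CoTan I M) :=
  momenta (jet (k - 1) _ (fun s => smallLambda L (jet k I γ s)) t)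

/-- The variation `δjᵏγ = κₖ(jᵏδγ)` generated by the vector field `δγ` along `γ`. -/
def variation (k : ℕ) (δγ : ℝ → TangentBundle I M) (t : ℝ) :
    TangentBundle 𝓘(ℝ, Fin (k + 1) → E) (Vel k I M) :=
  canonicalFlip (jet k I.tangent δγ t)

/-- The differential `⟨dS_L(jᵏγ), δjᵏγ⟩ = ∫ ⟨dL(jᵏγ(t)), δjᵏγ(t)⟩ dt` of the action in the direction
of a variation. -/
def actionDifferential (t₀ t₁ : ℝ) (γ : ℝ → M)
    (X : ℝ → TangentBundle 𝓘(ℝ, Fin (k + 1) → E) (Vel k I M)) : ℝ :=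
  ∫ t in t₀..t₁, pairing (differential L (jet k I γ t)) (X t)

end Cotangent

end HigherVar

end

open HigherVar

set_option linter.unusedSectionVars false

noncomputable section

namespace HigherVar

/-! ### Iterated directional derivatives -/

/-- `f` is smooth on a neighbourhood of `x`. -/
abbrev ContDiffNear {V G : Type*} [NormedAddCommGroup V] [NormedSpace ℝ V]
    [NormedAddCommGroup G] [NormedSpace ℝ G] (f : V → G) (x : V) : Prop :=
  ∀ᶠ y in 𝓝 x, ContDiffAt ℝ ∞ f y

/-- The iterated directional derivative `∂_{v₁} ⋯ ∂_{vₘ} f`, for `l = [v₁, …, vₘ]`. -/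
def dirDerivs {V G : Type*} [NormedAddCommGroup V] [NormedSpace ℝ V]
    [NormedAddCommGroup G] [NormedSpace ℝ G] : List V → (V → G) → V → G
  | [], f => f
  | v :: l, f => fun x => fderiv ℝ (dirDerivs l f) x v

section dirDerivs

variable {V W G G' : Type*} [NormedAddCommGroup V] [NormedSpace ℝ V]
  [NormedAddCommGroup W] [NormedSpace ℝ W]
  [NormedAddCommGroup G] [NormedSpace ℝ G] [NormedAddCommGroup G'] [NormedSpace ℝ G']

@[simp] theorem dirDerivs_nil (f : V → G) : dirDerivs [] f = f := rfl

theorem dirDerivs_cons (v : V) (l : List V) (f : V → G) (x : V) :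
    dirDerivs (v :: l) f x = fderiv ℝ (dirDerivs l f) x v := rfl

theorem dirDerivs_append (l l' : List V) (f : V → G) :
    dirDerivs (l ++ l') f = dirDerivs l (dirDerivs l' f) := by
  induction l with
  | nil => rfl
  | cons v l ih => funext x; simp [dirDerivs_cons, ih]

theorem ContDiffNear.contDiffAt {f : V → G} {x : V} (h : ContDiffNear f x) : ContDiffAt ℝ ∞ f x :=
  h.self_of_nhds

theorem ContDiffNear.congr {f g : V → G} {x : V} (h : ContDiffNear f x) (hfg : g =ᶠ[𝓝 x] f) :
    ContDiffNear g x := by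
  filter_upwards [h, hfg.eventuallyEq_nhds] with y h1 h2 using h1.congr_of_eventuallyEq h2

theorem ContDiffNear.comp {g : G → G'} {f : V → G} {x : V} (hg : ContDiffNear g (f x))
    (hf : ContDiffNear f x) : ContDiffNear (fun y => g (f y)) x := by
  filter_upwards [hf, hf.contDiffAt.continuousAt.eventually hg] with y h1 h2 using h2.comp y h1

theorem ContDiffNear.fderiv_apply {f : V → G} {x : V} (h : ContDiffNear f x) (v : V) :
    ContDiffNear (fun y => fderiv ℝ f y v) x :=
  h.mono fun _ hy => (hy.fderiv_right (m := ∞) (by simp)).clm_apply contDiffAt_const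

theorem ContDiffNear.dirDerivs {f : V → G} {x : V} (h : ContDiffNear f x) (l : List V) :
    ContDiffNear (dirDerivs l f) x := by
  induction l with
  | nil => exact h
  | cons v l ih => exact ih.fderiv_apply v

theorem contDiffNear_of_contDiff {f : V → G} (h : ContDiff ℝ ∞ f) (x : V) : ContDiffNear f x :=
  Eventually.of_forall fun _ => h.contDiffAt

theorem ContDiffNear.prodMk {f : V → G} {g : V → G'} {x : V} (h : ContDiffNear f x)
    (h' : ContDiffNear g x) : ContDiffNear (fun y => (f y, g y)) x := by
  filter_upwards [h, h'] with y h1 h2 using h1.prodMk h2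

theorem ContDiffNear.clm_apply {f : V → G →L[ℝ] G'} {g : V → G} {x : V} (h : ContDiffNear f x)
    (h' : ContDiffNear g x) : ContDiffNear (fun y => f y (g y)) x := by
  filter_upwards [h, h'] with y h1 h2 using h1.clm_apply h2

theorem dirDerivs_congr {f g : V → G} {x : V} (h : f =ᶠ[𝓝 x] g) (l : List V) :
    dirDerivs l f =ᶠ[𝓝 x] dirDerivs l g := by
  induction l with
  | nil => exact h
  | cons v l ih =>
    filter_upwards [ih.eventuallyEq_nhds] with y hy
    rw [dirDerivs_cons, dirDerivs_cons, hy.fderiv_eq]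

theorem dirDerivs_clm_comp (L : G →L[ℝ] G') {f : V → G} {x : V} (h : ContDiffNear f x)
    (l : List V) : dirDerivs l (fun y => L (f y)) =ᶠ[𝓝 x] fun y => L (dirDerivs l f y) := by
  induction l with
  | nil => exact EventuallyEq.rfl
  | cons v l ih =>
    filter_upwards [ih.eventuallyEq_nhds, h.dirDerivs l] with y hy h1
    rw [dirDerivs_cons, dirDerivs_cons, hy.fderiv_eq]
    have := (L.hasFDerivAt.comp y (h1.differentiableAt (by simp)).hasFDerivAt).fderiv
    change fderiv ℝ (L ∘ dirDerivs l f) y v = _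
    rw [this]; rfl

theorem dirDerivs_prodMk {f : V → G} {g : V → G'} {x : V} (h : ContDiffNear f x)
    (h' : ContDiffNear g x) (l : List V) :
    dirDerivs l (fun y => (f y, g y)) x = (dirDerivs l f x, dirDerivs l g x) := by
  refine Prod.ext ?_ ?_
  · exact ((dirDerivs_clm_comp (ContinuousLinearMap.fst ℝ G G') (h.prodMk h') l).self_of_nhds).symm
  · exact ((dirDerivs_clm_comp (ContinuousLinearMap.snd ℝ G G') (h.prodMk h') l).self_of_nhds).symm

theorem contDiffNear_pi {ι : Type*} [Fintype ι] {f : ι → V → G} {x : V}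
    (h : ∀ i, ContDiffNear (f i) x) : ContDiffNear (fun y i => f i y) x := by
  filter_upwards [eventually_all.2 h] with y hy using contDiffAt_pi.2 hy

theorem dirDerivs_pi {ι : Type*} [Fintype ι] {f : ι → V → G} {x : V} (h : ∀ i, ContDiffNear (f i) x)
    (l : List V) : dirDerivs l (fun y i => f i y) x = fun i => dirDerivs l (f i) x := by
  funext i
  have h' := contDiffNear_pi h
  exact ((dirDerivs_clm_comp
    (ContinuousLinearMap.proj (R := ℝ) (φ := fun _ : ι => G) i) h' l).self_of_nhds).symm

theorem dirDerivs_sum {ι : Type*} (s : Finset ι) (c : ι → ℝ) {f : ι → V → G} {x : V}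
    (h : ∀ i ∈ s, ContDiffNear (f i) x) (l : List V) :
    dirDerivs l (fun y => ∑ i ∈ s, c i • f i y) =ᶠ[𝓝 x]
      fun y => ∑ i ∈ s, c i • dirDerivs l (f i) y := by
  induction l with
  | nil => exact EventuallyEq.rfl
  | cons v l ih =>
    have h' : ∀ᶠ y in 𝓝 x, ∀ i ∈ s, ContDiffAt ℝ ∞ (dirDerivs l (f i)) y :=
      (Filter.eventually_all_finset s).2 fun i hi => (h i hi).dirDerivs l
    filter_upwards [ih.eventuallyEq_nhds, h'] with y hy h1
    have h2 : HasFDerivAt (fun y => ∑ i ∈ s, c i • dirDerivs l (f i) y)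
        (∑ i ∈ s, c i • fderiv ℝ (dirDerivs l (f i)) y) y :=
      HasFDerivAt.fun_sum fun i hi =>
        (((h1 i hi).differentiableAt (by simp)).hasFDerivAt).const_smul (c i)
    rw [dirDerivs_cons, hy.fderiv_eq, h2.fderiv, _root_.sum_apply]
    rfl

theorem dirDerivs_sub {f g : V → G} {x : V} (hf : ContDiffNear f x) (hg : ContDiffNear g x)
    (l : List V) : dirDerivs l (fun y => f y - g y) =ᶠ[𝓝 x]
      fun y => dirDerivs l f y - dirDerivs l g y := by
  induction l with
  | nil => exact EventuallyEq.rfl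
  | cons v l ih =>
    filter_upwards [ih.eventuallyEq_nhds, hf.dirDerivs l, hg.dirDerivs l] with y hy h1 h2
    rw [dirDerivs_cons, hy.fderiv_eq, fderiv_fun_sub (h1.differentiableAt (by simp))
      (h2.differentiableAt (by simp))]
    rfl

/-- Iterated directional derivatives commute with affine substitutions. -/
theorem dirDerivs_comp_affine (A : W →L[ℝ] V) (z : V) {f : V → G} {u : W}
    (hf : ContDiffNear f (z + A u)) (l : List W) :
    dirDerivs l (fun w => f (z + A w)) =ᶠ[𝓝 u] fun w => dirDerivs (l.map A) f (z + A w) := by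
  have hc : ContinuousAt (fun w => z + A w) u := by fun_prop
  induction l with
  | nil => exact EventuallyEq.rfl
  | cons v l ih =>
    filter_upwards [ih.eventuallyEq_nhds, hc.eventually (hf.dirDerivs (l.map A))] with w hw h1
    rw [dirDerivs_cons, hw.fderiv_eq]
    have h2 : HasFDerivAt (fun w => z + A w) A w := A.hasFDerivAt.const_add z
    have h3 := ((h1.differentiableAt (by simp)).hasFDerivAt.comp w h2).fderiv
    change fderiv ℝ (dirDerivs (l.map A) f ∘ fun w => z + A w) w v = _
    rw [h3]
    rfl

theorem dirDerivs_swap (v w : V) {f : V → G} {x : V} (hf : ContDiffNear f x) :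
    dirDerivs [v, w] f =ᶠ[𝓝 x] dirDerivs [w, v] f := by
  filter_upwards [hf] with y hy
  have hs : IsSymmSndFDerivAt ℝ f y :=
    hy.isSymmSndFDerivAt (by simpa using (WithTop.coe_le_coe.2 le_top : ((2 : ℕ∞) : ℕ∞ω) ≤ ∞))
  have hd : DifferentiableAt ℝ (fderiv ℝ f) y :=
    (hy.fderiv_right (m := ∞) (by simp)).differentiableAt (by simp)
  simp only [dirDerivs_cons]
  have key : ∀ v w : V, fderiv ℝ (dirDerivs [w] f) y v = fderiv ℝ (fderiv ℝ f) y v w := by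
    intro v w
    change fderiv ℝ (fun x => fderiv ℝ f x w) y v = _
    rw [fderiv_clm_apply hd (differentiableAt_const w)]
    simp
  rw [key, key]
  exact hs v w

theorem dirDerivs_perm {l l' : List V} (h : l.Perm l') {f : V → G} {x : V}
    (hf : ContDiffNear f x) : dirDerivs l f =ᶠ[𝓝 x] dirDerivs l' f := by
  induction h with
  | nil => exact EventuallyEq.rfl
  | cons v _ ih =>
    filter_upwards [ih.eventuallyEq_nhds] with y hy
    rw [dirDerivs_cons, dirDerivs_cons, hy.fderiv_eq]
  | swap v w l =>
    exact dirDerivs_swap w v (hf.dirDerivs l)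
  | trans _ _ h1 h2 => exact h1.trans h2

/-- The iterated directional derivatives of a composition depend only on those of the inner map,
for sublists of the directions. -/
theorem dirDerivs_comp_congr (l : List V) :
    ∀ {E : Type*} [NormedAddCommGroup E] [NormedSpace ℝ E] (h : E → G) (f g : V → E) (x : V),
      ContDiffNear h (f x) → ContDiffNear f x → ContDiffNear g x →
      (∀ l', l'.Sublist l → dirDerivs l' f x = dirDerivs l' g x) →
      dirDerivs l (fun y => h (f y)) x = dirDerivs l (fun y => h (g y)) x := by
  induction l using List.reverseRecOn with
  | nil =>
    intro E _ _ h f g x _ _ _ hfg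
    have := hfg [] (List.nil_sublist _)
    simp only [dirDerivs_nil] at this ⊢
    rw [this]
  | append_singleton l v ih =>
    intro E _ _ h f g x hh hf hg hfg
    have h0 : f x = g x := hfg [] (List.nil_sublist _)
    set h1 : E × E → G := fun p => fderiv ℝ h p.1 p.2 with hh1
    have key : ∀ w : V → E, w x = f x → ContDiffNear w x →
        dirDerivs (l ++ [v]) (fun y => h (w y)) x
          = dirDerivs l (fun y => h1 (w y, fderiv ℝ w y v)) x := by
      intro w hw0 hw
      rw [dirDerivs_append]
      refine (dirDerivs_congr ?_ l).self_of_nhds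
      have hhw : ∀ᶠ y in 𝓝 x, ContDiffAt ℝ ∞ h (w y) := by
        apply hw.contDiffAt.continuousAt.eventually
        rw [hw0]; exact hh
      filter_upwards [hhw, hw] with y h2 h3
      have := ((h2.differentiableAt (by simp)).hasFDerivAt.comp y
        (h3.differentiableAt (by simp)).hasFDerivAt).fderiv
      change fderiv ℝ (h ∘ w) y v = _
      rw [this]; rfl
    rw [key f rfl hf, key g h0.symm hg]
    refine ih h1 (fun y => (f y, fderiv ℝ f y v)) (fun y => (g y, fderiv ℝ g y v)) x ?_
      (hf.prodMk (hf.fderiv_apply v)) (hg.prodMk (hg.fderiv_apply v)) ?_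
    · have : ∀ᶠ y in 𝓝 ((f x, fderiv ℝ f x v) : E × E), ContDiffAt ℝ ∞ h y.1 :=
        continuousAt_fst.eventually hh
      filter_upwards [this] with y hy
      have h2 : ContDiffAt ℝ ∞ (fderiv ℝ h) y.1 := hy.fderiv_right (m := ∞) (by simp)
      exact (h2.comp y contDiffAt_fst).clm_apply contDiffAt_snd
    · intro l' hl'
      rw [dirDerivs_prodMk hf (hf.fderiv_apply v), dirDerivs_prodMk hg (hg.fderiv_apply v),
        hfg l' (hl'.trans (List.sublist_append_left _ _))]
      have := hfg (l' ++ [v]) (hl'.append_right _)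
      rw [dirDerivs_append, dirDerivs_append] at this
      exact congrArg _ this

theorem mixedPartial_eq_dirDerivs {k : ℕ} (l : List (Fin k)) (g : (Fin k → ℝ) → ℝ) :
    mixedPartial l g = dirDerivs (l.map fun i => Pi.single i (1 : ℝ)) g := by
  induction l with
  | nil => rfl
  | cons i l ih => simp only [mixedPartial, ih]; rfl

theorem iteratedDeriv_eq_dirDerivs (n : ℕ) (g : ℝ → G) :
    iteratedDeriv n g = dirDerivs (List.replicate n 1) g := by
  induction n with
  | zero => simp
  | succ n ih => rw [iteratedDeriv_succ, ih]; rfl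

theorem iteratedDeriv_snd {f : V × ℝ → G} {v : V} {t : ℝ} (hf : ContDiffNear f (v, t)) (q : ℕ) :
    iteratedDeriv q (fun τ => f (v, τ)) t
      = dirDerivs (List.replicate q ((0, 1) : V × ℝ)) f (v, t) := by
  have := (dirDerivs_comp_affine (ContinuousLinearMap.inr ℝ V ℝ) (v, 0) (f := f) (u := t)
    (by simpa using hf) (List.replicate q 1)).self_of_nhds
  rw [iteratedDeriv_eq_dirDerivs]
  simpa using this

/-- An iterated partial derivative of a function of two real variables, as a derivative along
coordinate directions. -/
theorem iteratedDeriv_iteratedDeriv {f : ℝ × ℝ → G} {s t : ℝ} (hf : ContDiffNear f (s, t))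
    (p q : ℕ) :
    iteratedDeriv p (fun σ => iteratedDeriv q (fun τ => f (σ, τ)) t) s
      = dirDerivs (List.replicate p ((1, 0) : ℝ × ℝ) ++ List.replicate q (0, 1)) f (s, t) := by
  have h1 : ∀ᶠ σ in 𝓝 s, iteratedDeriv q (fun τ => f (σ, τ)) t
      = dirDerivs (List.replicate q ((0, 1) : ℝ × ℝ)) f (σ, t) := by
    have hc : ContinuousAt (fun σ : ℝ => (σ, t)) s := by fun_prop
    filter_upwards [hc.eventually hf.eventually_nhds] with σ hσ
    exact iteratedDeriv_snd hσ q
  rw [Filter.EventuallyEq.iteratedDeriv_eq _ h1, iteratedDeriv_eq_dirDerivs, dirDerivs_append]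
  have := (dirDerivs_comp_affine (ContinuousLinearMap.inl ℝ ℝ ℝ) (0, t)
      (f := dirDerivs (List.replicate q ((0, 1) : ℝ × ℝ)) f) (u := s)
      (by simpa using hf.dirDerivs _) (List.replicate p 1)).self_of_nhds
  simpa using this


/-- The binomial formula for `(∂_v - ∂_w)ᵏ`. -/
theorem dirDerivs_replicate_sub (v w : V) (k : ℕ) : ∀ {f : V → G} {x : V}, ContDiffNear f x →
    dirDerivs (List.replicate k (v - w)) f x = ∑ j ∈ Finset.range (k + 1),
      ((-1) ^ j * (k.choose j : ℝ)) •
        dirDerivs (List.replicate j w ++ List.replicate (k - j) v) f x := by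
  induction k with
  | zero => intro f x _; simp
  | succ k ih =>
    intro f x hf
    have e0 : List.replicate (k + 1) (v - w) = List.replicate k (v - w) ++ [v - w] :=
      List.replicate_succ'
    have e1 : dirDerivs [v - w] f =ᶠ[𝓝 x] fun y => dirDerivs [v] f y - dirDerivs [w] f y :=
      Eventually.of_forall fun y => map_sub (fderiv ℝ f y) v w
    rw [e0, dirDerivs_append, (dirDerivs_congr e1 _).self_of_nhds,
      (dirDerivs_sub (hf.dirDerivs [v]) (hf.dirDerivs [w]) _).self_of_nhds]
    beta_reduce
    rw [ih (hf.dirDerivs [v]), ih (hf.dirDerivs [w])]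
    have a1 : ∀ j ∈ Finset.range (k + 1),
        ((-1) ^ j * (k.choose j : ℝ)) •
          dirDerivs (List.replicate j w ++ List.replicate (k - j) v) (dirDerivs [v] f) x
        = ((-1) ^ j * (k.choose j : ℝ)) •
          dirDerivs (List.replicate j w ++ List.replicate (k + 1 - j) v) f x := by
      intro j hj
      have hj' : k + 1 - j = (k - j) + 1 := by
        have := Finset.mem_range.1 hj; omega
      rw [← dirDerivs_append, List.append_assoc, ← List.replicate_succ', hj']
    have a2 : ∀ j ∈ Finset.range (k + 1),
        ((-1) ^ j * (k.choose j : ℝ)) •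
          dirDerivs (List.replicate j w ++ List.replicate (k - j) v) (dirDerivs [w] f) x
        = ((-1) ^ j * (k.choose j : ℝ)) •
          dirDerivs (List.replicate (j + 1) w ++ List.replicate (k + 1 - (j + 1)) v) f x := by
      intro j hj
      rw [← dirDerivs_append]
      congr 1
      have hj' : k + 1 - (j + 1) = k - j := by omega
      rw [hj']
      refine (dirDerivs_perm ?_ hf).self_of_nhds
      rw [List.replicate_succ]
      exact (List.perm_append_comm (l₂ := [w])).trans (by simp)
    rw [Finset.sum_congr rfl a1, Finset.sum_congr rfl a2]
    set T : ℕ → G := fun j => dirDerivs (List.replicate j w ++ List.replicate (k + 1 - j) v) f x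
    change ∑ j ∈ Finset.range (k + 1), ((-1) ^ j * (k.choose j : ℝ)) • T j
      - ∑ j ∈ Finset.range (k + 1), ((-1) ^ j * (k.choose j : ℝ)) • T (j + 1)
      = ∑ j ∈ Finset.range (k + 1 + 1), ((-1) ^ j * ((k + 1).choose j : ℝ)) • T j
    have b1 : ∑ j ∈ Finset.range (k + 1), ((-1) ^ j * (k.choose j : ℝ)) • T j
        = ∑ j ∈ Finset.range (k + 1), ((-1) ^ (j + 1) * (k.choose (j + 1) : ℝ)) • T (j + 1)
          + T 0 := by
      have := Finset.sum_range_succ' (fun j => ((-1) ^ j * (k.choose j : ℝ)) • T j) (k + 1)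
      rw [Finset.sum_range_succ] at this
      simpa using this
    rw [b1, Finset.sum_range_succ' _ (k + 1), add_sub_right_comm, ← Finset.sum_sub_distrib]
    congr 1
    · refine Finset.sum_congr rfl fun j _ => ?_
      rw [← sub_smul]
      congr 1
      rw [Nat.choose_succ_succ]
      push_cast
      ring
    · simp

end dirDerivs

/-! ### Smooth maps near a point -/

section SmoothNear

variable {E : Type*} [NormedAddCommGroup E] [NormedSpace ℝ E] {H : Type*} [TopologicalSpace H]
  {I : ModelWithCorners ℝ E H} {N : Type*} [TopologicalSpace N] [ChartedSpace H N]
  {E' : Type*} [NormedAddCommGroup E'] [NormedSpace ℝ E'] {H' : Type*} [TopologicalSpace H']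
  {I' : ModelWithCorners ℝ E' H'} {N' : Type*} [TopologicalSpace N'] [ChartedSpace H' N']
  {V W G : Type*} [NormedAddCommGroup V] [NormedSpace ℝ V] [NormedAddCommGroup W]
  [NormedSpace ℝ W] [NormedAddCommGroup G] [NormedSpace ℝ G]

/-- `h` is a smooth map between manifolds on a neighbourhood of `x`. -/
def SmoothMapNear (I : ModelWithCorners ℝ E H) (I' : ModelWithCorners ℝ E' H') (h : N → N')
    (x : N) : Prop :=
  ∀ᶠ y in 𝓝 x, ContMDiffAt I I' ∞ h y

theorem SmoothNear.continuousAt {f : V → N} {u : V} (h : SmoothNear I f u) : ContinuousAt f u :=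
  h.self_of_nhds.continuousAt

theorem SmoothNear.eventually {f : V → N} {u : V} (h : SmoothNear I f u) :
    ∀ᶠ v in 𝓝 u, SmoothNear I f v :=
  h.eventually_nhds

theorem SmoothNear.congr {f g : V → N} {u : V} (h : SmoothNear I f u) (hfg : g =ᶠ[𝓝 u] f) :
    SmoothNear I g u := by
  filter_upwards [h, hfg.eventuallyEq_nhds] with y h1 h2 using h1.congr_of_eventuallyEq h2

theorem smoothNear_iff_contDiffNear {f : V → G} {u : V} :
    SmoothNear 𝓘(ℝ, G) f u ↔ ContDiffNear f u := by
  simp only [SmoothNear, ContDiffNear, contMDiffAt_iff_contDiffAt]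

theorem smoothMapNear_iff_contDiffNear {f : V → G} {u : V} :
    SmoothMapNear 𝓘(ℝ, V) 𝓘(ℝ, G) f u ↔ ContDiffNear f u := by
  simp only [SmoothMapNear, ContDiffNear, contMDiffAt_iff_contDiffAt]

theorem SmoothMapNear.comp_smoothNear {h : N → N'} {f : V → N} {u : V}
    (hh : SmoothMapNear I I' h (f u)) (hf : SmoothNear I f u) :
    SmoothNear I' (fun v => h (f v)) u := by
  filter_upwards [hf, hf.continuousAt.eventually hh] with y h1 h2 using ContMDiffAt.comp y h2 h1

theorem SmoothMapNear.comp {E'' : Type*} [NormedAddCommGroup E''] [NormedSpace ℝ E'']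
    {H'' : Type*} [TopologicalSpace H''] {I'' : ModelWithCorners ℝ E'' H''} {N'' : Type*}
    [TopologicalSpace N''] [ChartedSpace H'' N''] {g : N' → N''} {h : N → N'} {x : N}
    (hg : SmoothMapNear I' I'' g (h x)) (hh : SmoothMapNear I I' h x) :
    SmoothMapNear I I'' (fun y => g (h y)) x := by
  filter_upwards [hh, hh.self_of_nhds.continuousAt.eventually hg] with y h1 h2
    using ContMDiffAt.comp y h2 h1

theorem SmoothMapNear.comp_contDiffNear {h : N → G} {f : V → N} {u : V}
    (hh : SmoothMapNear I 𝓘(ℝ, G) h (f u)) (hf : SmoothNear I f u) :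
    ContDiffNear (fun v => h (f v)) u :=
  smoothNear_iff_contDiffNear.1 (hh.comp_smoothNear hf)

theorem SmoothMapNear.clm_comp {h : N → G} {x : N} (hh : SmoothMapNear I 𝓘(ℝ, G) h x)
    (l : G →L[ℝ] W) : SmoothMapNear I 𝓘(ℝ, W) (fun y => l (h y)) x :=
  (smoothMapNear_iff_contDiffNear.2 (contDiffNear_of_contDiff l.contDiff _)).comp hh

theorem SmoothNear.comp {f : V → N} {g : W → V} {w : W} (hf : SmoothNear I f (g w))
    (hg : ContDiffNear g w) : SmoothNear I (fun u => f (g u)) w :=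
  SmoothMapNear.comp_smoothNear (I := 𝓘(ℝ, V)) hf (smoothNear_iff_contDiffNear.2 hg)

theorem SmoothNear.eventually_mem_source {f : V → N} {u : V} {x : N} (hf : SmoothNear I f u)
    (hx : f u ∈ (extChartAt I x).source) : ∀ᶠ v in 𝓝 u, f v ∈ (extChartAt I x).source :=
  hf.continuousAt.eventually ((isOpen_extChartAt_source x).mem_nhds hx)

variable [IsManifold I ∞ N]

theorem smoothMapNear_extChartAt {x y : N} (hy : y ∈ (extChartAt I x).source) :
    SmoothMapNear I 𝓘(ℝ, E) (extChartAt I x) y := by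
  filter_upwards [(isOpen_extChartAt_source x).mem_nhds hy] with z hz
  exact contMDiffAt_extChartAt' (by simpa using hz)

theorem SmoothNear.contDiffNear_extChartAt {f : V → N} {u : V} {x : N} (hf : SmoothNear I f u)
    (hx : f u ∈ (extChartAt I x).source) : ContDiffNear (fun v => extChartAt I x (f v)) u :=
  (smoothMapNear_extChartAt hx).comp_contDiffNear hf

variable [I.Boundaryless]

theorem smoothNear_extChartAt_symm {x : N} {z : E} (hz : z ∈ (extChartAt I x).target) :
    SmoothNear I (extChartAt I x).symm z := by
  filter_upwards [(isOpen_extChartAt_target x).mem_nhds hz] with y hy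
  exact (contMDiffOn_extChartAt_symm x).contMDiffAt ((isOpen_extChartAt_target x).mem_nhds hy)

/-- A map into a manifold is smooth near a point if it is continuous there and smooth when read in
a chart. -/
theorem smoothNear_of_chart {f : V → N} {u : V} {x : N} (hc : ∀ᶠ v in 𝓝 u,
    f v ∈ (extChartAt I x).source) (hf : ContDiffNear (fun v => extChartAt I x (f v)) u) :
    SmoothNear I f u := by
  have h1 := (smoothNear_extChartAt_symm ((extChartAt I x).map_source hc.self_of_nhds)).comp
    (g := fun v => extChartAt I x (f v)) hf
  refine h1.congr ?_
  filter_upwards [hc] with v hv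
  exact ((extChartAt I x).left_inv hv).symm

end SmoothNear

/-! ### Jets and iterated jets -/

section Jets

variable {E : Type*} [NormedAddCommGroup E] [NormedSpace ℝ E] {H : Type*} [TopologicalSpace H]
  {I : ModelWithCorners ℝ E H} {N : Type*} [TopologicalSpace N] [ChartedSpace H N]
  {E' : Type*} [NormedAddCommGroup E'] [NormedSpace ℝ E'] {H' : Type*} [TopologicalSpace H']
  {I' : ModelWithCorners ℝ E' H'} {N' : Type*} [TopologicalSpace N'] [ChartedSpace H' N']
  {G : Type*} [NormedAddCommGroup G] [NormedSpace ℝ G] {k l : ℕ} {γ δ : ℝ → N}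

theorem jet_shift {t : ℝ} (h : SmoothNear I γ t) :
    jet k I γ t = jet k I (fun s => γ (t + s)) 0 := by
  rw [jet, jet, dif_pos h, dif_pos h.shift]
  congr 2
  funext s
  simp

theorem base_jet (h : SmoothNear I γ 0) : (jet k I γ 0).base = γ 0 := (Vel.rep_jet h).1

theorem iteratedDeriv_eq_of_jet_eq (hγ : SmoothNear I γ 0) (hδ : SmoothNear I δ 0)
    (h : jet k I γ 0 = jet k I δ 0) {F : N → G} (hF : SmoothMapNear I 𝓘(ℝ, G) F (γ 0)) {i : ℕ}
    (hi : i ≤ k) :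
    iteratedDeriv i (fun t => F (γ t)) 0 = iteratedDeriv i (fun t => F (δ t)) 0 := by
  have h0 : γ 0 = δ 0 := by rw [← base_jet (k := k) hγ, h, base_jet hδ]
  refine (SeparatingDual.eq_iff_forall_dual_eq (R := ℝ)).2 fun L => ?_
  rw [← iteratedDeriv_clm_comp L (hF.comp_contDiffNear hγ).contDiffAt,
    ← iteratedDeriv_clm_comp L ((h0 ▸ hF).comp_contDiffNear hδ).contDiffAt,
    ← (Vel.rep_jet (k := k) hγ).2 (fun x => L (F x)) (hF.clm_comp L) i hi, h,
    (Vel.rep_jet (k := k) hδ).2 (fun x => L (F x)) ((h0 ▸ hF).clm_comp L) i hi]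

theorem jet_congr {t : ℝ} (hγ : SmoothNear I γ t) (h : γ =ᶠ[𝓝 t] δ) :
    jet k I γ t = jet k I δ t := by
  have hδ := hγ.congr h.symm
  rw [jet_shift hγ, jet_shift hδ]
  have h' : (fun s => γ (t + s)) =ᶠ[𝓝 0] fun s => δ (t + s) := by
    have hc : ContinuousAt (fun s : ℝ => t + s) 0 := by fun_prop
    have h2 : ∀ᶠ y in 𝓝 (t + 0), γ y = δ y := by rwa [add_zero]
    exact hc.eventually h2
  refine Vel.jet_eq_of hγ.shift hδ.shift h'.self_of_nhds fun g _ α _ => ?_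
  exact (h'.fun_comp g).iteratedDeriv_eq α

theorem map_jet {h : N → N'} (hγ : SmoothNear I γ 0) (hh : SmoothMapNear I I' h (γ 0)) :
    (jet k I γ 0).map I' h = jet k I' (fun t => h (γ t)) 0 := by
  have h0 := base_jet (k := k) hγ
  rw [Vel.base] at h0
  refine Vel.jet_eq_of (SmoothMapNear.comp_smoothNear (by rwa [h0]) (Vel.smooth_rep _))
    (hh.comp_smoothNear hγ) (by rw [h0]) fun g hg α hα => ?_
  rw [h0] at hg
  exact (Vel.rep_jet hγ).2 (fun x => g (h x)) (SmoothMapNear.comp (I'' := 𝓘(ℝ, ℝ)) hg hh) α hα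

theorem proj_jet (hγ : SmoothNear I γ 0) (hl : l ≤ k) :
    (jet k I γ 0).proj l = jet l I γ 0 := by
  have h0 := base_jet (k := k) hγ
  rw [Vel.base] at h0
  refine Vel.jet_eq_of (Vel.smooth_rep _) hγ h0 fun g hg α hα => ?_
  rw [h0] at hg
  exact (Vel.rep_jet hγ).2 g hg α (hα.trans hl)

section chart

variable [IsManifold I ∞ N] [I.Boundaryless]

theorem jet_eq_of_chart {x : N} (hγ : SmoothNear I γ 0) (hδ : SmoothNear I δ 0)
    (h0 : γ 0 = δ 0) (hx : γ 0 ∈ (extChartAt I x).source)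
    (h : ∀ i ≤ k, iteratedDeriv i (fun t => extChartAt I x (γ t)) 0
      = iteratedDeriv i (fun t => extChartAt I x (δ t)) 0) :
    jet k I γ 0 = jet k I δ 0 := by
  rw [← Vel.ofCoords_coords (v := jet k I γ 0) (x := x) (by rwa [base_jet hγ]),
    ← Vel.ofCoords_coords (v := jet k I δ 0) (x := x) (by rwa [base_jet hδ, ← h0])]
  congr 1
  funext α
  rw [Vel.coords_jet hγ hx, Vel.coords_jet hδ (h0 ▸ hx), h α (by omega)]

end chart

/-! #### Iterated jets -/

variable {f g : (Fin k → ℝ) → N}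

/-- The coordinate directions with the indices in a list. -/
abbrev basisDirs (l : List (Fin k)) : List (Fin k → ℝ) := l.map fun i => Pi.single i 1

theorem iterJet_eq_mk (hf : SmoothNear I f 0) : iterJet I f = ITan.mk ⟨f, hf⟩ := by
  rw [iterJet, dif_pos hf]

theorem iterJet_eq_of (hf : SmoothNear I f 0) (hg : SmoothNear I g 0) (h0 : f 0 = g 0)
    (h : ∀ F : N → ℝ, SmoothMapNear I 𝓘(ℝ, ℝ) F (f 0) → ∀ l : List (Fin k), l.Nodup →
      dirDerivs (basisDirs l) (fun u => F (f u)) 0 = dirDerivs (basisDirs l) (fun u => F (g u)) 0) :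
    iterJet I f = iterJet I g := by
  rw [iterJet_eq_mk hf, iterJet_eq_mk hg]
  refine Quotient.sound ⟨h0, fun F hF l hl => ?_⟩
  rw [mixedPartial_eq_dirDerivs, mixedPartial_eq_dirDerivs]
  exact h F hF l hl

theorem apply_zero_of_iterJet_eq (hf : SmoothNear I f 0) (hg : SmoothNear I g 0)
    (h : iterJet I f = iterJet I g) : f 0 = g 0 := by
  rw [iterJet_eq_mk hf, iterJet_eq_mk hg] at h
  exact (Quotient.exact h).1

theorem dirDerivs_eq_of_iterJet_eq (hf : SmoothNear I f 0) (hg : SmoothNear I g 0)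
    (h : iterJet I f = iterJet I g) {F : N → G} (hF : SmoothMapNear I 𝓘(ℝ, G) F (f 0))
    {l : List (Fin k)} (hl : l.Nodup) :
    dirDerivs (basisDirs l) (fun u => F (f u)) 0 = dirDerivs (basisDirs l) (fun u => F (g u)) 0 := by
  have h0 := apply_zero_of_iterJet_eq hf hg h
  rw [iterJet_eq_mk hf, iterJet_eq_mk hg] at h
  refine (SeparatingDual.eq_iff_forall_dual_eq (R := ℝ)).2 fun L => ?_
  have h1 := (Quotient.exact h).2 (fun x => L (F x)) (hF.clm_comp L) l hl
  rw [mixedPartial_eq_dirDerivs, mixedPartial_eq_dirDerivs] at h1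
  have e1 := (dirDerivs_clm_comp L (hF.comp_contDiffNear hf) (basisDirs l)).self_of_nhds
  have e2 := (dirDerivs_clm_comp L ((h0 ▸ hF).comp_contDiffNear hg) (basisDirs l)).self_of_nhds
  exact e1.symm.trans (h1.trans e2)

theorem sublist_basisDirs {l : List (Fin k)} (hl : l.Nodup) {l' : List (Fin k → ℝ)}
    (h : l'.Sublist (basisDirs l)) : ∃ m : List (Fin k), m.Nodup ∧ l' = basisDirs m := by
  obtain ⟨m, hm, rfl⟩ := List.sublist_map_iff.1 h
  exact ⟨m, hl.sublist hm, rfl⟩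

/-- A criterion for the equality of iterated jets of two composite maps. -/
theorem iterJet_comp_eq_of {f g : (Fin k → ℝ) → G} {F : G → N} (hf : ContDiffNear f 0)
    (hg : ContDiffNear g 0) (hF : SmoothNear I F (f 0))
    (h : ∀ l : List (Fin k), l.Nodup → dirDerivs (basisDirs l) f 0 = dirDerivs (basisDirs l) g 0) :
    iterJet I (fun u => F (f u)) = iterJet I (fun u => F (g u)) := by
  have h0 : f 0 = g 0 := h [] List.nodup_nil
  refine iterJet_eq_of (hF.comp hf) (SmoothNear.comp (by rwa [← h0]) hg) (by rw [h0])
    fun Q hQ l hl => ?_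
  refine dirDerivs_comp_congr _ (fun x => Q (F x)) f g 0 (hQ.comp_contDiffNear hF) hf hg ?_
  intro l' hl'
  obtain ⟨m, hm, rfl⟩ := sublist_basisDirs hl hl'
  exact h m hm

theorem iterJet_congr (hf : SmoothNear I f 0) (h : f =ᶠ[𝓝 0] g) : iterJet I f = iterJet I g :=
  iterJet_eq_of hf (hf.congr h.symm) h.self_of_nhds fun F _ _ _ =>
    (dirDerivs_congr (h.fun_comp F) _).self_of_nhds

theorem ITan.exists_rep (X : ITan k I N) : SmoothNear I X.rep 0 ∧ iterJet I X.rep = X := by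
  refine ⟨(Quotient.out X).2, ?_⟩
  change iterJet I (Quotient.out X).1 = X
  rw [iterJet_eq_mk (Quotient.out X).2]
  exact Quotient.out_eq X

theorem map_iterJet {h : N → N'} (hf : SmoothNear I f 0) (hh : SmoothMapNear I I' h (f 0)) :
    (iterJet I f).map I' h = iterJet I' (fun u => h (f u)) := by
  obtain ⟨h1, h2⟩ := (iterJet I f).exists_rep
  have h0 := apply_zero_of_iterJet_eq h1 hf h2
  have hh' : SmoothMapNear I I' h ((iterJet I f).rep 0) := by rwa [h0]
  refine iterJet_eq_of (hh'.comp_smoothNear h1) (hh.comp_smoothNear hf) (by rw [h0])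
    fun F hF l hl => ?_
  exact dirDerivs_eq_of_iterJet_eq h1 hf h2 (SmoothMapNear.comp (I'' := 𝓘(ℝ, ℝ)) hF hh') hl

/-- The sum of the coordinates. -/
def sumCLM (k : ℕ) : (Fin k → ℝ) →L[ℝ] ℝ := ∑ i, ContinuousLinearMap.proj i

@[simp] theorem sumCLM_apply (u : Fin k → ℝ) : sumCLM k u = ∑ i, u i := by
  simp [sumCLM]

theorem map_sumCLM_basisDirs (l : List (Fin k)) :
    (basisDirs l).map (sumCLM k) = List.replicate l.length 1 := by
  rw [List.map_map]
  refine List.eq_replicate_iff.2 ⟨by simp, fun b hb => ?_⟩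
  obtain ⟨i, _, rfl⟩ := List.mem_map.1 hb
  simp

theorem dirDerivs_comp_sum {F : ℝ → G} (hF : ContDiffNear F 0) (l : List (Fin k)) :
    dirDerivs (basisDirs l) (fun u => F (∑ i, u i)) 0 = iteratedDeriv l.length F 0 := by
  have := (dirDerivs_comp_affine (sumCLM k) 0 (u := 0) (f := F) (by simpa using hF)
    (basisDirs l)).self_of_nhds
  rw [map_sumCLM_basisDirs] at this
  simpa [iteratedDeriv_eq_dirDerivs] using this

theorem contDiffNear_sum (u : Fin k → ℝ) : ContDiffNear (fun u : Fin k → ℝ => ∑ i, u i) u := by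
  apply contDiffNear_of_contDiff
  fun_prop

theorem SmoothNear.comp_sum (hγ : SmoothNear I γ 0) :
    SmoothNear I (fun u : Fin k → ℝ => γ (∑ i, u i)) 0 :=
  SmoothNear.comp (by simpa using hγ) (contDiffNear_sum 0)

theorem length_le_of_nodup {l : List (Fin k)} (h : l.Nodup) : l.length ≤ k := by
  simpa using h.length_le_card

theorem iota_jet (hγ : SmoothNear I γ 0) :
    (jet k I γ 0).iota = iterJet I (fun u => γ (∑ i, u i)) := by
  have h0 := base_jet (k := k) hγ
  rw [Vel.base] at h0
  refine iterJet_eq_of (Vel.smooth_rep _).comp_sum hγ.comp_sum (by simpa using h0)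
    fun F hF l hl => ?_
  have hF' : SmoothMapNear I 𝓘(ℝ, ℝ) F (γ 0) := by simpa [h0] using hF
  have hF'' : SmoothMapNear I 𝓘(ℝ, ℝ) F ((jet k I γ 0).rep 0) := by rwa [h0]
  rw [dirDerivs_comp_sum (F := fun t => F ((jet k I γ 0).rep t))
      (hF''.comp_contDiffNear (Vel.smooth_rep _)),
    dirDerivs_comp_sum (F := fun t => F (γ t)) (hF'.comp_contDiffNear hγ)]
  exact (Vel.rep_jet hγ).2 F hF' _ (length_le_of_nodup hl)

theorem iota_injective : Function.Injective (Vel.iota : Vel k I N → ITan k I N) := by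
  intro v w h
  rw [← Vel.jet_rep v, ← Vel.jet_rep w] at h ⊢
  have hv := v.smooth_rep
  have hw := w.smooth_rep
  rw [iota_jet hv, iota_jet hw] at h
  have h0 := apply_zero_of_iterJet_eq hv.comp_sum hw.comp_sum h
  simp only [Pi.zero_apply, Finset.sum_const_zero] at h0
  refine Vel.jet_eq_of hv hw h0 fun F hF α hα => ?_
  have := dirDerivs_eq_of_iterJet_eq hv.comp_sum hw.comp_sum h (G := ℝ) (F := F)
    (by simpa using (show SmoothMapNear I 𝓘(ℝ, ℝ) F (v.rep 0) from hF)) (l := (List.finRange k).take α)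
    ((List.nodup_finRange k).sublist (List.take_sublist _ _))
  rw [dirDerivs_comp_sum (F := fun t => F (v.rep t)) (SmoothMapNear.comp_contDiffNear hF hv),
    dirDerivs_comp_sum (F := fun t => F (w.rep t))
      (SmoothMapNear.comp_contDiffNear (h0 ▸ hF) hw)] at this
  simpa [hα] using this

end Jets

/-! ### Smooth maps into and out of the higher tangent bundles -/

section VelSmooth

variable {E : Type*} [NormedAddCommGroup E] [NormedSpace ℝ E] {H : Type*} [TopologicalSpace H]
  {I : ModelWithCorners ℝ E H} {N : Type*} [TopologicalSpace N] [ChartedSpace H N]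
  {E' : Type*} [NormedAddCommGroup E'] [NormedSpace ℝ E'] {H' : Type*} [TopologicalSpace H']
  {I' : ModelWithCorners ℝ E' H'} {N' : Type*} [TopologicalSpace N'] [ChartedSpace H' N']
  {V : Type*} [NormedAddCommGroup V] [NormedSpace ℝ V] {k l : ℕ}

theorem SmoothNear.curve {F : V × ℝ → N} {v : V} {t : ℝ} (hF : SmoothNear I F (v, t)) :
    SmoothNear I (fun t => F (v, t)) t :=
  SmoothNear.comp (g := fun t => (v, t)) hF
    (contDiffNear_of_contDiff (contDiff_const.prodMk contDiff_id) t)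

theorem SmoothNear.eventually_curve {F : V × ℝ → N} {v : V} {t : ℝ} (hF : SmoothNear I F (v, t)) :
    ∀ᶠ u in 𝓝 v, SmoothNear I F (u, t) := by
  have hc : ContinuousAt (fun u : V => (u, t)) v := by fun_prop
  exact hc.eventually hF.eventually

theorem coords_zero_eq (w : Vel k I N) : Vel.coords w.base w 0 = extChartAt I w.base w.base := by
  simp [Vel.coords, Vel.base]

theorem coords_base_mem (w : Vel k I N) :
    Vel.coords w.base w 0 ∈ (extChartAt I w.base).target := by
  rw [coords_zero_eq]
  exact mem_extChartAt_target _

/-- The curve in the chart at the base point of a velocity that represents the velocity with given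
adapted coordinates. -/
def chartCurve (I : ModelWithCorners ℝ E H) (x : N) (p : (Fin (k + 1) → E) × ℝ) : N :=
  (extChartAt I x).symm (polyCurve p.1 p.2)

theorem chartCurve_base (w : Vel k I N) :
    chartCurve I w.base (Vel.coords w.base w, 0) = w.base := by
  dsimp only [chartCurve]
  rw [polyCurve_zero, coords_zero_eq, extChartAt_to_inv]

variable [I.Boundaryless] [IsManifold I ∞ N]

theorem extChartAt_vel (w : Vel k I N) :
    extChartAt 𝓘(ℝ, Fin (k + 1) → E) w = Vel.chart k I w.base := by
  rw [extChartAt, OpenPartialHomeomorph.extend, modelWithCornersSelf_partialEquiv,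
    PartialEquiv.trans_refl]
  rfl

theorem extChartAt_vel_apply (w v : Vel k I N) :
    extChartAt 𝓘(ℝ, Fin (k + 1) → E) w v = Vel.coords w.base v := by
  rw [extChartAt_vel]; rfl

theorem mem_extChartAt_vel_source (w v : Vel k I N) :
    v ∈ (extChartAt 𝓘(ℝ, Fin (k + 1) → E) w).source ↔ v.base ∈ (extChartAt I w.base).source := by
  rw [extChartAt_vel]; rfl

theorem coords_jet_family {F : V × ℝ → N} {v : V} {x : N} (hF : SmoothNear I F (v, 0))
    (hx : F (v, 0) ∈ (extChartAt I x).source) :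
    (fun u => Vel.coords x (jet k I (fun t => F (u, t)) 0)) =ᶠ[𝓝 v] fun u α =>
      dirDerivs (List.replicate α ((0, 1) : V × ℝ)) (fun p => extChartAt I x (F p)) (u, 0) := by
  have hc : ContinuousAt (fun u : V => (u, (0 : ℝ))) v := by fun_prop
  filter_upwards [hF.eventually_curve, hc.eventually (hF.eventually_mem_source hx)] with u h1 h2
  funext α
  rw [Vel.coords_jet h1.curve h2]
  exact iteratedDeriv_snd (h1.contDiffNear_extChartAt h2) _

theorem contDiffNear_fst_zero {G : Type*} [NormedAddCommGroup G] [NormedSpace ℝ G] {F : V × ℝ → G}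
    {v : V} (hF : ContDiffNear F (v, 0)) : ContDiffNear (fun u => F (u, 0)) v :=
  ContDiffNear.comp (f := fun u => (u, (0 : ℝ))) hF
    (contDiffNear_of_contDiff (contDiff_id.prodMk contDiff_const) v)

/-- The jets of a smooth family of curves depend smoothly on the parameter. -/
theorem smoothNear_jet_family {F : V × ℝ → N} {v : V} (hF : SmoothNear I F (v, 0)) :
    SmoothNear 𝓘(ℝ, Fin (k + 1) → E) (fun u => jet k I (fun t => F (u, t)) 0) v := by
  have hb := base_jet (k := k) hF.curve
  have hx : F (v, 0) ∈ (extChartAt I (jet k I (fun t => F (v, t)) 0).base).source := by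
    rw [hb]; exact mem_extChartAt_source _
  have hc : ContinuousAt (fun u : V => (u, (0 : ℝ))) v := by fun_prop
  refine smoothNear_of_chart (x := jet k I (fun t => F (v, t)) 0) ?_ ?_
  · filter_upwards [hF.eventually_curve, hc.eventually (hF.eventually_mem_source hx)] with u h1 h2
    rw [mem_extChartAt_vel_source, base_jet h1.curve]
    exact h2
  · simp only [extChartAt_vel_apply]
    refine ContDiffNear.congr ?_ (coords_jet_family hF hx)
    exact contDiffNear_pi fun α =>
      contDiffNear_fst_zero ((hF.contDiffNear_extChartAt hx).dirDerivs _)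

theorem smoothNear_jet {γ : ℝ → N} {t : ℝ} (h : SmoothNear I γ t) :
    SmoothNear 𝓘(ℝ, Fin (k + 1) → E) (fun s => jet k I γ s) t := by
  have h1 : SmoothNear I (fun p : ℝ × ℝ => γ (p.1 + p.2)) (t, 0) :=
    SmoothNear.comp (by simpa using h)
      (contDiffNear_of_contDiff (contDiff_fst.add contDiff_snd) _)
  refine (smoothNear_jet_family (k := k) h1).congr ?_
  filter_upwards [h.eventually] with s hs
  exact jet_shift hs

theorem smoothNear_chartCurve {x : N} {y : Fin (k + 1) → E} (hy : y 0 ∈ (extChartAt I x).target) :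
    SmoothNear I (chartCurve I x) (y, 0) :=
  SmoothNear.comp (g := fun p : (Fin (k + 1) → E) × ℝ => polyCurve p.1 p.2)
    (smoothNear_extChartAt_symm (by simpa [polyCurve_zero] using hy))
    (contDiffNear_of_contDiff contDiff_polyCurve _)


/-- A map out of a higher tangent bundle is smooth near a velocity if it is so in adapted
coordinates. -/
theorem smoothMapNear_vel {w : Vel k I N} {Q : Vel k I N → N'}
    (h : SmoothNear I' (fun y => Q (jet k I (fun t => chartCurve I w.base (y, t)) 0))
      (Vel.coords w.base w)) :
    SmoothMapNear 𝓘(ℝ, Fin (k + 1) → E) I' Q w := by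
  have hw : w ∈ (extChartAt 𝓘(ℝ, Fin (k + 1) → E) w).source := mem_extChartAt_source w
  have h1 := smoothMapNear_extChartAt (I := 𝓘(ℝ, Fin (k + 1) → E)) hw
  rw [← extChartAt_vel_apply] at h
  have h2 := SmoothMapNear.comp (I' := 𝓘(ℝ, Fin (k + 1) → E)) h h1
  have h3 : ∀ᶠ v in 𝓝 w, Q v = Q (jet k I (fun t => chartCurve I w.base
      (extChartAt 𝓘(ℝ, Fin (k + 1) → E) w v, t)) 0) := by
    filter_upwards [(isOpen_extChartAt_source (I := 𝓘(ℝ, Fin (k + 1) → E)) w).mem_nhds hw] with v hv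
    rw [extChartAt_vel_apply]
    exact congrArg Q (Vel.ofCoords_coords ((mem_extChartAt_vel_source w v).1 hv)).symm
  filter_upwards [h2, h3.eventually_nhds] with v h4 h5 using h4.congr_of_eventuallyEq h5

theorem smoothMapNear_proj (hl : l ≤ k) (w : Vel k I N) :
    SmoothMapNear 𝓘(ℝ, Fin (k + 1) → E) 𝓘(ℝ, Fin (l + 1) → E) (Vel.proj l) w := by
  have hF := smoothNear_chartCurve (coords_base_mem w)
  refine smoothMapNear_vel ((smoothNear_jet_family (k := l) hF).congr ?_)
  filter_upwards [hF.eventually_curve] with y hy using proj_jet hy.curve hl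

variable [I'.Boundaryless] [IsManifold I' ∞ N']

theorem smoothMapNear_map {h : N → N'} {w : Vel k I N} (hh : SmoothMapNear I I' h w.base) :
    SmoothMapNear 𝓘(ℝ, Fin (k + 1) → E) 𝓘(ℝ, Fin (k + 1) → E') (Vel.map I' h) w := by
  have hF := smoothNear_chartCurve (coords_base_mem w)
  rw [← chartCurve_base w] at hh
  refine smoothMapNear_vel ((smoothNear_jet_family (k := k) (hh.comp_smoothNear hF)).congr ?_)
  have hc : ContinuousAt (fun y : Fin (k + 1) → E => chartCurve I w.base (y, 0))
      (Vel.coords w.base w) :=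
    ContinuousAt.comp (f := fun y : Fin (k + 1) → E => (y, (0 : ℝ))) hF.continuousAt (by fun_prop)
  filter_upwards [hF.eventually_curve, hc.eventually hh.eventually_nhds] with y hy h2
  exact map_jet hy.curve h2

theorem smoothMapNear_iteratedDeriv {h : N → ℝ} {w : Vel k I N}
    (hh : SmoothMapNear I 𝓘(ℝ, ℝ) h w.base) {q : ℕ} (hq : q ≤ k) :
    SmoothMapNear 𝓘(ℝ, Fin (k + 1) → E) 𝓘(ℝ, ℝ)
      (fun v : Vel k I N => iteratedDeriv q (fun t => h (v.rep t)) 0) w := by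
  have hF := smoothNear_chartCurve (coords_base_mem w)
  rw [← chartCurve_base w] at hh
  have h1 := hh.comp_contDiffNear hF
  refine smoothMapNear_vel (smoothNear_iff_contDiffNear.2
    (ContDiffNear.congr (contDiffNear_fst_zero (h1.dirDerivs (List.replicate q (0, 1)))) ?_))
  have hc : ContinuousAt (fun y : Fin (k + 1) → E => chartCurve I w.base (y, 0))
      (Vel.coords w.base w) :=
    ContinuousAt.comp (f := fun y : Fin (k + 1) → E => (y, (0 : ℝ))) hF.continuousAt (by fun_prop)
  filter_upwards [hF.eventually_curve, hc.eventually hh.eventually_nhds] with y hy h2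
  rw [(Vel.rep_jet hy.curve).2 h h2 q hq]
  exact iteratedDeriv_snd (SmoothMapNear.comp_contDiffNear h2 hy) q

/-! ### Jets of families of jets -/

/-- The jet `jʲ_s jˡ_t f(s, t)` at `s = t = 0`. -/
def nestedJet (j l : ℕ) (I : ModelWithCorners ℝ E H) [I.Boundaryless] [IsManifold I ∞ N]
    (f : ℝ → ℝ → N) : Vel j 𝓘(ℝ, Fin (l + 1) → E) (Vel l I N) :=
  jet j _ (fun s => jet l I (f s) 0) 0

/-- The mixed directions, `p` times the first and `q` times the second one. -/
abbrev biDirs (p q : ℕ) : List (ℝ × ℝ) := List.replicate p (1, 0) ++ List.replicate q (0, 1)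

variable {f g : ℝ → ℝ → N} {j : ℕ}

theorem SmoothNear.jet_uncurry (hf : SmoothNear I (Function.uncurry f) ((0, 0) : ℝ × ℝ)) :
    SmoothNear 𝓘(ℝ, Fin (l + 1) → E) (fun s => jet l I (f s) 0) 0 :=
  smoothNear_jet_family hf

theorem SmoothNear.eventually_uncurry
    (hf : SmoothNear I (Function.uncurry f) ((0, 0) : ℝ × ℝ)) :
    ∀ᶠ s in 𝓝 0, SmoothNear I (f s) 0 :=
  hf.eventually_curve.mono fun _ h => h.curve

theorem dirDerivs_eq_of_nestedJet_eq (hf : SmoothNear I (Function.uncurry f) ((0, 0) : ℝ × ℝ))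
    (hg : SmoothNear I (Function.uncurry g) ((0, 0) : ℝ × ℝ))
    (h : nestedJet j l I f = nestedJet j l I g) {F : N → ℝ}
    (hF : SmoothMapNear I 𝓘(ℝ, ℝ) F (f 0 0)) :
    f 0 0 = g 0 0 ∧ ∀ p ≤ j, ∀ q ≤ l,
      dirDerivs (biDirs p q) (fun z => F (Function.uncurry f z)) (0, 0)
        = dirDerivs (biDirs p q) (fun z => F (Function.uncurry g z)) (0, 0) := by
  have hf0 := hf.eventually_uncurry.self_of_nhds
  have hg0 := hg.eventually_uncurry.self_of_nhds
  have h0 : jet l I (f 0) 0 = jet l I (g 0) 0 := by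
    rw [← base_jet (k := j) (hf.jet_uncurry (l := l)), ← base_jet (k := j) hg.jet_uncurry]
    exact congrArg _ h
  have h00 : f 0 0 = g 0 0 := by
    rw [← base_jet (k := l) hf0, h0, base_jet hg0]
  refine ⟨h00, fun p hp q hq => ?_⟩
  have hF' : SmoothMapNear I 𝓘(ℝ, ℝ) F (jet l I (f 0) 0).base := by rwa [base_jet hf0]
  have key := iteratedDeriv_eq_of_jet_eq (hf.jet_uncurry (l := l)) hg.jet_uncurry h
    (smoothMapNear_iteratedDeriv hF' hq) hp
  have red : ∀ {f : ℝ → ℝ → N}, SmoothNear I (Function.uncurry f) ((0, 0) : ℝ × ℝ) →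
      SmoothMapNear I 𝓘(ℝ, ℝ) F (f 0 0) →
      iteratedDeriv p (fun s => iteratedDeriv q (fun t => F ((jet l I (f s) 0).rep t)) 0) 0
        = dirDerivs (biDirs p q) (fun z => F (Function.uncurry f z)) (0, 0) := by
    intro f hf hF
    rw [← iteratedDeriv_iteratedDeriv (SmoothMapNear.comp_contDiffNear hF hf)]
    apply Filter.EventuallyEq.iteratedDeriv_eq
    have hc : ContinuousAt (fun s : ℝ => f s 0) 0 :=
      ContinuousAt.comp (f := fun s : ℝ => (s, (0 : ℝ))) hf.continuousAt (by fun_prop)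
    filter_upwards [hf.eventually_uncurry, hc.eventually hF.eventually_nhds] with s hs h2
    exact (Vel.rep_jet hs).2 F h2 q hq
  rwa [red hf hF, red hg (h00 ▸ hF)] at key

theorem nestedJet_eq_of_chart {x : N} (hf : SmoothNear I (Function.uncurry f) ((0, 0) : ℝ × ℝ))
    (hg : SmoothNear I (Function.uncurry g) ((0, 0) : ℝ × ℝ)) (h0 : f 0 0 = g 0 0)
    (hx : x = f 0 0)
    (h : ∀ p ≤ j, ∀ q ≤ l,
      dirDerivs (biDirs p q) (fun z => extChartAt I x (Function.uncurry f z)) (0, 0)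
        = dirDerivs (biDirs p q) (fun z => extChartAt I x (Function.uncurry g z)) (0, 0)) :
    nestedJet j l I f = nestedJet j l I g := by
  have hf0 := hf.eventually_uncurry.self_of_nhds
  have hg0 := hg.eventually_uncurry.self_of_nhds
  have hxf : f 0 0 ∈ (extChartAt I x).source := by rw [hx]; exact mem_extChartAt_source _
  have hxg : g 0 0 ∈ (extChartAt I x).source := h0 ▸ hxf
  have hl0 : jet l I (f 0) 0 = jet l I (g 0) 0 := by
    refine jet_eq_of_chart hf0 hg0 h0 hxf fun q hq => ?_
    have e1 := iteratedDeriv_snd (hf.contDiffNear_extChartAt hxf) q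
    have e2 := iteratedDeriv_snd (hg.contDiffNear_extChartAt hxg) q
    exact e1.trans ((h 0 (Nat.zero_le _) q hq).trans e2.symm)
  have hb : (jet l I (f 0) 0).base = x := by rw [base_jet hf0, hx]
  refine jet_eq_of_chart (x := jet l I (f 0) 0) hf.jet_uncurry hg.jet_uncurry hl0
    (mem_extChartAt_source _) fun p hp => ?_
  simp only [extChartAt_vel_apply, hb]
  have red : ∀ {f : ℝ → ℝ → N}, SmoothNear I (Function.uncurry f) ((0, 0) : ℝ × ℝ) →
      f 0 0 ∈ (extChartAt I x).source →
      iteratedDeriv p (fun s => Vel.coords x (jet l I (f s) 0)) 0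
        = fun q : Fin (l + 1) =>
          dirDerivs (biDirs p q) (fun z => extChartAt I x (Function.uncurry f z)) (0, 0) := by
    intro f hf hx
    have e := (coords_jet_family (k := l) (F := Function.uncurry f) hf hx).iteratedDeriv_eq p
    refine e.trans ?_
    rw [iteratedDeriv_eq_dirDerivs]
    have hs := hf.contDiffNear_extChartAt hx
    rw [dirDerivs_pi fun q => contDiffNear_fst_zero (hs.dirDerivs _)]
    funext q
    rw [← iteratedDeriv_eq_dirDerivs, ← iteratedDeriv_iteratedDeriv hs]
    apply Filter.EventuallyEq.iteratedDeriv_eq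
    have hc : ContinuousAt (fun s : ℝ => (s, (0 : ℝ))) 0 := by fun_prop
    filter_upwards [hc.eventually hs.eventually_nhds] with s hs
    exact (iteratedDeriv_snd hs q).symm
  rw [red hf hxf, red hg hxg]
  funext q
  exact h p hp q (by omega)

theorem biProj_nestedJet {m n : ℕ} (hf : SmoothNear I (Function.uncurry f) ((0, 0) : ℝ × ℝ))
    (hm : m ≤ k) (hn : n ≤ k) :
    biProj m n (nestedJet k k I f) = nestedJet m n I f := by
  rw [biProj, nestedJet, proj_jet hf.jet_uncurry hm,
    map_jet hf.jet_uncurry (smoothMapNear_proj hn _)]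
  refine jet_congr ((smoothMapNear_proj hn _).comp_smoothNear hf.jet_uncurry) ?_
  filter_upwards [hf.eventually_uncurry] with s hs using proj_jet hs hn

theorem map_nestedJet {h : N → N'} (hf : SmoothNear I (Function.uncurry f) ((0, 0) : ℝ × ℝ))
    (hh : SmoothMapNear I I' h (f 0 0)) :
    (nestedJet j l I f).map 𝓘(ℝ, Fin (l + 1) → E') (Vel.map I' h)
      = nestedJet j l I' fun s t => h (f s t) := by
  have hf0 := hf.eventually_uncurry.self_of_nhds
  have hh' : SmoothMapNear I I' h (jet l I (f 0) 0).base := by rwa [base_jet hf0]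
  rw [nestedJet, map_jet hf.jet_uncurry (smoothMapNear_map hh')]
  refine jet_congr (SmoothMapNear.comp_smoothNear (f := fun s => jet l I (f s) 0)
    (smoothMapNear_map hh') hf.jet_uncurry) ?_
  have hc : ContinuousAt (fun s : ℝ => f s 0) 0 :=
    ContinuousAt.comp (f := fun s : ℝ => (s, (0 : ℝ))) hf.continuousAt (by fun_prop)
  filter_upwards [hf.eventually_uncurry, hc.eventually hh.eventually_nhds] with s hs h2
  exact map_jet hs h2

theorem iotaDouble_jet {γ : ℝ → N} (hγ : SmoothNear I γ 0) :
    (jet (2 * k) I γ 0).iotaDouble k = nestedJet k k I fun s t => γ (s + t) := by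
  set v := jet (2 * k) I γ 0 with hv
  have h0 : v.rep 0 = γ 0 := base_jet hγ
  have hs : ∀ {δ : ℝ → N}, SmoothNear I δ 0 →
      SmoothNear I (Function.uncurry fun s t => δ (s + t)) ((0, 0) : ℝ × ℝ) := fun hδ =>
    SmoothNear.comp (g := fun p : ℝ × ℝ => p.1 + p.2) (by simpa using hδ)
      (contDiffNear_of_contDiff (contDiff_fst.add contDiff_snd) _)
  have h1 : v.iotaDouble k = nestedJet k k I fun s t => v.rep (s + t) := by
    rw [Vel.iotaDouble, nestedJet]
    refine jet_congr (smoothNear_jet v.smooth_rep) ?_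
    filter_upwards [SmoothNear.eventually v.smooth_rep] with s h using jet_shift h
  rw [h1]
  refine nestedJet_eq_of_chart (x := γ 0) (hs v.smooth_rep) (hs hγ) (by simpa using h0)
    (by simpa using h0.symm) fun p hp q hq => ?_
  have red : ∀ {δ : ℝ → N}, SmoothNear I δ 0 → δ 0 = γ 0 →
      dirDerivs (biDirs p q)
        (fun z => extChartAt I (γ 0) (Function.uncurry (fun s t => δ (s + t)) z)) (0, 0)
        = iteratedDeriv (p + q) (fun t => extChartAt I (γ 0) (δ t)) 0 := by
    intro δ hδ hδ0
    have hx : δ 0 ∈ (extChartAt I (γ 0)).source := by rw [hδ0]; exact mem_extChartAt_source _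
    have := (dirDerivs_comp_affine
      (ContinuousLinearMap.fst ℝ ℝ ℝ + ContinuousLinearMap.snd ℝ ℝ ℝ) 0 (u := ((0, 0) : ℝ × ℝ))
      (f := fun t => extChartAt I (γ 0) (δ t)) (by simpa using hδ.contDiffNear_extChartAt hx)
      (biDirs p q)).self_of_nhds
    rw [iteratedDeriv_eq_dirDerivs]
    simpa [Function.uncurry_def] using this
  rw [red v.smooth_rep h0, red hγ rfl]
  exact iteratedDeriv_eq_of_jet_eq v.smooth_rep hγ (Vel.jet_rep v)
    (smoothMapNear_extChartAt (by rw [h0]; exact mem_extChartAt_source _)) (by omega)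

/-- The sums of the first `j` coordinates and of the remaining ones. -/
def biSum (k j : ℕ) : (Fin k → ℝ) →L[ℝ] ℝ × ℝ :=
  (∑ i : Fin k with i.val < j, ContinuousLinearMap.proj i).prod
    (∑ i : Fin k with j ≤ i.val, ContinuousLinearMap.proj i)

theorem biSum_apply (u : Fin k → ℝ) :
    biSum k j u = (∑ i : Fin k with i.val < j, u i, ∑ i : Fin k with j ≤ i.val, u i) := by
  simp [biSum, _root_.sum_apply]

theorem biSum_single (i : Fin k) :
    biSum k j (Pi.single i 1) = if i.val < j then (1, 0) else (0, 1) := by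
  rw [biSum_apply]
  split_ifs with h
  · refine Prod.ext ?_ ?_
    · simp [Pi.single_apply, h]
    · simp [Pi.single_apply, h]
  · refine Prod.ext ?_ ?_
    · simp [Pi.single_apply, h]
    · simp [Pi.single_apply, not_lt.1 h]

theorem biSum_add (u : Fin k → ℝ) : (biSum k j u).1 + (biSum k j u).2 = ∑ i, u i := by
  rw [biSum_apply]
  have := Finset.sum_filter_add_sum_filter_not Finset.univ (fun i : Fin k => i.val < j) u
  simpa [not_lt] using this

theorem map_biSum_perm (L : List (Fin k)) :
    ((basisDirs L).map (biSum k j)).Perm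
      (biDirs (L.filter (·.val < j)).length (L.filter (fun i => !decide (i.val < j))).length) := by
  have h1 : ((L.filter (·.val < j)) ++ (L.filter (fun i => !decide (i.val < j)))).Perm L :=
    List.filter_append_perm _ _
  refine ((h1.map _).map _).symm.trans ?_
  rw [List.map_append, List.map_append, biDirs]
  have e1 : ((L.filter (·.val < j)).map fun i => Pi.single i (1 : ℝ)).map (biSum k j)
      = List.replicate (L.filter (·.val < j)).length ((1, 0) : ℝ × ℝ) := by
    refine List.eq_replicate_iff.2 ⟨by simp, fun b hb => ?_⟩
    simp only [List.mem_map, List.mem_filter] at hb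
    obtain ⟨_, ⟨i, ⟨_, hi⟩, rfl⟩, rfl⟩ := hb
    rw [biSum_single, if_pos (by simpa using hi)]
  have e2 : ((L.filter (fun i => !decide (i.val < j))).map fun i => Pi.single i (1 : ℝ)).map (biSum k j)
      = List.replicate (L.filter (fun i => !decide (i.val < j))).length ((0, 1) : ℝ × ℝ) := by
    refine List.eq_replicate_iff.2 ⟨by simp, fun b hb => ?_⟩
    simp only [List.mem_map, List.mem_filter] at hb
    obtain ⟨_, ⟨i, ⟨_, hi⟩, rfl⟩, rfl⟩ := hb
    rw [biSum_single, if_neg (by simpa using hi)]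
  rw [e1, e2]

theorem length_filter_lt_le {L : List (Fin k)} (hL : L.Nodup) (j : ℕ) :
    (L.filter (·.val < j)).length ≤ j := by
  have h1 : ((L.filter (·.val < j)).map Fin.val).Nodup := (hL.filter _).map Fin.val_injective
  have h2 : (L.filter (·.val < j)).map Fin.val ⊆ List.range j := by
    intro a ha
    simp only [List.mem_map, List.mem_filter] at ha
    obtain ⟨i, ⟨_, hi⟩, rfl⟩ := ha
    simpa using hi
  simpa using (List.subperm_of_subset h1 h2).length_le

theorem length_filter_not_lt_le {L : List (Fin k)} (hL : L.Nodup) (j : ℕ) :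
    (L.filter (fun i => !decide (i.val < j))).length ≤ k - j := by
  have h1 : ((L.filter (fun i => !decide (i.val < j))).map Fin.val).Nodup :=
    (hL.filter _).map Fin.val_injective
  have h2 : (L.filter (fun i => !decide (i.val < j))).map Fin.val ⊆ List.range' j (k - j) := by
    intro a ha
    simp only [List.mem_map, List.mem_filter] at ha
    obtain ⟨i, ⟨_, hi⟩, rfl⟩ := ha
    have hi' : j ≤ i.val := by simpa using hi
    have := i.isLt
    rw [List.mem_range'_1]
    omega
  simpa using (List.subperm_of_subset h1 h2).length_le

theorem dirDerivs_comp_biSum {G : Type*} [NormedAddCommGroup G] [NormedSpace ℝ G] {F : ℝ × ℝ → G}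
    (hF : ContDiffNear F (0, 0)) (L : List (Fin k)) :
    dirDerivs (basisDirs L) (fun u => F (biSum k j u)) 0
      = dirDerivs (biDirs (L.filter (·.val < j)).length (L.filter (fun i => !decide (i.val < j))).length)
        F (0, 0) := by
  have := (dirDerivs_comp_affine (biSum k j) 0 (u := 0) (f := F)
    (by rw [map_zero, add_zero]; exact hF) (basisDirs L)).self_of_nhds
  rw [← (dirDerivs_perm (map_biSum_perm L) hF).self_of_nhds]
  simp only [zero_add, map_zero] at this
  exact this

theorem dirDerivs_finRange_comp_biSum {G : Type*} [NormedAddCommGroup G] [NormedSpace ℝ G]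
    {F : ℝ × ℝ → G} (hF : ContDiffNear F (0, 0)) (hj : j ≤ k) :
    dirDerivs (basisDirs (List.finRange k)) (fun u => F (biSum k j u)) 0
      = dirDerivs (biDirs j (k - j)) F (0, 0) := by
  rw [dirDerivs_comp_biSum hF]
  have h1 := length_filter_lt_le (List.nodup_finRange k) j
  have h2 := length_filter_not_lt_le (List.nodup_finRange k) j
  have h3 := (List.filter_append_perm (fun i : Fin k => i.val < j) (List.finRange k)).length_eq
  rw [List.length_append, List.length_finRange] at h3
  congr 2 <;> omega

theorem contDiffNear_biSum (u : Fin k → ℝ) : ContDiffNear (fun u => biSum k j u) u :=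
  contDiffNear_of_contDiff (biSum k j).contDiff u

theorem SmoothNear.comp_biSum (hf : SmoothNear I (Function.uncurry f) ((0, 0) : ℝ × ℝ)) :
    SmoothNear I (fun u => Function.uncurry f (biSum k j u)) 0 :=
  SmoothNear.comp (by rw [map_zero]; exact hf) (contDiffNear_biSum 0)

theorem biIota_nestedJet (hf : SmoothNear I (Function.uncurry f) ((0, 0) : ℝ × ℝ)) :
    biIota k j (k - j) (nestedJet j (k - j) I f)
      = iterJet I fun u => Function.uncurry f (biSum k j u) := by
  have hrw : ∀ f : ℝ → ℝ → N, (fun u : Fin k → ℝ =>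
      f (∑ i : Fin k with i.val < j, u i) (∑ i : Fin k with j ≤ i.val, u i))
      = fun u => Function.uncurry f (biSum k j u) := by
    intro f; funext u; rw [biSum_apply]; rfl
  have hex : ∃! X, ∃ g : ℝ → ℝ → N, SmoothNear I (Function.uncurry g) ((0, 0) : ℝ × ℝ) ∧
      nestedJet j (k - j) I f = jet j _ (fun s => jet (k - j) I (g s) 0) 0 ∧
      X = iterJet I (fun u : Fin k → ℝ =>
        g (∑ i : Fin k with i.val < j, u i) (∑ i : Fin k with j ≤ i.val, u i)) := by
    refine ⟨_, ⟨f, hf, rfl, rfl⟩, ?_⟩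
    rintro _ ⟨g, hg, h, rfl⟩
    rw [hrw, hrw]
    have h' : nestedJet j (k - j) I f = nestedJet j (k - j) I g := h
    have h00 := (dirDerivs_eq_of_nestedJet_eq hf hg h' (F := fun _ => 0)
      (Eventually.of_forall fun _ => contMDiffAt_const)).1
    refine iterJet_eq_of hg.comp_biSum hf.comp_biSum (by rw [map_zero]; exact h00.symm)
      fun F hF L hL => ?_
    have hF' : SmoothMapNear I 𝓘(ℝ, ℝ) F (g 0 0) := by rw [map_zero] at hF; exact hF
    have hF'' : SmoothMapNear I 𝓘(ℝ, ℝ) F (f 0 0) := by rwa [h00]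
    rw [dirDerivs_comp_biSum (F := fun z => F (Function.uncurry g z))
        (SmoothMapNear.comp_contDiffNear hF' hg),
      dirDerivs_comp_biSum (F := fun z => F (Function.uncurry f z))
        (SmoothMapNear.comp_contDiffNear hF'' hf)]
    exact ((dirDerivs_eq_of_nestedJet_eq hf hg h' hF'').2 _ (length_filter_lt_le hL j) _
      (length_filter_not_lt_le hL j)).symm
  rw [biIota, theUnique, dif_pos hex, ← hrw]
  exact hex.unique hex.choose_spec.1 ⟨f, hf, rfl, rfl⟩

end VelSmooth

/-! ### Jets in vector bundles -/

section JetsComp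

variable {E : Type*} [NormedAddCommGroup E] [NormedSpace ℝ E] {H : Type*} [TopologicalSpace H]
  {I : ModelWithCorners ℝ E H} {N : Type*} [TopologicalSpace N] [ChartedSpace H N]
  {G : Type*} [NormedAddCommGroup G] [NormedSpace ℝ G] {k : ℕ}

/-- A criterion for the equality of the jets of two composite curves. -/
theorem jet_comp_eq_of {c d : ℝ → G} {F : G → N} (hc : ContDiffNear c 0) (hd : ContDiffNear d 0)
    (hF : SmoothNear I F (c 0)) (h : ∀ i ≤ k, iteratedDeriv i c 0 = iteratedDeriv i d 0) :
    jet k I (fun t => F (c t)) 0 = jet k I (fun t => F (d t)) 0 := by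
  have h0 : c 0 = d 0 := by simpa using h 0 (Nat.zero_le _)
  refine Vel.jet_eq_of (hF.comp hc) (SmoothNear.comp (by rwa [← h0]) hd) (by rw [h0])
    fun Q hQ α hα => ?_
  exact iteratedDeriv_comp_congr k (fun x => Q (F x)) c d
    (SmoothMapNear.comp_contDiffNear hQ hF) hc hd h α hα

theorem iteratedDeriv_prodMk {G' : Type*} [NormedAddCommGroup G'] [NormedSpace ℝ G'] {c : ℝ → G}
    {d : ℝ → G'} {t : ℝ} (hc : ContDiffNear c t) (hd : ContDiffNear d t) (i : ℕ) :
    iteratedDeriv i (fun s => (c s, d s)) t = (iteratedDeriv i c t, iteratedDeriv i d t) := by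
  simp only [iteratedDeriv_eq_dirDerivs]
  exact dirDerivs_prodMk hc hd _

end JetsComp

section VectorBundle

variable {E : Type*} [NormedAddCommGroup E] [NormedSpace ℝ E] {H : Type*} [TopologicalSpace H]
  {I : ModelWithCorners ℝ E H} {M : Type*} [TopologicalSpace M] [ChartedSpace H M]
  {F : Type*} [NormedAddCommGroup F] [NormedSpace ℝ F] {Z : M → Type*}
  [TopologicalSpace (TotalSpace F Z)] [∀ x, AddCommGroup (Z x)] [∀ x, Module ℝ (Z x)]
  [∀ x, TopologicalSpace (Z x)] [FiberBundle F Z] [VectorBundle ℝ F Z]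
  {V : Type*} [NormedAddCommGroup V] [NormedSpace ℝ V] {k : ℕ} {x y : M}

/-- The vector at `y` with given fibre coordinate in the preferred trivialization at `x`. -/
def fibrePt (F : Type*) [NormedAddCommGroup F] [NormedSpace ℝ F] (Z : M → Type*)
    [TopologicalSpace (TotalSpace F Z)] [∀ x, AddCommGroup (Z x)] [∀ x, Module ℝ (Z x)]
    [∀ x, TopologicalSpace (Z x)] [FiberBundle F Z] [VectorBundle ℝ F Z] (x y : M) (q : F) :
    TotalSpace F Z :=
  ⟨y, (trivializationAt F Z x).symm y q⟩

/-- The fibre coordinate in the preferred trivialization at `x`. -/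
def fibreCoord (x : M) (p : TotalSpace F Z) : F := (trivializationAt F Z x p).2

theorem fibreCoord_fibrePt (hy : y ∈ (trivializationAt F Z x).baseSet) (q : F) :
    fibreCoord x (fibrePt F Z x y q) = q := by
  rw [fibreCoord, fibrePt, (trivializationAt F Z x).apply_mk_symm hy]

theorem fibrePt_fibreCoord {p : TotalSpace F Z} (hp : p.proj ∈ (trivializationAt F Z x).baseSet) :
    fibrePt F Z x p.proj (fibreCoord x p) = p := by
  rcases p with ⟨y, v⟩
  rw [fibrePt, fibreCoord]
  congr 1
  exact Bundle.Trivialization.symm_apply_apply_mk _ hp v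

variable [ContMDiffVectorBundle ∞ F Z I]

theorem smoothMapNear_totalSpace_proj (p : TotalSpace F Z) :
    SmoothMapNear (I.prod 𝓘(ℝ, F)) I (fun p : TotalSpace F Z => p.proj) p :=
  Eventually.of_forall fun _ => contMDiffAt_proj Z

theorem smoothMapNear_fibreCoord {p : TotalSpace F Z}
    (hp : p.proj ∈ (trivializationAt F Z x).baseSet) :
    SmoothMapNear (I.prod 𝓘(ℝ, F)) 𝓘(ℝ, F) (fibreCoord (Z := Z) x) p := by
  have ho : IsOpen (trivializationAt F Z x).source := (trivializationAt F Z x).open_source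
  have hp' : p ∈ (trivializationAt F Z x).source := (Trivialization.mem_source _).2 hp
  filter_upwards [ho.mem_nhds hp'] with v hv
  exact (((trivializationAt F Z x).contMDiffAt_iff (IB := I) (f := fun v => v) hv).1
    contMDiffAt_id).2

theorem smoothNear_fibrePt {f : V → M} {q : V → F} {u : V} (hf : SmoothNear I f u)
    (hx : f u ∈ (trivializationAt F Z x).baseSet) (hq : ContDiffNear q u) :
    SmoothNear (I.prod 𝓘(ℝ, F)) (fun v => fibrePt F Z x (f v) (q v)) u := by
  have h1 : ∀ᶠ v in 𝓝 u, f v ∈ (trivializationAt F Z x).baseSet :=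
    hf.continuousAt.eventually ((trivializationAt F Z x).open_baseSet.mem_nhds hx)
  filter_upwards [hf, hq, h1.eventually_nhds] with v h2 h3 h4
  refine ((trivializationAt F Z x).contMDiffAt_iff
    ((Trivialization.mem_source _).2 h4.self_of_nhds)).2 ⟨h2, ?_⟩
  refine (contMDiffAt_iff_contDiffAt.2 h3).congr_of_eventuallyEq ?_
  filter_upwards [h4] with w hw using fibreCoord_fibrePt hw _

/-- A smooth map into a vector bundle is determined near a point by its base map and its fibre
coordinate. -/
theorem SmoothNear.eventuallyEq_fibrePt {f : V → TotalSpace F Z} {u : V}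
    (hf : SmoothNear (I.prod 𝓘(ℝ, F)) f u) (hx : (f u).proj ∈ (trivializationAt F Z x).baseSet) :
    f =ᶠ[𝓝 u] fun v => fibrePt F Z x (f v).proj (fibreCoord x (f v)) := by
  have h1 : SmoothNear I (fun v => (f v).proj) u :=
    (smoothMapNear_totalSpace_proj (f u)).comp_smoothNear hf
  filter_upwards [h1.continuousAt.eventually
    ((trivializationAt F Z x).open_baseSet.mem_nhds hx)] with v hv
  exact (fibrePt_fibreCoord hv).symm

theorem map_jet_fibrePt {γ : ℝ → M} (hγ : SmoothNear I γ 0)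
    (hx : γ 0 ∈ (trivializationAt F Z x).baseSet) {q : ℝ → F} (hq : ContDiffNear q 0) :
    (jet k (I.prod 𝓘(ℝ, F)) (fun t => fibrePt F Z x (γ t) (q t)) 0).map I (fun p => p.proj)
      = jet k I γ 0 :=
  map_jet (smoothNear_fibrePt hγ hx hq) (smoothMapNear_totalSpace_proj _)

variable [IsManifold I ∞ M] [I.Boundaryless]

theorem smoothNear_fibrePt_symm {z : E × F} (hz : z.1 ∈ (extChartAt I x).target)
    (hx : (extChartAt I x).symm z.1 ∈ (trivializationAt F Z x).baseSet) :
    SmoothNear (I.prod 𝓘(ℝ, F))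
      (fun p : E × F => fibrePt F Z x ((extChartAt I x).symm p.1) p.2) z :=
  smoothNear_fibrePt (SmoothNear.comp (smoothNear_extChartAt_symm hz)
    (contDiffNear_of_contDiff contDiff_fst z)) hx (contDiffNear_of_contDiff contDiff_snd z)

theorem fibrePt_eventuallyEq {f : V → M} {u : V} (hf : SmoothNear I f u)
    (hx : f u ∈ (extChartAt I x).source) (q : V → F) :
    (fun v => fibrePt F Z x (f v) (q v)) =ᶠ[𝓝 u] fun v =>
      fibrePt F Z x ((extChartAt I x).symm (extChartAt I x (f v), q v).1)
        (extChartAt I x (f v), q v).2 := by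
  filter_upwards [hf.eventually_mem_source hx] with v hv
  simp only [(extChartAt I x).left_inv hv]

theorem jet_fibrePt_congr {γ δ : ℝ → M} (hγ : SmoothNear I γ 0) (hδ : SmoothNear I δ 0)
    (hx : γ 0 ∈ (extChartAt I x).source) (hx' : γ 0 ∈ (trivializationAt F Z x).baseSet)
    {q r : ℝ → F} (hq : ContDiffNear q 0) (hr : ContDiffNear r 0)
    (h : jet k I γ 0 = jet k I δ 0) (hqr : ∀ i ≤ k, iteratedDeriv i q 0 = iteratedDeriv i r 0) :
    jet k (I.prod 𝓘(ℝ, F)) (fun t => fibrePt F Z x (γ t) (q t)) 0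
      = jet k (I.prod 𝓘(ℝ, F)) (fun t => fibrePt F Z x (δ t) (r t)) 0 := by
  have h0 : γ 0 = δ 0 := by rw [← base_jet (k := k) hγ, h, base_jet hδ]
  rw [jet_congr (smoothNear_fibrePt hγ hx' hq) (fibrePt_eventuallyEq hγ hx q),
    jet_congr (smoothNear_fibrePt hδ (h0 ▸ hx') hr) (fibrePt_eventuallyEq hδ (h0 ▸ hx) r)]
  have hcγ := hγ.contDiffNear_extChartAt hx
  have hcδ := hδ.contDiffNear_extChartAt (h0 ▸ hx)
  refine jet_comp_eq_of (F := fun p : E × F => fibrePt F Z x ((extChartAt I x).symm p.1) p.2)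
    (hcγ.prodMk hq) (hcδ.prodMk hr) (smoothNear_fibrePt_symm ((extChartAt I x).map_source hx)
      (by dsimp only; rwa [(extChartAt I x).left_inv hx])) fun i hi => ?_
  rw [iteratedDeriv_prodMk hcγ hq, iteratedDeriv_prodMk hcδ hr, hqr i hi,
    iteratedDeriv_eq_of_jet_eq hγ hδ h (smoothMapNear_extChartAt hx) hi]

/-- The jet of the curve of vectors over `γ` whose fibre coordinate is the polynomial with
derivatives `q`. -/
def fibreJet (I : ModelWithCorners ℝ E H) (F : Type*) [NormedAddCommGroup F] [NormedSpace ℝ F]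
    (Z : M → Type*) [TopologicalSpace (TotalSpace F Z)] [∀ x, AddCommGroup (Z x)]
    [∀ x, Module ℝ (Z x)] [∀ x, TopologicalSpace (Z x)] [FiberBundle F Z] [VectorBundle ℝ F Z]
    (x : M) (γ : ℝ → M) (q : Fin (k + 1) → F) : Vel k (I.prod 𝓘(ℝ, F)) (TotalSpace F Z) :=
  jet k _ (fun t => fibrePt F Z x (γ t) (polyCurve q t)) 0

theorem contDiffNear_polyCurve (q : Fin (k + 1) → F) (t : ℝ) : ContDiffNear (polyCurve q) t :=
  contDiffNear_of_contDiff (contDiff_polyCurve' q) t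

theorem jet_fibrePt_eq_fibreJet {γ : ℝ → M} (hγ : SmoothNear I γ 0)
    (hx : γ 0 ∈ (extChartAt I x).source) (hx' : γ 0 ∈ (trivializationAt F Z x).baseSet)
    {q : ℝ → F} (hq : ContDiffNear q 0) :
    jet k (I.prod 𝓘(ℝ, F)) (fun t => fibrePt F Z x (γ t) (q t)) 0
      = fibreJet I F Z x γ fun i : Fin (k + 1) => iteratedDeriv i q 0 :=
  jet_fibrePt_congr hγ hγ hx hx' hq (contDiffNear_polyCurve _ _) rfl fun i hi =>
    (iteratedDeriv_polyCurve (fun i : Fin (k + 1) => iteratedDeriv i q 0) ⟨i, by omega⟩).symm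

theorem map_fibreJet {γ : ℝ → M} (hγ : SmoothNear I γ 0)
    (hx : γ 0 ∈ (trivializationAt F Z x).baseSet) (q : Fin (k + 1) → F) :
    (fibreJet I F Z x γ q).map I (fun p => p.proj) = jet k I γ 0 :=
  map_jet_fibrePt hγ hx (contDiffNear_polyCurve q 0)

theorem exists_eq_fibreJet {γ : ℝ → M} (hγ : SmoothNear I γ 0)
    (hx : γ 0 ∈ (extChartAt I x).source) (hx' : γ 0 ∈ (trivializationAt F Z x).baseSet)
    {w : Vel k (I.prod 𝓘(ℝ, F)) (TotalSpace F Z)} (hw : w.map I (fun p => p.proj) = jet k I γ 0) :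
    ∃ q : Fin (k + 1) → F, w = fibreJet I F Z x γ q := by
  have hr : SmoothNear (I.prod 𝓘(ℝ, F)) w.rep 0 := w.smooth_rep
  have hp : SmoothNear I (fun t => (w.rep t).proj) 0 :=
    (smoothMapNear_totalSpace_proj _).comp_smoothNear hr
  have hw' : jet k I (fun t => (w.rep t).proj) 0 = jet k I γ 0 := hw
  have h0 : (w.rep 0).proj = γ 0 := by rw [← base_jet (k := k) hγ, ← hw', base_jet hp]
  have hx1 : (w.rep 0).proj ∈ (trivializationAt F Z x).baseSet := by rwa [h0]
  have hq : ContDiffNear (fun t => fibreCoord x (w.rep t)) 0 :=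
    (smoothMapNear_fibreCoord hx1).comp_contDiffNear hr
  refine ⟨fun i => iteratedDeriv i (fun t => fibreCoord x (w.rep t)) 0, ?_⟩
  rw [← jet_fibrePt_eq_fibreJet hγ hx hx' hq]
  refine w.jet_rep.symm.trans ((jet_congr hr (hr.eventuallyEq_fibrePt hx1)).trans ?_)
  exact jet_fibrePt_congr hp hγ (by rwa [h0]) hx1 hq hq hw' fun _ _ => rfl

end VectorBundle

/-! ### Pairings in fibre coordinates -/

section Pairing

variable {E : Type*} [NormedAddCommGroup E] [NormedSpace ℝ E] {H : Type*} [TopologicalSpace H]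
  {I : ModelWithCorners ℝ E H} {M : Type*} [TopologicalSpace M] [ChartedSpace H M]
  [IsManifold I ∞ M] {V : Type*} [NormedAddCommGroup V] [NormedSpace ℝ V] {k : ℕ} {x y : M}

/-- The tangent vector at `y` with given fibre coordinate. -/
abbrev tanPt (I : ModelWithCorners ℝ E H) [IsManifold I ∞ M] (x y : M) (b : E) :
    TangentBundle I M :=
  fibrePt E (fun x : M => TangentSpace I x) x y b

/-- The covector at `y` with given fibre coordinate. -/
abbrev coPt (I : ModelWithCorners ℝ E H) [IsManifold I ∞ M] (x y : M) (q : E →L[ℝ] ℝ) :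
    CoTan I M :=
  fibrePt (E →L[ℝ] ℝ) (fun x : M => TangentSpace I x →L[ℝ] ℝ) x y q

theorem mem_baseSet_tan (hy : y ∈ (extChartAt I x).source) :
    y ∈ (trivializationAt E (fun x : M => TangentSpace I x) x).baseSet := by
  simpa using hy

theorem mem_baseSet_co (hy : y ∈ (extChartAt I x).source) :
    y ∈ (trivializationAt (E →L[ℝ] ℝ) (fun x : M => TangentSpace I x →L[ℝ] ℝ) x).baseSet := by
  rw [hom_trivializationAt_baseSet]
  exact ⟨mem_baseSet_tan hy, mem_univ _⟩

/-- The covector in `T*_y M` with given fibre coordinate. -/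
abbrev coVec (I : ModelWithCorners ℝ E H) [IsManifold I ∞ M] (x y : M) (q : E →L[ℝ] ℝ) :
    TangentSpace I y →L[ℝ] ℝ :=
  (trivializationAt (E →L[ℝ] ℝ) (fun x : M => TangentSpace I x →L[ℝ] ℝ) x).symm y q

/-- The tangent vector in `T_y M` with given fibre coordinate. -/
abbrev tanVec (I : ModelWithCorners ℝ E H) [IsManifold I ∞ M] (x y : M) (b : E) :
    TangentSpace I y :=
  (trivializationAt E (fun x : M => TangentSpace I x) x).symm y b

theorem coPt_eq (q : E →L[ℝ] ℝ) : coPt I x y q = ⟨y, coVec I x y q⟩ := rfl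

theorem fibreCoord_co (hy : y ∈ (extChartAt I x).source) (a : TangentSpace I y →L[ℝ] ℝ) (b : E) :
    fibreCoord x (⟨y, a⟩ : CoTan I M) b = a (tanVec I x y b) := by
  rw [fibreCoord, hom_trivializationAt_apply, ContinuousLinearMap.inCoordinates]
  simp [(trivializationAt E (fun x : M => TangentSpace I x) x).symmL_apply (R := ℝ)
    (mem_baseSet_tan hy)]

theorem tanVec_fibreCoord (hy : y ∈ (extChartAt I x).source) (b : TangentSpace I y) :
    tanVec I x y (fibreCoord x (⟨y, b⟩ : TangentBundle I M)) = b :=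
  Bundle.Trivialization.symm_apply_apply_mk _ (mem_baseSet_tan hy) b

theorem apply_eq_fibreCoord (hy : y ∈ (extChartAt I x).source) (a : TangentSpace I y →L[ℝ] ℝ)
    (b : TangentSpace I y) :
    a b = fibreCoord x (⟨y, a⟩ : CoTan I M) (fibreCoord x (⟨y, b⟩ : TangentBundle I M)) := by
  rw [fibreCoord_co hy, tanVec_fibreCoord hy]

theorem coVec_apply_tanVec (hy : y ∈ (extChartAt I x).source) (q : E →L[ℝ] ℝ) (b : E) :
    coVec I x y q (tanVec I x y b) = q b := by
  rw [← fibreCoord_co hy]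
  have := fibreCoord_fibrePt (mem_baseSet_co (I := I) hy) q
  exact congrArg (fun r : E →L[ℝ] ℝ => r b) this

theorem coVec_fibreCoord (hy : y ∈ (extChartAt I x).source) (a : TangentSpace I y →L[ℝ] ℝ) :
    coVec I x y (fibreCoord x (⟨y, a⟩ : CoTan I M)) = a :=
  Bundle.Trivialization.symm_apply_apply_mk _ (mem_baseSet_co hy) a

theorem coVec_sum (hy : y ∈ (extChartAt I x).source) {n : ℕ} (c : Fin n → ℝ)
    (q : Fin n → E →L[ℝ] ℝ) :
    coVec I x y (∑ j, c j • q j) = ∑ j, c j • coVec I x y (q j) := by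
  ext b
  obtain ⟨b, rfl⟩ : ∃ b', b = tanVec I x y b' := ⟨_, (tanVec_fibreCoord hy b).symm⟩
  rw [coVec_apply_tanVec hy, _root_.sum_apply, _root_.sum_apply]
  refine Finset.sum_congr rfl fun j _ => ?_
  exact congrArg (c j * ·) (coVec_apply_tanVec hy (q j) b).symm

theorem pairing_mk (a : TangentSpace I y →L[ℝ] ℝ) (b : TangentSpace I y) :
    pairing (⟨y, a⟩ : CoTan I M) (⟨y, b⟩ : TangentBundle I M) = a b := by
  rw [pairing, dif_pos rfl]

theorem pairing_coPt_tanPt (hy : y ∈ (extChartAt I x).source) (q : E →L[ℝ] ℝ) (b : E) :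
    pairing (coPt I x y q) (tanPt I x y b) = q b :=
  (pairing_mk _ _).trans (coVec_apply_tanVec hy q b)

/-! #### Lifted pairings -/

theorem smoothMapNear_coTau (p : CoTan I M) : SmoothMapNear (coModel I) I coTau p :=
  smoothMapNear_totalSpace_proj p

theorem smoothMapNear_tau (p : TangentBundle I M) : SmoothMapNear I.tangent I tau p :=
  smoothMapNear_totalSpace_proj p

theorem contDiffNear_fibreCoord_co {f : V → CoTan I M} {u : V} (hf : SmoothNear (coModel I) f u)
    (hx : (f u).proj ∈ (extChartAt I x).source) :
    ContDiffNear (fun v => fibreCoord x (f v)) u :=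
  (smoothMapNear_fibreCoord (mem_baseSet_co hx)).comp_contDiffNear hf

theorem contDiffNear_fibreCoord_tan {f : V → TangentBundle I M} {u : V}
    (hf : SmoothNear I.tangent f u) (hx : (f u).proj ∈ (extChartAt I x).source) :
    ContDiffNear (fun v => fibreCoord x (f v)) u :=
  (smoothMapNear_fibreCoord (mem_baseSet_tan hx)).comp_contDiffNear hf

theorem iterPairing_iterJet {f : (Fin k → ℝ) → M} {a : ∀ u, TangentSpace I (f u) →L[ℝ] ℝ}
    {b : ∀ u, TangentSpace I (f u)}
    (ha : SmoothNear (coModel I) (fun u => (⟨f u, a u⟩ : CoTan I M)) 0)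
    (hb : SmoothNear I.tangent (fun u => (⟨f u, b u⟩ : TangentBundle I M)) 0) :
    iterPairing (iterJet (coModel I) (fun u => (⟨f u, a u⟩ : CoTan I M)))
      (iterJet I.tangent (fun u => (⟨f u, b u⟩ : TangentBundle I M)))
      = dirDerivs (basisDirs (List.finRange k)) (fun u => a u (b u)) 0 := by
  have key : ∃! r, ∃ (f' : (Fin k → ℝ) → M) (a' : ∀ u, TangentSpace I (f' u) →L[ℝ] ℝ)
      (b' : ∀ u, TangentSpace I (f' u)),
      SmoothNear (coModel I) (fun u => (⟨f' u, a' u⟩ : CoTan I M)) 0 ∧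
      SmoothNear I.tangent (fun u => (⟨f' u, b' u⟩ : TangentBundle I M)) 0 ∧
      iterJet (coModel I) (fun u => (⟨f u, a u⟩ : CoTan I M))
        = iterJet (coModel I) (fun u => (⟨f' u, a' u⟩ : CoTan I M)) ∧
      iterJet I.tangent (fun u => (⟨f u, b u⟩ : TangentBundle I M))
        = iterJet I.tangent (fun u => (⟨f' u, b' u⟩ : TangentBundle I M)) ∧
      r = mixedPartial (List.finRange k) (fun u => a' u (b' u)) 0 := by
    refine ⟨_, ⟨f, a, b, ha, hb, rfl, rfl, rfl⟩, ?_⟩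
    rintro _ ⟨f', a', b', ha', hb', hA, hB, rfl⟩
    have h0 : f 0 = f' 0 := congrArg TotalSpace.proj (apply_zero_of_iterJet_eq ha ha' hA)
    have hx : f 0 ∈ (extChartAt I (f 0)).source := mem_extChartAt_source _
    have hx' : f' 0 ∈ (extChartAt I (f 0)).source := h0 ▸ hx
    have red : ∀ {f' : (Fin k → ℝ) → M} {a : ∀ u, TangentSpace I (f' u) →L[ℝ] ℝ}
        {b : ∀ u, TangentSpace I (f' u)},
        SmoothNear (coModel I) (fun u => (⟨f' u, a u⟩ : CoTan I M)) 0 →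
        f' 0 ∈ (extChartAt I (f 0)).source →
        (fun u => a u (b u)) =ᶠ[𝓝 0] fun u =>
          (fun p : (E →L[ℝ] ℝ) × E => p.1 p.2) (fibreCoord (f 0) (⟨f' u, a u⟩ : CoTan I M),
            fibreCoord (f 0) (⟨f' u, b u⟩ : TangentBundle I M)) := by
      intro f' a b ha hx
      have hs : SmoothNear I f' 0 := (smoothMapNear_coTau _).comp_smoothNear ha
      filter_upwards [hs.eventually_mem_source hx] with u hu using apply_eq_fibreCoord hu _ _
    rw [mixedPartial_eq_dirDerivs, mixedPartial_eq_dirDerivs,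
      (dirDerivs_congr (red ha hx) _).self_of_nhds, (dirDerivs_congr (red ha' hx') _).self_of_nhds]
    have c1 := contDiffNear_fibreCoord_co (x := f 0) ha hx
    have c2 := contDiffNear_fibreCoord_tan (x := f 0) hb hx
    have c1' := contDiffNear_fibreCoord_co (x := f 0) ha' hx'
    have c2' := contDiffNear_fibreCoord_tan (x := f 0) hb' hx'
    refine (dirDerivs_comp_congr _ (fun p : (E →L[ℝ] ℝ) × E => p.1 p.2) _ _ 0 ?_
      (c1.prodMk c2) (c1'.prodMk c2') ?_).symm
    · exact contDiffNear_of_contDiff (contDiff_fst.clm_apply contDiff_snd) _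
    · intro l hl
      obtain ⟨m, hm, rfl⟩ := sublist_basisDirs (List.nodup_finRange k) hl
      rw [dirDerivs_prodMk c1 c2, dirDerivs_prodMk c1' c2',
        dirDerivs_eq_of_iterJet_eq ha ha' hA (smoothMapNear_fibreCoord (mem_baseSet_co hx)) hm,
        dirDerivs_eq_of_iterJet_eq hb hb' hB (smoothMapNear_fibreCoord (mem_baseSet_tan hx)) hm]
  rw [iterPairing, theUnique, dif_pos key]
  refine key.unique key.choose_spec.1 ⟨f, a, b, ha, hb, rfl, rfl, ?_⟩
  rw [mixedPartial_eq_dirDerivs]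

theorem smoothNear_coPt {f : V → M} {q : V → E →L[ℝ] ℝ} {u : V} (hf : SmoothNear I f u)
    (hx : f u ∈ (extChartAt I x).source) (hq : ContDiffNear q u) :
    SmoothNear (coModel I) (fun v => coPt I x (f v) (q v)) u :=
  smoothNear_fibrePt hf (mem_baseSet_co hx) hq

theorem smoothNear_tanPt {f : V → M} {b : V → E} {u : V} (hf : SmoothNear I f u)
    (hx : f u ∈ (extChartAt I x).source) (hb : ContDiffNear b u) :
    SmoothNear I.tangent (fun v => tanPt I x (f v) (b v)) u :=
  smoothNear_fibrePt hf (mem_baseSet_tan hx) hb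

theorem iterPairing_fibrePt {f : (Fin k → ℝ) → M} {q : (Fin k → ℝ) → E →L[ℝ] ℝ}
    {b : (Fin k → ℝ) → E} (hf : SmoothNear I f 0) (hx : f 0 ∈ (extChartAt I x).source)
    (hq : ContDiffNear q 0) (hb : ContDiffNear b 0) :
    iterPairing (iterJet (coModel I) (fun u => coPt I x (f u) (q u)))
      (iterJet I.tangent (fun u => tanPt I x (f u) (b u)))
      = dirDerivs (basisDirs (List.finRange k)) (fun u => q u (b u)) 0 := by
  refine (iterPairing_iterJet (f := f) (a := fun u => coVec I x (f u) (q u))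
    (b := fun u => tanVec I x (f u) (b u)) (smoothNear_coPt hf hx hq)
    (smoothNear_tanPt hf hx hb)).trans ?_
  refine (dirDerivs_congr ?_ _).self_of_nhds
  filter_upwards [hf.eventually_mem_source hx] with u hu using coVec_apply_tanVec hu _ _

theorem velPairing_fibrePt {γ : ℝ → M} {q : ℝ → E →L[ℝ] ℝ} {b : ℝ → E} (hγ : SmoothNear I γ 0)
    (hx : γ 0 ∈ (extChartAt I x).source) (hq : ContDiffNear q 0) (hb : ContDiffNear b 0) :
    velPairing (jet k (coModel I) (fun t => coPt I x (γ t) (q t)) 0)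
      (jet k I.tangent (fun t => tanPt I x (γ t) (b t)) 0)
      = iteratedDeriv k (fun t => q t (b t)) 0 := by
  rw [velPairing, iota_jet (smoothNear_coPt hγ hx hq), iota_jet (smoothNear_tanPt hγ hx hb)]
  have h0 : (∑ i : Fin k, (0 : Fin k → ℝ) i) = 0 := by simp
  rw [iterPairing_fibrePt (f := fun u => γ (∑ i, u i)) (q := fun u => q (∑ i, u i))
    (b := fun u => b (∑ i, u i)) hγ.comp_sum (by rwa [h0])
    (ContDiffNear.comp (by rwa [h0]) (contDiffNear_sum 0))
    (ContDiffNear.comp (by rwa [h0]) (contDiffNear_sum 0)),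
    dirDerivs_comp_sum (F := fun t => q t (b t)) (hq.clm_apply hb), List.length_finRange]

variable [I.Boundaryless]

theorem linComb_fibrePt {n : ℕ} (c : Fin (n + 1) → ℝ) {f : (Fin k → ℝ) → M}
    {q : Fin (n + 1) → (Fin k → ℝ) → E →L[ℝ] ℝ} (hf : SmoothNear I f 0)
    (hx : f 0 ∈ (extChartAt I x).source) (hq : ∀ j, ContDiffNear (q j) 0) :
    linComb c (fun j => iterJet (coModel I) (fun u => coPt I x (f u) (q j u)))
      = iterJet (coModel I) (fun u => coPt I x (f u) (∑ j, c j • q j u)) := by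
  set X : Fin (n + 1) → ITan k (coModel I) (CoTan I M) :=
    fun j => iterJet (coModel I) (fun u => coPt I x (f u) (q j u)) with hX
  have hqs : ContDiffNear (fun u => ∑ j, c j • q j u) 0 := by
    filter_upwards [eventually_all.2 hq] with u hu
    exact ContDiffAt.sum fun j _ => (hu j).const_smul (c j)
  have main : ∀ (f' : (Fin k → ℝ) → M) (a : Fin (n + 1) → ∀ u, TangentSpace I (f' u) →L[ℝ] ℝ),
      (∀ j, SmoothNear (coModel I) (fun u => (⟨f' u, a j u⟩ : CoTan I M)) 0) →
      (∀ j, X j = iterJet (coModel I) (fun u => (⟨f' u, a j u⟩ : CoTan I M))) →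
      iterJet (coModel I) (fun u => (⟨f' u, ∑ j, c j • a j u⟩ : CoTan I M))
        = iterJet (coModel I) (fun u => coPt I x (f u) (∑ j, c j • q j u)) := by
    intro f' a ha hXa
    have hf' : SmoothNear I f' 0 := (smoothMapNear_coTau _).comp_smoothNear (ha 0)
    have hs := fun j => smoothNear_coPt hf hx (hq j)
    have h0 : f 0 = f' 0 := congrArg TotalSpace.proj (apply_zero_of_iterJet_eq (hs 0) (ha 0) (hXa 0))
    have hx' : f' 0 ∈ (extChartAt I x).source := h0 ▸ hx
    have hfa := fun j => contDiffNear_fibreCoord_co (x := x) (ha j) hx'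
    set F : E × (Fin (n + 1) → E →L[ℝ] ℝ) → CoTan I M := fun p =>
      coPt I x ((extChartAt I x).symm p.1) (∑ j, c j • p.2 j) with hF
    have e1 : (fun u => (⟨f' u, ∑ j, c j • a j u⟩ : CoTan I M)) =ᶠ[𝓝 0] fun u =>
        F (extChartAt I x (f' u), fun j => fibreCoord x (⟨f' u, a j u⟩ : CoTan I M)) := by
      filter_upwards [hf'.eventually_mem_source hx'] with u hu
      simp only [hF, (extChartAt I x).left_inv hu]
      rw [coPt_eq, coVec_sum hu]
      simp only [coVec_fibreCoord hu]
    have e2 : (fun u => coPt I x (f u) (∑ j, c j • q j u)) =ᶠ[𝓝 0] fun u =>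
        F (extChartAt I x (f u), fun j => q j u) := by
      filter_upwards [hf.eventually_mem_source hx] with u hu
      simp only [hF, (extChartAt I x).left_inv hu]
    have d1 := (hf'.contDiffNear_extChartAt hx').prodMk (contDiffNear_pi hfa)
    have d2 := (hf.contDiffNear_extChartAt hx).prodMk (contDiffNear_pi hq)
    have hFs : SmoothNear (coModel I) F
        (extChartAt I x (f' 0), fun j => fibreCoord x (⟨f' 0, a j 0⟩ : CoTan I M)) := by
      refine smoothNear_coPt (SmoothNear.comp (g := Prod.fst)
        (smoothNear_extChartAt_symm ((extChartAt I x).map_source hx'))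
        (contDiffNear_of_contDiff contDiff_fst _)) ?_ ?_
      · dsimp only; rwa [(extChartAt I x).left_inv hx']
      · apply contDiffNear_of_contDiff
        fun_prop
    have s1 := SmoothNear.comp (g := fun u => (extChartAt I x (f' u),
      fun j => fibreCoord x (⟨f' u, a j u⟩ : CoTan I M))) hFs d1
    rw [← iterJet_congr s1 e1.symm, iterJet_congr (smoothNear_coPt hf hx hqs) e2]
    refine iterJet_comp_eq_of d1 d2 hFs fun l hl => ?_
    rw [dirDerivs_prodMk (hf'.contDiffNear_extChartAt hx') (contDiffNear_pi hfa),
      dirDerivs_prodMk (hf.contDiffNear_extChartAt hx) (contDiffNear_pi hq),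
      dirDerivs_pi hfa, dirDerivs_pi hq]
    refine Prod.ext ?_ ?_
    · have hp : SmoothMapNear (coModel I) 𝓘(ℝ, E) (fun p : CoTan I M => extChartAt I x (coTau p))
          (coPt I x (f 0) (q 0 0)) :=
        SmoothMapNear.comp (smoothMapNear_extChartAt hx) (smoothMapNear_coTau _)
      exact (dirDerivs_eq_of_iterJet_eq (hs 0) (ha 0) (hXa 0) hp hl).symm
    · funext j
      have hp := smoothMapNear_fibreCoord (I := I) (p := coPt I x (f 0) (q j 0))
        (mem_baseSet_co hx)
      have e := dirDerivs_eq_of_iterJet_eq (hs j) (ha j) (hXa j) hp hl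
      refine e.symm.trans (dirDerivs_congr ?_ _).self_of_nhds
      filter_upwards [hf.eventually_mem_source hx] with u hu
      exact fibreCoord_fibrePt (mem_baseSet_co hu) _
  have hY : iterJet (coModel I) (fun u => coPt I x (f u) (∑ j, c j • q j u))
      = iterJet (coModel I) (fun u => (⟨f u, ∑ j, c j • coVec I x (f u) (q j u)⟩ : CoTan I M)) := by
    refine iterJet_congr (smoothNear_coPt hf hx hqs) ?_
    filter_upwards [hf.eventually_mem_source hx] with u hu
    rw [coPt_eq, coVec_sum hu]
  have key : ∃! Y, ∃ (f : (Fin k → ℝ) → M) (a : Fin (n + 1) → ∀ u, TangentSpace I (f u) →L[ℝ] ℝ),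
      (∀ j, SmoothNear (coModel I) (fun u => (⟨f u, a j u⟩ : CoTan I M)) 0) ∧
      (∀ j, X j = iterJet (coModel I) (fun u => (⟨f u, a j u⟩ : CoTan I M))) ∧
      Y = iterJet (coModel I) (fun u => (⟨f u, ∑ j, c j • a j u⟩ : CoTan I M)) := by
    refine ⟨_, ⟨f, fun j u => coVec I x (f u) (q j u),
      fun j => smoothNear_coPt hf hx (hq j), fun j => rfl, hY⟩, ?_⟩
    rintro _ ⟨f', a, h1, h2, rfl⟩
    exact main f' a h1 h2
  rw [linComb, theUnique, dif_pos key]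
  exact key.unique key.choose_spec.1 ⟨f, fun j u => coVec I x (f u) (q j u),
      fun j => smoothNear_coPt hf hx (hq j), fun j => rfl, hY⟩

/-! #### Nondegeneracy of the lifted pairing -/

/-- The jet of covectors over `γ` with given derivatives of the fibre coordinate. -/
abbrev coJet (I : ModelWithCorners ℝ E H) [IsManifold I ∞ M] (x : M) (γ : ℝ → M)
    (q : Fin (k + 1) → E →L[ℝ] ℝ) : Vel k (coModel I) (CoTan I M) :=
  fibreJet I (E →L[ℝ] ℝ) (fun x : M => TangentSpace I x →L[ℝ] ℝ) x γ q

/-- The jet of vectors over `γ` with given derivatives of the fibre coordinate. -/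
abbrev tanJet (I : ModelWithCorners ℝ E H) [IsManifold I ∞ M] (x : M) (γ : ℝ → M)
    (b : Fin (k + 1) → E) : Vel k I.tangent (TangentBundle I M) :=
  fibreJet I E (fun x : M => TangentSpace I x) x γ b

/-- The coordinate form of the lifted pairing. -/
theorem iteratedDeriv_polyCurve_apply {G : Type*} [NormedAddCommGroup G] [NormedSpace ℝ G]
    (q : Fin (k + 1) → G →L[ℝ] ℝ) (b : Fin (k + 1) → G) :
    iteratedDeriv k (fun t => polyCurve q t (polyCurve b t)) 0
      = ∑ i : Fin (k + 1), (k.choose i : ℝ) * q i (b (Fin.rev i)) := by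
  have h1 : (fun t => polyCurve q t (polyCurve b t)) = fun t => ∑ p : Fin (k + 1) × Fin (k + 1),
      (q p.1 (b p.2) / ((p.1 : ℕ).factorial * (p.2 : ℕ).factorial)) • t ^ ((p.1 : ℕ) + p.2) := by
    funext t
    rw [polyCurve, polyCurve, _root_.sum_apply, Fintype.sum_prod_type]
    refine Finset.sum_congr rfl fun i _ => ?_
    rw [map_sum]
    refine Finset.sum_congr rfl fun j _ => ?_
    rw [_root_.smul_apply, map_smul, smul_eq_mul, smul_eq_mul, smul_eq_mul, pow_add]
    have := Nat.factorial_ne_zero (i : ℕ)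
    have := Nat.factorial_ne_zero (j : ℕ)
    field_simp
  rw [h1, iteratedDeriv_eq_dirDerivs, (dirDerivs_sum _ _
    (fun p _ => contDiffNear_of_contDiff (by fun_prop) _) _).self_of_nhds]
  simp only [← iteratedDeriv_eq_dirDerivs]
  rw [Fintype.sum_prod_type]
  refine Finset.sum_congr rfl fun i _ => ?_
  rw [Finset.sum_eq_single (Fin.rev i)]
  · have hi : (i : ℕ) + (Fin.rev i : ℕ) = k := by rw [Fin.val_rev]; omega
    have hr : (Fin.rev i : ℕ) = k - i := by rw [Fin.val_rev]; omega
    rw [iteratedDeriv_fun_pow_zero, if_pos hi.symm, Nat.choose_eq_factorial_div_factorial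
      (by omega : (i : ℕ) ≤ k), Nat.cast_div (Nat.factorial_mul_factorial_dvd_factorial (by omega))
      (by positivity), hi, hr, smul_eq_mul]
    push_cast
    ring
  · intro j _ hj
    rw [iteratedDeriv_fun_pow_zero, if_neg, Nat.cast_zero, smul_zero]
    intro h
    dsimp only at h
    apply hj
    ext
    rw [Fin.val_rev]
    omega
  · simp

/-- The coefficients that represent a linear functional with respect to the lifted pairing. -/
def dualCoeff {G : Type*} [NormedAddCommGroup G] [NormedSpace ℝ G]
    (R : (Fin (k + 1) → G) →L[ℝ] ℝ) (i : Fin (k + 1)) : G →L[ℝ] ℝ :=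
  ((k.choose i : ℝ)⁻¹) • R.comp (ContinuousLinearMap.single ℝ (fun _ => G) (Fin.rev i))

theorem iteratedDeriv_dualCoeff {G : Type*} [NormedAddCommGroup G] [NormedSpace ℝ G]
    (R : (Fin (k + 1) → G) →L[ℝ] ℝ) (b : Fin (k + 1) → G) :
    iteratedDeriv k (fun t => polyCurve (dualCoeff R) t (polyCurve b t)) 0 = R b := by
  rw [iteratedDeriv_polyCurve_apply]
  have h1 : ∀ i : Fin (k + 1), (k.choose i : ℝ) * dualCoeff R i (b (Fin.rev i))
      = R (Pi.single (Fin.rev i) (b (Fin.rev i))) := by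
    intro i
    have : (k.choose i : ℝ) ≠ 0 := by
      exact_mod_cast (Nat.choose_pos (by omega : (i : ℕ) ≤ k)).ne'
    simp [dualCoeff, this]
  have h2 := Equiv.sum_comp Fin.revPerm (fun i => R (Pi.single i (b i)))
  simp only [Fin.revPerm_apply] at h2
  rw [Finset.sum_congr rfl fun i _ => h1 i, h2, ← map_sum, Finset.univ_sum_single]

theorem dualCoeff_unique {G : Type*} [NormedAddCommGroup G] [NormedSpace ℝ G]
    {R : (Fin (k + 1) → G) →L[ℝ] ℝ} {q : Fin (k + 1) → G →L[ℝ] ℝ}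
    (h : ∀ b, iteratedDeriv k (fun t => polyCurve q t (polyCurve b t)) 0 = R b) :
    q = dualCoeff R := by
  funext i
  ext e
  have h1 := h (Pi.single (Fin.rev i) e)
  rw [iteratedDeriv_polyCurve_apply, Finset.sum_eq_single i] at h1
  · have : (k.choose i : ℝ) ≠ 0 := by
      exact_mod_cast (Nat.choose_pos (by omega : (i : ℕ) ≤ k)).ne'
    simp only [Pi.single_eq_same] at h1
    simp only [dualCoeff, _root_.smul_apply, ContinuousLinearMap.comp_apply,
      ContinuousLinearMap.single_apply, smul_eq_mul]
    rw [← h1]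
    field_simp
  · intro j _ hj
    have : Fin.rev j ≠ Fin.rev i := fun h => hj (Fin.rev_injective h)
    simp [Pi.single_eq_of_ne this]
  · simp

theorem velPairing_coJet_tanJet {γ : ℝ → M} (hγ : SmoothNear I γ 0)
    (hx : γ 0 ∈ (extChartAt I x).source) (q : Fin (k + 1) → E →L[ℝ] ℝ) (b : Fin (k + 1) → E) :
    velPairing (coJet I x γ q) (tanJet I x γ b)
      = iteratedDeriv k (fun t => polyCurve q t (polyCurve b t)) 0 :=
  velPairing_fibrePt hγ hx (contDiffNear_polyCurve q 0) (contDiffNear_polyCurve b 0)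

theorem eq_coJet_dualCoeff {γ : ℝ → M} (hγ : SmoothNear I γ 0)
    (hx : γ 0 ∈ (extChartAt I x).source) {w : Vel k (coModel I) (CoTan I M)}
    (hw : w.map I coTau = jet k I γ 0) {R : (Fin (k + 1) → E) →L[ℝ] ℝ}
    (h : ∀ b, velPairing w (tanJet I x γ b) = R b) : w = coJet I x γ (dualCoeff R) := by
  obtain ⟨q, rfl⟩ := exists_eq_fibreJet hγ hx (mem_baseSet_co hx) hw
  rw [dualCoeff_unique fun b => (velPairing_coJet_tanJet hγ hx q b).symm.trans (h b)]

theorem velPairing_dualCoeff {γ : ℝ → M} (hγ : SmoothNear I γ 0)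
    (hx : γ 0 ∈ (extChartAt I x).source) (R : (Fin (k + 1) → E) →L[ℝ] ℝ) (b : Fin (k + 1) → E) :
    velPairing (coJet I x γ (dualCoeff R)) (tanJet I x γ b) = R b := by
  rw [velPairing_coJet_tanJet hγ hx, iteratedDeriv_dualCoeff]

theorem map_coJet {γ : ℝ → M} (hγ : SmoothNear I γ 0) (hx : γ 0 ∈ (extChartAt I x).source)
    (q : Fin (k + 1) → E →L[ℝ] ℝ) : (coJet I x γ q).map I coTau = jet k I γ 0 :=
  map_fibreJet hγ (mem_baseSet_co hx) q

theorem map_tanJet {γ : ℝ → M} (hγ : SmoothNear I γ 0) (hx : γ 0 ∈ (extChartAt I x).source)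
    (b : Fin (k + 1) → E) : (tanJet I x γ b).map I tau = jet k I γ 0 :=
  map_fibreJet hγ (mem_baseSet_tan hx) b

theorem exists_eq_tanJet {γ : ℝ → M} (hγ : SmoothNear I γ 0)
    (hx : γ 0 ∈ (extChartAt I x).source) {w : Vel k I.tangent (TangentBundle I M)}
    (hw : w.map I tau = jet k I γ 0) : ∃ b : Fin (k + 1) → E, w = tanJet I x γ b :=
  exists_eq_fibreJet hγ hx (mem_baseSet_tan hx) hw

end Pairing

/-! ### The canonical flip and its dual -/

section Velocity

variable {E : Type*} [NormedAddCommGroup E] [NormedSpace ℝ E] {H : Type*} [TopologicalSpace H]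
  {I : ModelWithCorners ℝ E H} {M : Type*} [TopologicalSpace M] [ChartedSpace H M]
  [IsManifold I ∞ M] {k : ℕ} {x : M}

theorem fibreCoord_tan {y : M} (hy : y ∈ (extChartAt I x).source) (b : TangentSpace I y) :
    fibreCoord x (⟨y, b⟩ : TangentBundle I M) = mfderiv I 𝓘(ℝ, E) (extChartAt I x) y b := by
  have h : fibreCoord x (⟨y, b⟩ : TangentBundle I M)
      = (trivializationAt E (TangentSpace I) x).continuousLinearMapAt ℝ y b := by
    rw [Bundle.Trivialization.continuousLinearMapAt_apply,
      Bundle.Trivialization.coe_linearMapAt_of_mem _ (mem_baseSet_tan hy)]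
    rfl
  rw [h]
  exact congrArg (fun A : TangentSpace I y →L[ℝ] E => A b)
    (TangentBundle.continuousLinearMapAt_trivializationAt (by simpa using hy))

theorem velocity_eq_tanPt [I.Boundaryless] {c : ℝ → M} {t : ℝ}
    (hc : ContMDiffAt 𝓘(ℝ, ℝ) I ∞ c t)
    (hx : c t ∈ (extChartAt I x).source) :
    velocity I c t = tanPt I x (c t) (deriv (fun s => extChartAt I x (c s)) t) := by
  have h1 : MDifferentiableAt 𝓘(ℝ, ℝ) I c t := hc.mdifferentiableAt (by simp)
  have h2 : MDifferentiableAt I 𝓘(ℝ, E) (extChartAt I x) (c t) :=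
    (smoothMapNear_extChartAt hx).self_of_nhds.mdifferentiableAt (by simp)
  have h3 : fibreCoord x (velocity I c t) = deriv (fun s => extChartAt I x (c s)) t := by
    rw [velocity, fibreCoord_tan hx]
    have h4 := mfderiv_comp t h2 h1
    rw [← fderiv_apply_one_eq_deriv, ← mfderiv_eq_fderiv]
    exact (congrArg (fun A => A (1 : ℝ)) h4).symm
  rw [← h3]
  exact (fibrePt_fibreCoord (p := velocity I c t) (mem_baseSet_tan hx)).symm

variable [I.Boundaryless]

theorem velocity_eventuallyEq {F : ℝ × ℝ → M} (hF : SmoothNear I F (0, 0))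
    (hx : F (0, 0) ∈ (extChartAt I x).source) :
    (fun t => velocity I (fun s => F (s, t)) 0) =ᶠ[𝓝 0] fun t =>
      tanPt I x (F (0, t)) (dirDerivs [((1, 0) : ℝ × ℝ)] (fun p => extChartAt I x (F p)) (0, t)) := by
  have hc : ContinuousAt (fun t : ℝ => ((0, t) : ℝ × ℝ)) 0 := by fun_prop
  filter_upwards [hc.eventually hF.eventually, hc.eventually (hF.eventually_mem_source hx)]
    with t h1 h2
  have h3 : SmoothNear I (fun s => F (s, t)) 0 :=
    SmoothNear.comp (g := fun s : ℝ => ((s, t) : ℝ × ℝ)) h1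
      (contDiffNear_of_contDiff (contDiff_id.prodMk contDiff_const) 0)
  rw [velocity_eq_tanPt h3.self_of_nhds h2]
  have h4 := (dirDerivs_comp_affine (ContinuousLinearMap.inl ℝ ℝ ℝ) (0, t) (u := 0)
    (f := fun p => extChartAt I x (F p)) (by simpa using h1.contDiffNear_extChartAt h2)
    [1]).self_of_nhds
  rw [← fderiv_apply_one_eq_deriv]
  simp only [ContinuousLinearMap.inl_apply, Prod.mk_add_mk, zero_add, add_zero, List.map_cons,
    List.map_nil] at h4
  exact congrArg _ h4

theorem deriv_coords_jet {F : ℝ × ℝ → M} (hF : SmoothNear I F (0, 0))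
    (hx : F (0, 0) ∈ (extChartAt I x).source) (α : Fin (k + 1)) :
    deriv (fun s => Vel.coords x (jet k I (fun t => F (s, t)) 0)) 0 α
      = iteratedDeriv α
        (fun t => dirDerivs [((1, 0) : ℝ × ℝ)] (fun p => extChartAt I x (F p)) (0, t)) 0 := by
  have hs := hF.contDiffNear_extChartAt hx
  have e1 := (coords_jet_family (k := k) hF hx).iteratedDeriv_eq 1
  rw [iteratedDeriv_one, iteratedDeriv_eq_dirDerivs,
    dirDerivs_pi fun q : Fin (k + 1) => contDiffNear_fst_zero (hs.dirDerivs _)] at e1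
  rw [e1, iteratedDeriv_snd (hs.dirDerivs _), ← dirDerivs_append]
  have h4 := (dirDerivs_comp_affine (ContinuousLinearMap.inl ℝ ℝ ℝ) (0, 0) (u := 0)
    (f := dirDerivs (List.replicate α ((0, 1) : ℝ × ℝ)) fun p => extChartAt I x (F p))
    (by simpa using hs.dirDerivs _) [1]).self_of_nhds
  simp only [ContinuousLinearMap.inl_apply, Prod.mk_add_mk, zero_add, add_zero, List.map_cons,
    List.map_nil] at h4
  refine h4.trans ?_
  rw [← dirDerivs_append]
  exact (dirDerivs_perm List.perm_append_comm hs).self_of_nhds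

theorem smoothNear_velocity {F : ℝ × ℝ → M} (hF : SmoothNear I F (0, 0)) :
    SmoothNear I.tangent (fun t => velocity I (fun s => F (s, t)) 0) 0 := by
  have hx := mem_extChartAt_source (I := I) (F (0, 0))
  refine (smoothNear_tanPt hF.curve hx ?_).congr (velocity_eventuallyEq hF hx)
  exact ((hF.contDiffNear_extChartAt hx).dirDerivs _).comp (f := fun t => ((0, t) : ℝ × ℝ))
    (contDiffNear_of_contDiff (contDiff_const.prodMk contDiff_id) 0)

/-- Two families of curves whose velocities along the first parameter have the same jet have jets
with the same velocity. -/
theorem velocity_jet_congr {F G : ℝ × ℝ → M} (hF : SmoothNear I F (0, 0))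
    (hG : SmoothNear I G (0, 0))
    (h : jet k I.tangent (fun t => velocity I (fun s => F (s, t)) 0) 0
      = jet k I.tangent (fun t => velocity I (fun s => G (s, t)) 0) 0) :
    velocity 𝓘(ℝ, Fin (k + 1) → E) (fun s => jet k I (fun t => F (s, t)) 0) 0
      = velocity 𝓘(ℝ, Fin (k + 1) → E) (fun s => jet k I (fun t => G (s, t)) 0) 0 := by
  have vF := smoothNear_velocity hF
  have vG := smoothNear_velocity hG
  have h0 : jet k I (fun t => F (0, t)) 0 = jet k I (fun t => G (0, t)) 0 := by
    have := congrArg (Vel.map I tau) h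
    rwa [map_jet vF (smoothMapNear_tau _), map_jet vG (smoothMapNear_tau _)] at this
  have h00 : F (0, 0) = G (0, 0) := by
    rw [← base_jet (k := k) hF.curve, h0, base_jet hG.curve]
  set w := jet k I (fun t => F (0, t)) 0 with hw
  have hb : w.base = F (0, 0) := base_jet hF.curve
  have hx : F (0, 0) ∈ (extChartAt I (F (0, 0))).source := mem_extChartAt_source _
  have hx' : G (0, 0) ∈ (extChartAt I (F (0, 0))).source := h00 ▸ hx
  have cF := smoothNear_jet_family (k := k) hF
  have cG := smoothNear_jet_family (k := k) hG
  rw [velocity_eq_tanPt (x := w) cF.self_of_nhds (mem_extChartAt_source _),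
    velocity_eq_tanPt (x := w) cG.self_of_nhds (by rw [← h0]; exact mem_extChartAt_source _), ← h0]
  congr 1
  simp only [extChartAt_vel_apply, hb]
  funext α
  rw [deriv_coords_jet hF hx, deriv_coords_jet hG hx']
  have red : ∀ {F' : ℝ × ℝ → M}, SmoothNear I F' (0, 0) →
      F' (0, 0) ∈ (extChartAt I (F (0, 0))).source →
      (fun t => fibreCoord (F (0, 0)) (velocity I (fun s => F' (s, t)) 0)) =ᶠ[𝓝 0] fun t =>
        dirDerivs [((1, 0) : ℝ × ℝ)] (fun p => extChartAt I (F (0, 0)) (F' p)) (0, t) := by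
    intro F' hF' hx
    filter_upwards [velocity_eventuallyEq hF' hx, hF'.curve.eventually_mem_source hx] with t h1 h2
    rw [h1]
    exact fibreCoord_fibrePt (mem_baseSet_tan h2) _
  rw [← (red hF hx).iteratedDeriv_eq, ← (red hG hx').iteratedDeriv_eq]
  exact iteratedDeriv_eq_of_jet_eq vF vG h (smoothMapNear_fibreCoord (mem_baseSet_tan hx))
    (by omega)

theorem canonicalFlip_jet {F : ℝ × ℝ → M} (hF : SmoothNear I F (0, 0)) :
    canonicalFlip (jet k I.tangent (fun t => velocity I (fun s => F (s, t)) 0) 0)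
      = velocity 𝓘(ℝ, Fin (k + 1) → E) (fun s => jet k I (fun t => F (s, t)) 0) 0 := by
  have hswap : ∀ {F : ℝ × ℝ → M}, SmoothNear I F (0, 0) →
      SmoothNear I (fun p : ℝ × ℝ => F (p.2, p.1)) (0, 0) := fun hF =>
    SmoothNear.comp (g := fun p : ℝ × ℝ => (p.2, p.1)) hF
      (contDiffNear_of_contDiff (contDiff_snd.prodMk contDiff_fst) _)
  have key : ∃! X : TangentBundle 𝓘(ℝ, Fin (k + 1) → E) (Vel k I M), ∃ f : ℝ → ℝ → M,
      SmoothNear I (Function.uncurry f) ((0, 0) : ℝ × ℝ) ∧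
      jet k I.tangent (fun t => velocity I (fun s => F (s, t)) 0) 0
        = jet k I.tangent (fun t => velocity I (fun s => f t s) 0) 0 ∧
      X = velocity _ (fun s => jet k I (fun t => f t s) 0) 0 := by
    refine ⟨_, ⟨fun t s => F (s, t), hswap hF, rfl, rfl⟩, ?_⟩
    rintro _ ⟨f, hf, h, rfl⟩
    exact (velocity_jet_congr hF (G := fun p => f p.2 p.1) (hswap hf) h).symm
  rw [canonicalFlip, theUnique, dif_pos key]
  exact key.unique key.choose_spec.1 ⟨fun t s => F (s, t), hswap hF, rfl, rfl⟩

/-- The canonical flip in adapted coordinates. -/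
theorem canonicalFlip_tanJet {γ : ℝ → M} (hγ : SmoothNear I γ 0)
    (hx : γ 0 ∈ (extChartAt I x).source) (b : Fin (k + 1) → E) :
    canonicalFlip (tanJet I x γ b) = velocity 𝓘(ℝ, Fin (k + 1) → E)
      (fun s => Vel.ofCoords I x (Vel.coords x (jet k I γ 0) + s • b)) 0 := by
  set y := Vel.coords x (jet k I γ 0) with hy
  have hy0 : y 0 = extChartAt I x (γ 0) := by
    rw [hy, Vel.coords_jet hγ hx]; simp
  have hyt : y 0 ∈ (extChartAt I x).target := by rw [hy0]; exact (extChartAt I x).map_source hx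
  have hF : SmoothNear I (fun p : ℝ × ℝ => chartCurve I x (y + p.1 • b, p.2)) (0, 0) := by
    refine SmoothNear.comp (f := chartCurve I x) (g := fun p : ℝ × ℝ => (y + p.1 • b, p.2)) ?_ ?_
    · simpa using smoothNear_chartCurve hyt
    · apply contDiffNear_of_contDiff
      fun_prop
  have hb : chartCurve I x (y, 0) = γ 0 := by
    dsimp only [chartCurve]
    rw [polyCurve_zero, hy0, (extChartAt I x).left_inv hx]
  have hx' : chartCurve I x (y + (0 : ℝ) • b, 0) ∈ (extChartAt I x).source := by
    rwa [zero_smul, add_zero, hb]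
  have hγ' : SmoothNear I (fun t => chartCurve I x (y, t)) 0 := (smoothNear_chartCurve hyt).curve
  have hV : tanJet I x γ b = jet k I.tangent
      (fun t => velocity I (fun s => chartCurve I x (y + s • b, t)) 0) 0 := by
    have h1 : jet k I γ 0 = jet k I (fun t => chartCurve I x (y, t)) 0 :=
      (Vel.ofCoords_coords (v := jet k I γ 0) (x := x) (by rwa [base_jet hγ])).symm
    rw [jet_congr (smoothNear_velocity hF) (velocity_eventuallyEq hF hx')]
    have h2 : (fun t => dirDerivs [((1, 0) : ℝ × ℝ)]
        (fun p => extChartAt I x (chartCurve I x (y + p.1 • b, p.2))) (0, t))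
        =ᶠ[𝓝 0] polyCurve b := by
      have hc : Continuous (fun p : ℝ × ℝ => polyCurve (y + p.1 • b) p.2) := by
        exact (contDiff_polyCurve (E := E) (k := k)).continuous.comp
          (f := fun p : ℝ × ℝ => ((y + p.1 • b, p.2) : (Fin (k + 1) → E) × ℝ)) (by fun_prop)
      have hev : ∀ᶠ p in 𝓝 ((0, 0) : ℝ × ℝ), polyCurve (y + p.1 • b) p.2
          ∈ (extChartAt I x).target := by
        refine hc.continuousAt.eventually ((isOpen_extChartAt_target x).mem_nhds ?_)
        simpa [polyCurve_zero] using hyt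
      have hct : ContinuousAt (fun t : ℝ => ((0, t) : ℝ × ℝ)) 0 := by fun_prop
      filter_upwards [hct.eventually hev.eventually_nhds] with t ht
      have h3 : (fun p : ℝ × ℝ => extChartAt I x (chartCurve I x (y + p.1 • b, p.2)))
          =ᶠ[𝓝 (0, t)] fun p => polyCurve (y + p.1 • b) p.2 := by
        filter_upwards [ht] with p hp using (extChartAt I x).right_inv hp
      rw [(dirDerivs_congr h3 _).self_of_nhds]
      have h4 : ∀ s t : ℝ, polyCurve (y + s • b) t = polyCurve y t + s • polyCurve b t := by
        intro s t
        simp only [polyCurve, Finset.smul_sum, ← Finset.sum_add_distrib, Pi.add_apply,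
          Pi.smul_apply, smul_add, smul_comm s]
      have h5 := (dirDerivs_comp_affine (ContinuousLinearMap.inl ℝ ℝ ℝ) (0, t) (u := 0)
        (f := fun p : ℝ × ℝ => polyCurve (y + p.1 • b) p.2)
        (contDiffNear_of_contDiff ((contDiff_polyCurve (E := E) (k := k)).comp
          (f := fun p : ℝ × ℝ => ((y + p.1 • b, p.2) : (Fin (k + 1) → E) × ℝ)) (by fun_prop)) _)
        [1]).self_of_nhds
      simp only [ContinuousLinearMap.inl_apply, Prod.mk_add_mk, zero_add, add_zero, List.map_cons,
        List.map_nil, h4] at h5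
      simp only [h4]
      rw [← h5, dirDerivs_cons, dirDerivs_nil, fderiv_apply_one_eq_deriv]
      have h6 : HasDerivAt (fun w : ℝ => polyCurve y t + w • polyCurve b t)
          ((1 : ℝ) • polyCurve b t) 0 := ((hasDerivAt_id 0).smul_const _).const_add _
      rw [h6.deriv, one_smul]
    have hd := ((hF.contDiffNear_extChartAt hx').dirDerivs [((1, 0) : ℝ × ℝ)]).comp
      (f := fun t : ℝ => ((0, t) : ℝ × ℝ))
      (contDiffNear_of_contDiff (contDiff_const.prodMk contDiff_id) 0)
    simp only [zero_smul, add_zero]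
    exact jet_fibrePt_congr hγ hγ' hx (mem_baseSet_tan hx) (contDiffNear_polyCurve b 0) hd h1
      fun i _ => (h2.iteratedDeriv_eq i).symm
  rw [hV, canonicalFlip_jet hF]
  rfl

theorem canonicalFlip_proj {γ : ℝ → M} (hγ : SmoothNear I γ 0)
    {V : Vel k I.tangent (TangentBundle I M)} (hV : V.map I tau = jet k I γ 0) :
    (canonicalFlip V).proj = jet k I γ 0 := by
  have hx := mem_extChartAt_source (I := I) (γ 0)
  obtain ⟨b, rfl⟩ := exists_eq_tanJet hγ hx hV
  rw [canonicalFlip_tanJet hγ hx, velocity]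
  dsimp only
  rw [zero_smul, add_zero]
  exact Vel.ofCoords_coords (by rwa [base_jet hγ])

/-! #### The differential of a Lagrangian -/

theorem smoothNear_ofCoords {y : Fin (k + 1) → E} (hy : y 0 ∈ (extChartAt I x).target) :
    SmoothNear 𝓘(ℝ, Fin (k + 1) → E) (fun y => (Vel.ofCoords I x y : Vel k I M)) y :=
  smoothNear_jet_family (smoothNear_chartCurve hy)

/-- The Lagrangian read in the adapted coordinates of the chart at `x`. -/
def localLagrangian (I : ModelWithCorners ℝ E H) (L : Vel k I M → ℝ) (x : M)
    (y : Fin (k + 1) → E) : ℝ :=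
  L (Vel.ofCoords I x y)

variable {L : Vel k I M → ℝ}

theorem contDiffNear_localLagrangian (hL : ContMDiff 𝓘(ℝ, Fin (k + 1) → E) 𝓘(ℝ, ℝ) ∞ L)
    {y : Fin (k + 1) → E} (hy : y 0 ∈ (extChartAt I x).target) :
    ContDiffNear (localLagrangian I L x) y :=
  SmoothMapNear.comp_contDiffNear (h := L) (f := fun y => Vel.ofCoords I x y)
    (Eventually.of_forall fun v => hL v) (smoothNear_ofCoords hy)

theorem pairing_differential (hL : ContMDiff 𝓘(ℝ, Fin (k + 1) → E) 𝓘(ℝ, ℝ) ∞ L)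
    {γ : ℝ → M} (hγ : SmoothNear I γ 0)
    (hx : γ 0 ∈ (extChartAt I x).source) (b : Fin (k + 1) → E) :
    pairing (differential L (jet k I γ 0)) (canonicalFlip (tanJet I x γ b))
      = fderiv ℝ (localLagrangian I L x) (Vel.coords x (jet k I γ 0)) b := by
  rw [canonicalFlip_tanJet hγ hx]
  set y := Vel.coords x (jet k I γ 0) with hy
  have hyt : y 0 ∈ (extChartAt I x).target := by
    have hy0 : y 0 = extChartAt I x (γ 0) := by
      rw [hy, Vel.coords_jet hγ hx]; simp
    rw [hy0]; exact (extChartAt I x).map_source hx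
  set c : ℝ → Vel k I M := fun s => Vel.ofCoords I x (y + s • b) with hc
  have hc0 : jet k I γ 0 = c 0 := by
    rw [hc]
    dsimp only
    rw [zero_smul, add_zero]
    exact (Vel.ofCoords_coords (by rwa [base_jet hγ])).symm
  have hcs : SmoothNear 𝓘(ℝ, Fin (k + 1) → E) c 0 := by
    refine SmoothNear.comp (g := fun s : ℝ => y + s • b)
      (by simpa using smoothNear_ofCoords hyt) ?_
    apply contDiffNear_of_contDiff
    fun_prop
  rw [hc0, differential, velocity]
  refine (pairing_mk (I := 𝓘(ℝ, Fin (k + 1) → E)) (y := c 0) _ _).trans ?_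
  have h1 := mfderiv_comp (0 : ℝ) ((hL (c 0)).mdifferentiableAt (by simp))
    (hcs.self_of_nhds.mdifferentiableAt (by simp))
  have h2 : fderiv ℝ (L ∘ c) 0 (1 : ℝ) = fderiv ℝ (localLagrangian I L x) y b := by
    have h3 : HasFDerivAt (localLagrangian I L x) (fderiv ℝ (localLagrangian I L x) y)
        (y + (0 : ℝ) • b) := by
      rw [zero_smul, add_zero]
      exact ((contDiffNear_localLagrangian hL hyt).contDiffAt.differentiableAt
        (by simp)).hasFDerivAt
    have h4 : HasDerivAt (fun s : ℝ => y + s • b) ((1 : ℝ) • b) 0 :=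
      ((hasDerivAt_id 0).smul_const b).const_add y
    have h5 := h3.comp_hasDerivAt (0 : ℝ) h4
    rw [one_smul] at h5
    rw [fderiv_apply_one_eq_deriv]
    exact h5.deriv
  rw [← h2, ← mfderiv_eq_fderiv]
  exact (congrArg (fun A => A (1 : ℝ)) h1).symm

theorem dualFlip_spec (hL : ContMDiff 𝓘(ℝ, Fin (k + 1) → E) 𝓘(ℝ, ℝ) ∞ L)
    {γ : ℝ → M} (hγ : SmoothNear I γ 0)
    (hx : γ 0 ∈ (extChartAt I x).source) :
    dualFlip (differential L (jet k I γ 0)) = coJet I x γ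
      (dualCoeff (fderiv ℝ (localLagrangian I L x) (Vel.coords x (jet k I γ 0)))) := by
  set R := fderiv ℝ (localLagrangian I L x) (Vel.coords x (jet k I γ 0)) with hR
  have key : ∃! w : Vel k (coModel I) (CoTan I M),
      w.map I coTau = (differential L (jet k I γ 0)).proj ∧
      ∀ V : Vel k I.tangent (TangentBundle I M), V.map I tau = (differential L (jet k I γ 0)).proj →
        pairing (differential L (jet k I γ 0)) (canonicalFlip V) = velPairing w V := by
    refine ⟨coJet I x γ (dualCoeff R), ⟨map_coJet hγ hx _, fun V hV => ?_⟩, ?_⟩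
    · obtain ⟨b, rfl⟩ := exists_eq_tanJet hγ hx hV
      rw [velPairing_dualCoeff hγ hx, pairing_differential hL hγ hx]
    · rintro w ⟨h1, h2⟩
      refine eq_coJet_dualCoeff hγ hx h1 fun b => ?_
      rw [← h2 _ (map_tanJet hγ hx b), pairing_differential hL hγ hx]
  rw [dualFlip, theUnique, dif_pos key]
  obtain ⟨h1, h2⟩ := key.choose_spec.1
  refine eq_coJet_dualCoeff hγ hx h1 fun b => ?_
  rw [← h2 _ (map_tanJet hγ hx b), pairing_differential hL hγ hx]

end Velocity

/-! ### Semi-holonomic vectors, forces and momenta -/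

section SemiHolonomic

variable {E : Type*} [NormedAddCommGroup E] [NormedSpace ℝ E] {H : Type*} [TopologicalSpace H]
  {I : ModelWithCorners ℝ E H} {M : Type*} [TopologicalSpace M] [ChartedSpace H M]
  [IsManifold I ∞ M] [I.Boundaryless] {m : ℕ} {x : M} {γ : ℝ → M} {q : ℝ × ℝ → E →L[ℝ] ℝ}

/-- The covector at `γ (s + t)` with fibre coordinate `q (s, t)`. -/
abbrev coFamily (I : ModelWithCorners ℝ E H) [IsManifold I ∞ M] (x : M) (γ : ℝ → M)
    (q : ℝ × ℝ → E →L[ℝ] ℝ) (s t : ℝ) : CoTan I M :=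
  coPt I x (γ (s + t)) (q (s, t))

theorem SmoothNear.comp_add (hγ : SmoothNear I γ 0) :
    SmoothNear I (fun z : ℝ × ℝ => γ (z.1 + z.2)) (0, 0) :=
  SmoothNear.comp (g := fun z : ℝ × ℝ => z.1 + z.2) (by simpa using hγ)
    (contDiffNear_of_contDiff (contDiff_fst.add contDiff_snd) _)

theorem smoothNear_coFamily (hγ : SmoothNear I γ 0) (hx : γ 0 ∈ (extChartAt I x).source)
    (hq : ContDiffNear q (0, 0)) :
    SmoothNear (coModel I) (Function.uncurry (coFamily I x γ q)) ((0, 0) : ℝ × ℝ) :=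
  smoothNear_coPt (f := fun z : ℝ × ℝ => γ (z.1 + z.2)) hγ.comp_add (by simpa using hx) hq

theorem combine_coFamily (hγ : SmoothNear I γ 0) (hx : γ 0 ∈ (extChartAt I x).source)
    (hq : ContDiffNear q (0, 0)) (c : ℕ → ℝ) :
    combine c (nestedJet m m (coModel I) (coFamily I x γ q))
      = iterJet (coModel I) (fun u : Fin m → ℝ => coPt I x (γ (∑ i, u i))
        (∑ j : Fin (m + 1), c j • q (biSum m j u))) := by
  have hP := smoothNear_coFamily hγ hx hq
  rw [combine]
  have h1 : ∀ j : Fin (m + 1), biIota m j (m - j) (biProj j (m - j)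
      (nestedJet m m (coModel I) (coFamily I x γ q)))
      = iterJet (coModel I) (fun u : Fin m → ℝ => coPt I x (γ (∑ i, u i)) (q (biSum m j u))) := by
    intro j
    rw [biProj_nestedJet hP (by omega) (by omega), biIota_nestedJet hP]
    congr 1
    funext u
    rw [← biSum_add (j := (j : ℕ)) u]
    rfl
  simp only [h1]
  refine linComb_fibrePt _ (f := fun u : Fin m → ℝ => γ (∑ i, u i))
    (q := fun j u => q (biSum m j u)) hγ.comp_sum (by simpa using hx) fun j => ?_
  exact ContDiffNear.comp (by rw [map_zero]; exact hq) (contDiffNear_biSum 0)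

theorem contDiffNear_comp_biSum {G : Type*} [NormedAddCommGroup G] [NormedSpace ℝ G]
    {F : ℝ × ℝ → G} (hF : ContDiffNear F (0, 0)) (j : ℕ) :
    ContDiffNear (fun u => F (biSum m j u)) 0 :=
  ContDiffNear.comp (by rw [map_zero]; exact hF) (contDiffNear_biSum 0)

theorem contDiffNear_sum_biSum (hq : ContDiffNear q (0, 0)) (c : ℕ → ℝ) :
    ContDiffNear (fun u => ∑ j : Fin (m + 1), c j • q (biSum m j u)) 0 := by
  filter_upwards [eventually_all.2 fun j : Fin (m + 1) => contDiffNear_comp_biSum hq (j : ℕ)]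
    with u hu
  exact ContDiffAt.sum fun j _ => (hu j).const_smul (c j)

theorem ContDiffNear.apply_add {b : ℝ → E} (hq : ContDiffNear q (0, 0)) (hb : ContDiffNear b 0) :
    ContDiffNear (fun z : ℝ × ℝ => q z (b (z.1 + z.2))) (0, 0) :=
  hq.clm_apply (ContDiffNear.comp (f := fun z : ℝ × ℝ => z.1 + z.2) (by simpa using hb)
    (contDiffNear_of_contDiff (contDiff_fst.add contDiff_snd) _))

/-- The lifted pairing of a combination of the projections of a semi-holonomic vector. -/
theorem iterPairing_combine {b : ℝ → E} (hγ : SmoothNear I γ 0)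
    (hx : γ 0 ∈ (extChartAt I x).source) (hq : ContDiffNear q (0, 0)) (hb : ContDiffNear b 0)
    (c : ℕ → ℝ) :
    iterPairing (combine c (nestedJet m m (coModel I) (coFamily I x γ q)))
      (jet m I.tangent (fun t => tanPt I x (γ t) (b t)) 0).iota
      = ∑ j ∈ Finset.range (m + 1), c j •
        dirDerivs (biDirs j (m - j)) (fun z : ℝ × ℝ => q z (b (z.1 + z.2))) (0, 0) := by
  have hqb := hq.apply_add hb
  rw [combine_coFamily hγ hx hq, iota_jet (smoothNear_tanPt hγ hx hb),
    iterPairing_fibrePt (f := fun u : Fin m → ℝ => γ (∑ i, u i)) (b := fun u => b (∑ i, u i))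
      hγ.comp_sum (by simpa using hx) (contDiffNear_sum_biSum hq c)
      (ContDiffNear.comp (by simpa using hb) (contDiffNear_sum 0))]
  have h1 : (fun u : Fin m → ℝ => (∑ j : Fin (m + 1), c j • q (biSum m j u)) (b (∑ i, u i)))
      = fun u => ∑ j : Fin (m + 1), c j •
        (fun z : ℝ × ℝ => q z (b (z.1 + z.2))) (biSum m j u) := by
    funext u
    rw [_root_.sum_apply]
    refine Finset.sum_congr rfl fun j _ => ?_
    rw [_root_.smul_apply]
    beta_reduce
    rw [biSum_add]
  rw [h1, (dirDerivs_sum _ _ (fun j _ => contDiffNear_comp_biSum hqb _) _).self_of_nhds,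
    Finset.sum_range (fun j => c j •
      dirDerivs (biDirs j (m - j)) (fun z : ℝ × ℝ => q z (b (z.1 + z.2))) (0, 0))]
  refine Finset.sum_congr rfl fun j _ => ?_
  rw [dirDerivs_finRange_comp_biSum hqb (by omega)]

/-- The alternating sum of the mixed derivatives of `⟨q(s, t), b(s + t)⟩` involves only `b(0)`. -/
theorem sum_dirDerivs_apply_add {b : ℝ → E} (hq : ContDiffNear q (0, 0)) (hb : ContDiffNear b 0) :
    ∑ j ∈ Finset.range (m + 1), ((-1) ^ j * (m.choose j : ℝ)) •
        dirDerivs (biDirs j (m - j)) (fun z : ℝ × ℝ => q z (b (z.1 + z.2))) (0, 0)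
      = dirDerivs (List.replicate m ((0, 1) - (1, 0) : ℝ × ℝ)) q (0, 0) (b 0) := by
  have hqb := hq.apply_add hb
  rw [← dirDerivs_replicate_sub _ _ m hqb]
  set A : ℝ →L[ℝ] ℝ × ℝ := ContinuousLinearMap.toSpanSingleton ℝ ((0, 1) - (1, 0) : ℝ × ℝ) with hA
  have hA1 : A 1 = (0, 1) - (1, 0) := by simp [hA]
  have hsum : ∀ r, (A r).1 + (A r).2 = 0 := by intro r; simp [hA]
  have h1 := (dirDerivs_comp_affine A 0 (u := 0) (f := fun z : ℝ × ℝ => q z (b (z.1 + z.2)))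
    (by rw [map_zero, add_zero]; exact hqb) (List.replicate m 1)).self_of_nhds
  have h2 := (dirDerivs_comp_affine A 0 (u := 0) (f := q)
    (by rw [map_zero, add_zero]; exact hq) (List.replicate m 1)).self_of_nhds
  simp only [zero_add, map_zero, List.map_replicate, hA1, hsum] at h1 h2
  have hqA : ContDiffNear (fun r => q (A r)) 0 :=
    ContDiffNear.comp (by rw [map_zero]; exact hq) (contDiffNear_of_contDiff A.contDiff 0)
  have h3 := (dirDerivs_clm_comp (ContinuousLinearMap.apply ℝ ℝ (b 0)) hqA
    (List.replicate m 1)).self_of_nhds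
  refine h1.symm.trans (h3.trans ?_)
  exact congrArg (fun T : E →L[ℝ] ℝ => T (b 0)) h2

theorem isSemiHolonomicOver_coFamily (hγ : SmoothNear I γ 0) (hx : γ 0 ∈ (extChartAt I x).source)
    (hq : ContDiffNear q (0, 0)) :
    IsSemiHolonomicOver (nestedJet m m (coModel I) (coFamily I x γ q)) (jet (2 * m) I γ 0) := by
  rw [IsSemiHolonomicOver, iotaDouble_jet hγ]
  exact map_nestedJet (smoothNear_coFamily hγ hx hq) (smoothMapNear_coTau _)

theorem IsSemiHolonomicOver.proj_eq (hγ : SmoothNear I γ 0) (hx : γ 0 ∈ (extChartAt I x).source)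
    (hq : ContDiffNear q (0, 0)) {v : Vel (2 * m) I M}
    (hv : IsSemiHolonomicOver (nestedJet m m (coModel I) (coFamily I x γ q)) v) :
    v.proj m = jet m I γ 0 := by
  have h1 := isSemiHolonomicOver_coFamily (m := m) hγ hx hq
  rw [IsSemiHolonomicOver] at hv h1
  have h2 := congrArg Vel.base (hv.symm.trans h1)
  rw [iotaDouble_jet hγ, Vel.iotaDouble, base_jet (smoothNear_jet v.smooth_rep)] at h2
  refine h2.trans ?_
  have h3 := hγ.comp_add
  have h4 : SmoothNear I (Function.uncurry fun s t => γ (s + t)) ((0, 0) : ℝ × ℝ) := h3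
  rw [nestedJet, base_jet h4.jet_uncurry]
  simp only [zero_add]

theorem IsSemiHolonomicOver.base_eq (hγ : SmoothNear I γ 0) (hx : γ 0 ∈ (extChartAt I x).source)
    (hq : ContDiffNear q (0, 0)) {v : Vel (2 * m) I M}
    (hv : IsSemiHolonomicOver (nestedJet m m (coModel I) (coFamily I x γ q)) v) :
    v.base = γ 0 := by
  have h1 := congrArg Vel.base (hv.proj_eq hγ hx hq)
  rw [base_jet hγ, Vel.proj, base_jet v.smooth_rep] at h1
  exact h1

theorem base_tanJet (hγ : SmoothNear I γ 0) (hx : γ 0 ∈ (extChartAt I x).source)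
    (b : Fin (m + 1) → E) : (tanJet I x γ b).base = tanPt I x (γ 0) (b 0) := by
  rw [tanJet, fibreJet, base_jet (smoothNear_tanPt hγ hx (contDiffNear_polyCurve b 0)),
    polyCurve_zero]

theorem upsilon_coFamily (hγ : SmoothNear I γ 0) (hx : γ 0 ∈ (extChartAt I x).source)
    (hq : ContDiffNear q (0, 0)) :
    upsilon (nestedJet m m (coModel I) (coFamily I x γ q)) = coPt I x (γ 0)
      (dirDerivs (List.replicate m ((0, 1) - (1, 0) : ℝ × ℝ)) q (0, 0)) := by
  set Φ := nestedJet m m (coModel I) (coFamily I x γ q) with hΦ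
  set Q := dirDerivs (List.replicate m ((0, 1) - (1, 0) : ℝ × ℝ)) q (0, 0) with hQ
  have hpair : ∀ b : Fin (m + 1) → E,
      iterPairing (combine (fun j => (-1) ^ j * (m.choose j : ℝ)) Φ) (tanJet I x γ b).iota
        = Q (b 0) := by
    intro b
    rw [tanJet, fibreJet, iterPairing_combine hγ hx hq (contDiffNear_polyCurve b 0),
      sum_dirDerivs_apply_add hq (contDiffNear_polyCurve b 0), polyCurve_zero]
  have hex : ∃ v : Vel (2 * m) I M, IsSemiHolonomicOver Φ v ∧ (coPt I x (γ 0) Q).proj = v.base ∧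
      ∀ V : Vel m I.tangent (TangentBundle I M), V.map I tau = v.proj m →
        pairing (coPt I x (γ 0) Q) V.base
          = iterPairing (combine (fun j => (-1) ^ j * (m.choose j : ℝ)) Φ) V.iota := by
    refine ⟨jet (2 * m) I γ 0, isSemiHolonomicOver_coFamily hγ hx hq, (base_jet hγ).symm,
      fun V hV => ?_⟩
    rw [proj_jet hγ (by omega)] at hV
    obtain ⟨b, rfl⟩ := exists_eq_tanJet hγ hx hV
    rw [hpair, base_tanJet hγ hx, pairing_coPt_tanPt hx]
  have key : ∃! p : CoTan I M, ∃ v : Vel (2 * m) I M, IsSemiHolonomicOver Φ v ∧ p.proj = v.base ∧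
      ∀ V : Vel m I.tangent (TangentBundle I M), V.map I tau = v.proj m →
        pairing p V.base
          = iterPairing (combine (fun j => (-1) ^ j * (m.choose j : ℝ)) Φ) V.iota := by
    refine ⟨_, hex, ?_⟩
    rintro p ⟨v, hv, hp, h⟩
    rw [hv.proj_eq hγ hx hq] at h
    rw [hv.base_eq hγ hx hq] at hp
    obtain ⟨Q', rfl⟩ : ∃ Q', p = coPt I x (γ 0) Q' := by
      refine ⟨fibreCoord x p, ?_⟩
      have := fibrePt_fibreCoord (p := p) (mem_baseSet_co (I := I) (by rwa [hp]))
      rw [hp] at this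
      exact this.symm
    congr 1
    ext e
    have h1 := h _ (map_tanJet hγ hx (fun _ => e))
    rwa [base_tanJet hγ hx, pairing_coPt_tanPt hx, hpair] at h1
  rw [upsilon, theUnique, dif_pos key]
  exact key.unique key.choose_spec.1 hex

/-- The lifted pairing with a fixed covector jet, as a linear functional of the fibre
coordinates. -/
def pairingFunctional {m : ℕ} (Q : (Fin m → ℝ) → E →L[ℝ] ℝ) : (Fin (m + 1) → E) →L[ℝ] ℝ :=
  ∑ i : Fin (m + 1), (dirDerivs (basisDirs (List.finRange m))
    (fun u => ((∑ a, u a) ^ (i : ℕ) / ((i : ℕ).factorial : ℝ)) • Q u) 0).comp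
      (ContinuousLinearMap.proj i)

theorem pairingFunctional_apply {Q : (Fin m → ℝ) → E →L[ℝ] ℝ} (hQ : ContDiffNear Q 0)
    (b : Fin (m + 1) → E) :
    dirDerivs (basisDirs (List.finRange m)) (fun u => Q u (polyCurve b (∑ i, u i))) 0
      = pairingFunctional Q b := by
  have hs : ∀ i : Fin (m + 1), ContDiffNear
      (fun u : Fin m → ℝ => ((∑ a, u a) ^ (i : ℕ) / ((i : ℕ).factorial : ℝ)) • Q u) 0 := by
    intro i
    have hp : ContDiff ℝ ∞ fun u : Fin m → ℝ =>
        (∑ a, u a) ^ (i : ℕ) / ((i : ℕ).factorial : ℝ) := by fun_prop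
    filter_upwards [hQ] with u hu using hp.contDiffAt.smul hu
  have h1 : (fun u => Q u (polyCurve b (∑ i, u i))) = fun u => ∑ i : Fin (m + 1), (1 : ℝ) •
      (((∑ a, u a) ^ (i : ℕ) / ((i : ℕ).factorial : ℝ)) • Q u) (b i) := by
    funext u
    rw [polyCurve, map_sum]
    refine Finset.sum_congr rfl fun i _ => ?_
    rw [map_smul, one_smul, _root_.smul_apply]
  rw [h1, (dirDerivs_sum _ _ (fun i _ => ?_) _).self_of_nhds, pairingFunctional,
    _root_.sum_apply]
  · refine Finset.sum_congr rfl fun i _ => ?_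
    rw [one_smul]
    exact (dirDerivs_clm_comp (ContinuousLinearMap.apply ℝ ℝ (b i)) (hs i) _).self_of_nhds
  · exact (hs i).mono fun u hu => hu.clm_apply contDiffAt_const

theorem semiHolProj_spec {Q : (Fin m → ℝ) → E →L[ℝ] ℝ} (hγ : SmoothNear I γ 0)
    (hx : γ 0 ∈ (extChartAt I x).source) (hQ : ContDiffNear Q 0)
    {X : ITan m (coModel I) (CoTan I M)}
    (hX : X = iterJet (coModel I) (fun u => coPt I x (γ (∑ i, u i)) (Q u))) :
    (semiHolProj X).map I coTau = jet m I γ 0 ∧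
      ∀ V : Vel m I.tangent (TangentBundle I M), V.map I tau = jet m I γ 0 →
        velPairing (semiHolProj X) V = iterPairing X V.iota := by
  have hγs : SmoothNear I (fun u : Fin m → ℝ => γ (∑ i, u i)) 0 := hγ.comp_sum
  have hxs : γ (∑ i, (0 : Fin m → ℝ) i) ∈ (extChartAt I x).source := by simpa using hx
  have hpair : ∀ b : Fin (m + 1) → E,
      iterPairing X (tanJet I x γ b).iota = pairingFunctional Q b := by
    intro b
    rw [hX, tanJet, fibreJet, iota_jet (smoothNear_tanPt hγ hx (contDiffNear_polyCurve b 0)),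
      iterPairing_fibrePt (f := fun u => γ (∑ i, u i)) (b := fun u => polyCurve b (∑ i, u i))
        hγs hxs hQ (ContDiffNear.comp (contDiffNear_polyCurve b _) (contDiffNear_sum 0)),
      pairingFunctional_apply hQ]
  have hmap : X.map I coTau = (jet m I γ 0).iota := by
    rw [hX, map_iterJet (smoothNear_coPt hγs hxs hQ) (smoothMapNear_coTau _), iota_jet hγ]
    rfl
  have hex : ∃ v : Vel m I M, X.map I coTau = v.iota ∧
      (coJet I x γ (dualCoeff (pairingFunctional Q))).map I coTau = v ∧
      ∀ V : Vel m I.tangent (TangentBundle I M), V.map I tau = v →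
        velPairing (coJet I x γ (dualCoeff (pairingFunctional Q))) V = iterPairing X V.iota := by
    refine ⟨_, hmap, map_coJet hγ hx _, fun V hV => ?_⟩
    obtain ⟨b, rfl⟩ := exists_eq_tanJet hγ hx hV
    rw [velPairing_dualCoeff hγ hx, hpair]
  have key : ∃! w : Vel m (coModel I) (CoTan I M), ∃ v : Vel m I M, X.map I coTau = v.iota ∧
      w.map I coTau = v ∧ ∀ V : Vel m I.tangent (TangentBundle I M), V.map I tau = v →
        velPairing w V = iterPairing X V.iota := by
    refine ⟨_, hex, ?_⟩
    rintro w ⟨v, hv, hw, h⟩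
    obtain rfl : v = jet m I γ 0 := iota_injective (hv.symm.trans hmap)
    refine eq_coJet_dualCoeff hγ hx hw fun b => ?_
    rw [h _ (map_tanJet hγ hx b), hpair]
  rw [semiHolProj, theUnique, dif_pos key]
  obtain ⟨v, hv, hw, h⟩ := key.choose_spec.1
  obtain rfl : v = jet m I γ 0 := iota_injective (hv.symm.trans hmap)
  exact ⟨hw, h⟩

theorem momenta_coFamily (hγ : SmoothNear I γ 0) (hx : γ 0 ∈ (extChartAt I x).source)
    (hq : ContDiffNear q (0, 0)) :
    (momenta (nestedJet m m (coModel I) (coFamily I x γ q))).map I coTau = jet m I γ 0 ∧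
      ∀ {b : ℝ → E}, ContDiffNear b 0 →
        velPairing (momenta (nestedJet m m (coModel I) (coFamily I x γ q)))
          (jet m I.tangent (fun t => tanPt I x (γ t) (b t)) 0)
        = ∑ j ∈ Finset.range (m + 1), ((-1) ^ j * ((m + 1).choose (j + 1) : ℝ)) •
          dirDerivs (biDirs j (m - j)) (fun z : ℝ × ℝ => q z (b (z.1 + z.2))) (0, 0) := by
  obtain ⟨h1, h2⟩ := semiHolProj_spec hγ hx (contDiffNear_sum_biSum hq
    (fun j => (-1) ^ j * ((m + 1).choose (j + 1) : ℝ)))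
    (combine_coFamily hγ hx hq fun j => (-1) ^ j * ((m + 1).choose (j + 1) : ℝ))
  refine ⟨h1, fun {b} hb => ?_⟩
  rw [momenta, h2 _ (map_jet_fibrePt hγ (mem_baseSet_tan hx) hb), iterPairing_combine hγ hx hq hb]

end SemiHolonomic

/-! ### The first variation along a curve -/

section FirstVariation

variable {E : Type*} [NormedAddCommGroup E] [NormedSpace ℝ E] {H : Type*} [TopologicalSpace H]
  {I : ModelWithCorners ℝ E H} {M : Type*} [TopologicalSpace M] [ChartedSpace H M]
  [IsManifold I ∞ M] [I.Boundaryless] {k : ℕ} {x : M} {L : Vel k I M → ℝ} {γ : ℝ → M} {τ : ℝ}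

theorem contDiff_dualCoeff {G : Type*} [NormedAddCommGroup G] [NormedSpace ℝ G] :
    ContDiff ℝ ∞ (dualCoeff : ((Fin (k + 1) → G) →L[ℝ] ℝ) → Fin (k + 1) → G →L[ℝ] ℝ) := by
  rw [contDiff_pi]
  intro i
  exact (contDiff_id.clm_comp contDiff_const).const_smul _

theorem SmoothNear.comp_fst_add_snd {N : Type*} [TopologicalSpace N] [ChartedSpace H N] {c : ℝ → N}
    {σ : ℝ} (hc : SmoothNear I c σ) :
    SmoothNear I (fun z : ℝ × ℝ => c (z.1 + z.2)) (σ, 0) :=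
  SmoothNear.comp (g := fun z : ℝ × ℝ => z.1 + z.2) (by simpa using hc)
    (contDiffNear_of_contDiff (contDiff_fst.add contDiff_snd) _)

theorem contDiffNear_coords_jet (hγ : SmoothNear I γ τ) (hx : γ τ ∈ (extChartAt I x).source) :
    ContDiffNear (fun σ => Vel.coords x (jet k I γ σ)) τ := by
  have hF := hγ.comp_fst_add_snd
  have hx' : γ (τ + 0) ∈ (extChartAt I x).source := by rwa [add_zero]
  have h1 : ContDiffNear (fun σ => Vel.coords x (jet k I (fun t => γ (σ + t)) 0)) τ := by
    refine ContDiffNear.congr ?_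
      (coords_jet_family (k := k) (F := fun z : ℝ × ℝ => γ (z.1 + z.2)) hF hx')
    exact contDiffNear_pi fun α =>
      contDiffNear_fst_zero (SmoothNear.contDiffNear_extChartAt
        (f := fun z : ℝ × ℝ => γ (z.1 + z.2)) hF hx' |>.dirDerivs _)
  refine h1.congr ?_
  filter_upwards [hγ.eventually] with σ hσ
  rw [jet_shift hσ]

/-- The fibre coordinate of `Λ_L` along a curve, as a polynomial in the jet parameter. -/
def momentumCoord (I : ModelWithCorners ℝ E H) [I.Boundaryless] [IsManifold I ∞ M]
    (L : Vel k I M → ℝ) (x : M) (γ : ℝ → M) (z : ℝ × ℝ) : E →L[ℝ] ℝ :=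
  polyCurve (dualCoeff (fderiv ℝ (localLagrangian I L x) (Vel.coords x (jet k I γ z.1)))) z.2

theorem coords_jet_zero_mem (hγ : SmoothNear I γ τ) (hx : γ τ ∈ (extChartAt I x).source) :
    Vel.coords x (jet k I γ τ) 0 ∈ (extChartAt I x).target := by
  have hx' : γ (τ + 0) ∈ (extChartAt I x).source := by rwa [add_zero]
  rw [jet_shift hγ, Vel.coords_jet hγ.shift hx']
  simpa using (extChartAt I x).map_source hx

theorem contDiffNear_momentumCoord (hL : ContMDiff 𝓘(ℝ, Fin (k + 1) → E) 𝓘(ℝ, ℝ) ∞ L)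
    (hγ : SmoothNear I γ τ) (hx : γ τ ∈ (extChartAt I x).source) (t : ℝ) :
    ContDiffNear (momentumCoord I L x γ) (τ, t) := by
  have h1 : ContDiffNear (fderiv ℝ (localLagrangian I L x)) (Vel.coords x (jet k I γ τ)) :=
    (contDiffNear_localLagrangian hL (coords_jet_zero_mem hγ hx)).mono fun y hy =>
      hy.fderiv_right (m := ∞) (by simp)
  have h2 : ContDiffNear (fun σ =>
      dualCoeff (fderiv ℝ (localLagrangian I L x) (Vel.coords x (jet k I γ σ)))) τ :=
    (contDiffNear_of_contDiff contDiff_dualCoeff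
      (fderiv ℝ (localLagrangian I L x) (Vel.coords x (jet k I γ τ)))).comp
      (f := fun σ => fderiv ℝ (localLagrangian I L x) (Vel.coords x (jet k I γ σ)))
      (h1.comp (f := fun σ => Vel.coords x (jet k I γ σ)) (contDiffNear_coords_jet hγ hx))
  have h3 : ContDiffNear (fun z : ℝ × ℝ =>
      dualCoeff (fderiv ℝ (localLagrangian I L x) (Vel.coords x (jet k I γ z.1)))) (τ, t) :=
    ContDiffNear.comp (f := Prod.fst) (g := fun σ =>
      dualCoeff (fderiv ℝ (localLagrangian I L x) (Vel.coords x (jet k I γ σ)))) h2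
      (contDiffNear_of_contDiff contDiff_fst _)
  have h4 : ContDiffNear (fun z : ℝ × ℝ =>
      (dualCoeff (fderiv ℝ (localLagrangian I L x) (Vel.coords x (jet k I γ z.1))), z.2)) (τ, t) :=
    h3.prodMk (contDiffNear_of_contDiff contDiff_snd _)
  exact ContDiffNear.comp (g := fun p : (Fin (k + 1) → E →L[ℝ] ℝ) × ℝ => polyCurve p.1 p.2)
    (f := fun z : ℝ × ℝ =>
      (dualCoeff (fderiv ℝ (localLagrangian I L x) (Vel.coords x (jet k I γ z.1))), z.2))
    (contDiffNear_of_contDiff contDiff_polyCurve _) h4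

theorem bigLambda_jet (hL : ContMDiff 𝓘(ℝ, Fin (k + 1) → E) 𝓘(ℝ, ℝ) ∞ L)
    (hγ : SmoothNear I γ τ) (hx : γ τ ∈ (extChartAt I x).source) :
    bigLambda L (jet k I γ τ)
      = jet k (coModel I) (fun t => coPt I x (γ (τ + t)) (momentumCoord I L x γ (τ, t))) 0 := by
  have hx' : γ (τ + 0) ∈ (extChartAt I x).source := by rwa [add_zero]
  rw [bigLambda, jet_shift hγ, dualFlip_spec hL hγ.shift hx']
  simp only [momentumCoord, ← jet_shift (k := k) hγ]
  rfl

theorem pairing_differential_eq_velPairing (hL : ContMDiff 𝓘(ℝ, Fin (k + 1) → E) 𝓘(ℝ, ℝ) ∞ L)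
    (hγ : SmoothNear I γ τ) {V : Vel k I.tangent (TangentBundle I M)}
    (hV : V.map I tau = jet k I γ τ) :
    pairing (differential L (jet k I γ τ)) (canonicalFlip V)
      = velPairing (bigLambda L (jet k I γ τ)) V := by
  have hx' : γ (τ + 0) ∈ (extChartAt I (γ (τ + 0))).source := mem_extChartAt_source _
  rw [jet_shift hγ] at hV ⊢
  obtain ⟨b, rfl⟩ := exists_eq_tanJet hγ.shift hx' hV
  rw [pairing_differential hL hγ.shift hx', bigLambda, dualFlip_spec hL hγ.shift hx',
    velPairing_dualCoeff hγ.shift hx']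

theorem jet_proj_bigLambda (hL : ContMDiff 𝓘(ℝ, Fin (k + 1) → E) 𝓘(ℝ, ℝ) ∞ L)
    (hγ : SmoothNear I γ τ) (hx : γ τ ∈ (extChartAt I x).source) {n : ℕ} (hn : n ≤ k) :
    jet n 𝓘(ℝ, Fin (n + 1) → E × (E →L[ℝ] ℝ))
        (fun s => (bigLambda L (jet k I γ s)).proj n) τ
      = nestedJet n n (coModel I) (coFamily I x (fun t => γ (τ + t))
          fun z => momentumCoord I L x γ (τ + z.1, z.2)) := by
  have hx' : γ (τ + 0) ∈ (extChartAt I x).source := by rwa [add_zero]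
  have hP : SmoothNear (coModel I) (fun z : ℝ × ℝ =>
      coPt I x (γ (z.1 + z.2)) (momentumCoord I L x γ z)) (τ, 0) :=
    smoothNear_coPt (f := fun z : ℝ × ℝ => γ (z.1 + z.2)) hγ.comp_fst_add_snd hx'
      (contDiffNear_momentumCoord hL hγ hx 0)
  have hJ := smoothNear_jet_family (k := n) hP
  have h1 : (fun s => jet n (coModel I)
      (fun t => coPt I x (γ (s + t)) (momentumCoord I L x γ (s, t))) 0) =ᶠ[𝓝 τ]
      fun s => (bigLambda L (jet k I γ s)).proj n := by
    filter_upwards [hγ.eventually, hγ.eventually_mem_source hx, hP.eventually_curve]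
      with s h2 h3 h4
    rw [bigLambda_jet hL h2 h3, proj_jet h4.curve hn]
  rw [← jet_congr hJ h1, jet_shift hJ, nestedJet]
  simp only [add_assoc]

theorem dirDerivs_shift {G : Type*} [NormedAddCommGroup G] [NormedSpace ℝ G] {φ : ℝ × ℝ → G}
    {σ : ℝ} (hφ : ContDiffNear φ (σ, 0)) (l : List (ℝ × ℝ)) :
    dirDerivs l (fun z => φ (σ + z.1, z.2)) (0, 0) = dirDerivs l φ (σ, 0) := by
  have h := (dirDerivs_comp_affine (ContinuousLinearMap.id ℝ (ℝ × ℝ)) (σ, 0) (u := (0, 0))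
    (f := φ) (by simpa using hφ) l).self_of_nhds
  have h1 : ∀ z : ℝ × ℝ, ((σ, 0) : ℝ × ℝ) + z = (σ + z.1, z.2) := fun z => by
    ext <;> simp
  simp only [ContinuousLinearMap.coe_id', id_eq, h1, List.map_id_fun] at h
  simpa using h

variable {δγ : ℝ → TangentBundle I M}

/-- The pairing of the fibre coordinates of `Λ_L` and of a vector field along the curve. -/
def pairingCoord (L : Vel k I M → ℝ) (x : M) (γ : ℝ → M) (δγ : ℝ → TangentBundle I M)
    (z : ℝ × ℝ) : ℝ :=
  momentumCoord I L x γ z (fibreCoord x (δγ (z.1 + z.2)))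

theorem contDiffNear_pairingCoord (hL : ContMDiff 𝓘(ℝ, Fin (k + 1) → E) 𝓘(ℝ, ℝ) ∞ L)
    (hγ : SmoothNear I γ τ) (hx : γ τ ∈ (extChartAt I x).source)
    (hδ : SmoothNear I.tangent δγ τ) (hp : (δγ τ).proj = γ τ) :
    ContDiffNear (pairingCoord L x γ δγ) (τ, 0) := by
  have hb := contDiffNear_fibreCoord_tan (x := x) hδ (by rwa [hp])
  exact (contDiffNear_momentumCoord hL hγ hx 0).clm_apply
    (ContDiffNear.comp (f := fun z : ℝ × ℝ => z.1 + z.2) (g := fun t => fibreCoord x (δγ t))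
      (by simpa using hb) (contDiffNear_of_contDiff (contDiff_fst.add contDiff_snd) _))

theorem jet_vectorField {n : ℕ} (hγ : SmoothNear I γ τ) (hx : γ τ ∈ (extChartAt I x).source)
    (hδ : SmoothNear I.tangent δγ τ) (hp : ∀ᶠ t in 𝓝 τ, (δγ t).proj = γ t) :
    jet n I.tangent δγ τ = jet n I.tangent
      (fun t => tanPt I x (γ (τ + t)) (fibreCoord x (δγ (τ + t)))) 0 := by
  have h1 : δγ =ᶠ[𝓝 τ] fun t => tanPt I x (γ t) (fibreCoord x (δγ t)) := by
    filter_upwards [hp, hγ.eventually_mem_source hx] with t h1 h2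
    have := fibrePt_fibreCoord (x := x) (p := δγ t) (mem_baseSet_tan (by rwa [h1]))
    rw [h1] at this
    exact this.symm
  rw [jet_congr hδ h1, jet_shift (hδ.congr h1.symm)]

theorem map_tau_jet {n : ℕ} (hγ : SmoothNear I γ τ) (hδ : SmoothNear I.tangent δγ τ)
    (hp : ∀ᶠ t in 𝓝 τ, (δγ t).proj = γ t) :
    (jet n I.tangent δγ τ).map I tau = jet n I γ τ := by
  rw [jet_shift hδ, map_jet hδ.shift (smoothMapNear_tau _),
    ← jet_shift (γ := fun t => tau (δγ t)) ((smoothMapNear_tau _).comp_smoothNear hδ)]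
  exact (jet_congr hγ (hp.mono fun t ht => ht.symm)).symm

theorem variation_proj (hγ : SmoothNear I γ τ) (hδ : SmoothNear I.tangent δγ τ)
    (hp : ∀ᶠ t in 𝓝 τ, (δγ t).proj = γ t) : (variation k δγ τ).proj = jet k I γ τ := by
  have h := map_tau_jet (n := k) hγ hδ hp
  rw [jet_shift hγ] at h ⊢
  exact canonicalFlip_proj hγ.shift h

theorem pairing_variation (hL : ContMDiff 𝓘(ℝ, Fin (k + 1) → E) 𝓘(ℝ, ℝ) ∞ L)
    (hγ : SmoothNear I γ τ) (hx : γ τ ∈ (extChartAt I x).source)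
    (hδ : SmoothNear I.tangent δγ τ) (hp : ∀ᶠ t in 𝓝 τ, (δγ t).proj = γ t) :
    pairing (differential L (jet k I γ τ)) (variation k δγ τ)
      = dirDerivs (biDirs 0 k) (pairingCoord L x γ δγ) (τ, 0) := by
  have hx' : γ (τ + 0) ∈ (extChartAt I x).source := by rwa [add_zero]
  have hb := contDiffNear_fibreCoord_tan (x := x) hδ (by rwa [hp.self_of_nhds])
  have hq := contDiffNear_momentumCoord hL hγ hx 0
  rw [variation, pairing_differential_eq_velPairing hL hγ (map_tau_jet hγ hδ hp),
    bigLambda_jet hL hγ hx, jet_vectorField hγ hx hδ hp,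
    velPairing_fibrePt (γ := fun t => γ (τ + t))
      (q := fun t => momentumCoord I L x γ (τ, t)) (b := fun t => fibreCoord x (δγ (τ + t)))
      hγ.shift hx' (hq.comp (f := fun t : ℝ => ((τ, t) : ℝ × ℝ))
        (contDiffNear_of_contDiff (contDiff_const.prodMk contDiff_id) 0))
      (ContDiffNear.comp (f := fun t => τ + t) (g := fun t => fibreCoord x (δγ t))
        (by simpa using hb) (contDiffNear_of_contDiff (contDiff_const.add contDiff_id) 0))]
  exact iteratedDeriv_snd (contDiffNear_pairingCoord hL hγ hx hδ hp.self_of_nhds) k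

theorem contDiffNear_shift_momentumCoord (hL : ContMDiff 𝓘(ℝ, Fin (k + 1) → E) 𝓘(ℝ, ℝ) ∞ L)
    (hγ : SmoothNear I γ τ) (hx : γ τ ∈ (extChartAt I x).source) :
    ContDiffNear (fun z : ℝ × ℝ => momentumCoord I L x γ (τ + z.1, z.2)) (0, 0) := by
  refine ContDiffNear.comp (f := fun z : ℝ × ℝ => ((τ + z.1, z.2) : ℝ × ℝ))
    (by simpa using contDiffNear_momentumCoord hL hγ hx 0) (contDiffNear_of_contDiff ?_ _)
  fun_prop

theorem force_eq (hL : ContMDiff 𝓘(ℝ, Fin (k + 1) → E) 𝓘(ℝ, ℝ) ∞ L)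
    (hγ : SmoothNear I γ τ) (hx : γ τ ∈ (extChartAt I x).source) :
    force L γ τ = coPt I x (γ τ) (dirDerivs (List.replicate k ((0, 1) - (1, 0) : ℝ × ℝ))
      (fun z => momentumCoord I L x γ (τ + z.1, z.2)) (0, 0)) := by
  have h1 := jet_proj_bigLambda hL hγ hx (le_refl k)
  have h2 : (fun s => (bigLambda L (jet k I γ s)).proj k) = fun s => bigLambda L (jet k I γ s) :=
    funext fun s => Vel.jet_rep _
  rw [h2] at h1
  rw [force, h1, upsilon_coFamily hγ.shift (by rwa [add_zero])
    (contDiffNear_shift_momentumCoord hL hγ hx), add_zero]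

theorem contDiffNear_shift_fibreCoord (hx : γ τ ∈ (extChartAt I x).source)
    (hδ : SmoothNear I.tangent δγ τ) (hp : (δγ τ).proj = γ τ) :
    ContDiffNear (fun t => fibreCoord x (δγ (τ + t))) 0 :=
  ContDiffNear.comp (f := fun t => τ + t) (g := fun t => fibreCoord x (δγ t))
    (by simpa using contDiffNear_fibreCoord_tan (x := x) hδ (by rwa [hp]))
    (contDiffNear_of_contDiff (contDiff_const.add contDiff_id) 0)

theorem dirDerivs_pairingCoord_shift (hL : ContMDiff 𝓘(ℝ, Fin (k + 1) → E) 𝓘(ℝ, ℝ) ∞ L)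
    (hγ : SmoothNear I γ τ) (hx : γ τ ∈ (extChartAt I x).source)
    (hδ : SmoothNear I.tangent δγ τ) (hp : (δγ τ).proj = γ τ) (l : List (ℝ × ℝ)) :
    dirDerivs l (fun z : ℝ × ℝ => momentumCoord I L x γ (τ + z.1, z.2)
      (fibreCoord x (δγ (τ + (z.1 + z.2))))) (0, 0)
      = dirDerivs l (pairingCoord L x γ δγ) (τ, 0) := by
  rw [← dirDerivs_shift (contDiffNear_pairingCoord hL hγ hx hδ hp)]
  simp only [pairingCoord, add_assoc]

theorem pairing_force (hL : ContMDiff 𝓘(ℝ, Fin (k + 1) → E) 𝓘(ℝ, ℝ) ∞ L)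
    (hγ : SmoothNear I γ τ) (hx : γ τ ∈ (extChartAt I x).source)
    (hδ : SmoothNear I.tangent δγ τ) (hp : (δγ τ).proj = γ τ) :
    pairing (force L γ τ) (δγ τ) = ∑ j ∈ Finset.range (k + 1), ((-1) ^ j * (k.choose j : ℝ)) •
      dirDerivs (biDirs j (k - j)) (pairingCoord L x γ δγ) (τ, 0) := by
  have hq := contDiffNear_shift_momentumCoord hL hγ hx
  have hb := contDiffNear_shift_fibreCoord hx hδ hp
  have h1 : δγ τ = tanPt I x (γ τ) (fibreCoord x (δγ (τ + 0))) := by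
    have := fibrePt_fibreCoord (x := x) (p := δγ τ) (mem_baseSet_tan (by rwa [hp]))
    rw [hp] at this
    rw [add_zero]
    exact this.symm
  rw [force_eq hL hγ hx, h1, pairing_coPt_tanPt hx, ← sum_dirDerivs_apply_add hq hb]
  exact Finset.sum_congr rfl fun j _ => by
    rw [dirDerivs_pairingCoord_shift hL hγ hx hδ hp]

end FirstVariation

section FirstVariationSucc

variable {E : Type*} [NormedAddCommGroup E] [NormedSpace ℝ E] {H : Type*} [TopologicalSpace H]
  {I : ModelWithCorners ℝ E H} {M : Type*} [TopologicalSpace M] [ChartedSpace H M]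
  [IsManifold I ∞ M] [I.Boundaryless] {n : ℕ} {x : M} {L : Vel (n + 1) I M → ℝ} {γ : ℝ → M}
  {τ : ℝ} {δγ : ℝ → TangentBundle I M}

theorem momentum_eq (hL : ContMDiff 𝓘(ℝ, Fin (n + 1 + 1) → E) 𝓘(ℝ, ℝ) ∞ L)
    (hγ : SmoothNear I γ τ) (hx : γ τ ∈ (extChartAt I x).source) :
    momentum L γ τ = momenta (nestedJet n n (coModel I) (coFamily I x (fun t => γ (τ + t))
      fun z => momentumCoord I L x γ (τ + z.1, z.2))) :=
  congrArg momenta (jet_proj_bigLambda hL hγ hx (Nat.le_succ n))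

theorem map_momentum (hL : ContMDiff 𝓘(ℝ, Fin (n + 1 + 1) → E) 𝓘(ℝ, ℝ) ∞ L)
    (hγ : SmoothNear I γ τ) :
    Vel.map (k := n) I coTau (momentum L γ τ) = jet n I γ τ := by
  have hx := mem_extChartAt_source (I := I) (γ τ)
  rw [momentum_eq hL hγ hx, (momenta_coFamily (m := n) hγ.shift (by rwa [add_zero])
    (contDiffNear_shift_momentumCoord hL hγ hx)).1, jet_shift hγ]

theorem velPairing_momentum (hL : ContMDiff 𝓘(ℝ, Fin (n + 1 + 1) → E) 𝓘(ℝ, ℝ) ∞ L)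
    (hγ : SmoothNear I γ τ) (hx : γ τ ∈ (extChartAt I x).source)
    (hδ : SmoothNear I.tangent δγ τ) (hp : ∀ᶠ t in 𝓝 τ, (δγ t).proj = γ t) :
    velPairing (k := n) (momentum L γ τ) (jet n I.tangent δγ τ)
      = ∑ j ∈ Finset.range (n + 1), ((-1) ^ j * ((n + 1).choose (j + 1) : ℝ)) •
        dirDerivs (biDirs j (n - j)) (pairingCoord L x γ δγ) (τ, 0) := by
  have hq := contDiffNear_shift_momentumCoord hL hγ hx
  have hb := contDiffNear_shift_fibreCoord hx hδ hp.self_of_nhds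
  rw [momentum_eq hL hγ hx, jet_vectorField hγ hx hδ hp,
    (momenta_coFamily (m := n) hγ.shift (by rwa [add_zero]) hq).2 hb]
  exact Finset.sum_congr rfl fun j _ => by
    rw [dirDerivs_pairingCoord_shift hL hγ hx hδ hp.self_of_nhds]

theorem hasDerivAt_dirDerivs {φ : ℝ × ℝ → ℝ} (hφ : ContDiffNear φ (τ, 0)) (l : List (ℝ × ℝ)) :
    HasDerivAt (fun σ => dirDerivs l φ (σ, 0)) (dirDerivs ((1, 0) :: l) φ (τ, 0)) τ := by
  have h1 := ((hφ.dirDerivs l).contDiffAt.differentiableAt (by simp)).hasFDerivAt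
  have h2 : HasDerivAt (fun σ : ℝ => ((σ, 0) : ℝ × ℝ)) (1, 0) τ :=
    (hasDerivAt_id τ).prodMk (hasDerivAt_const τ 0)
  exact h1.comp_hasDerivAt τ h2

theorem continuousAt_dirDerivs {φ : ℝ × ℝ → ℝ} (hφ : ContDiffNear φ (τ, 0)) (l : List (ℝ × ℝ)) :
    ContinuousAt (fun σ => dirDerivs l φ (σ, 0)) τ :=
  (hasDerivAt_dirDerivs hφ l).continuousAt

theorem continuousAt_pairing_variation (hL : ContMDiff 𝓘(ℝ, Fin (n + 1 + 1) → E) 𝓘(ℝ, ℝ) ∞ L)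
    (hγ : SmoothNear I γ τ) (hδ : SmoothNear I.tangent δγ τ)
    (hp : ∀ᶠ t in 𝓝 τ, (δγ t).proj = γ t) :
    ContinuousAt (fun σ => pairing (differential L (jet (n + 1) I γ σ))
      (variation (n + 1) δγ σ)) τ := by
  have hx := mem_extChartAt_source (I := I) (γ τ)
  refine (continuousAt_dirDerivs (contDiffNear_pairingCoord hL hγ hx hδ hp.self_of_nhds)
    (biDirs 0 (n + 1))).congr ?_
  filter_upwards [hγ.eventually, hγ.eventually_mem_source hx, hδ.eventually, hp.eventually_nhds]
    with σ h1 h2 h3 h4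
  exact (pairing_variation hL h1 h2 h3 h4).symm

theorem continuousAt_pairing_force (hL : ContMDiff 𝓘(ℝ, Fin (n + 1 + 1) → E) 𝓘(ℝ, ℝ) ∞ L)
    (hγ : SmoothNear I γ τ) (hδ : SmoothNear I.tangent δγ τ)
    (hp : ∀ᶠ t in 𝓝 τ, (δγ t).proj = γ t) :
    ContinuousAt (fun σ => pairing (force L γ σ) (δγ σ)) τ := by
  have hx := mem_extChartAt_source (I := I) (γ τ)
  have hφ := contDiffNear_pairingCoord hL hγ hx hδ hp.self_of_nhds
  have h0 : ContinuousAt (fun σ => ∑ j ∈ Finset.range (n + 1 + 1),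
      ((-1) ^ j * ((n + 1).choose j : ℝ)) •
        dirDerivs (biDirs j (n + 1 - j)) (pairingCoord L (γ τ) γ δγ) (σ, 0)) τ :=
    tendsto_finsetSum _ fun j _ => (continuousAt_dirDerivs hφ _).const_mul _
  refine h0.congr ?_
  filter_upwards [hγ.eventually, hγ.eventually_mem_source hx, hδ.eventually, hp]
    with σ h1 h2 h3 h4
  exact (pairing_force hL h1 h2 h3 h4).symm

/-- The derivative of the pairing of the momentum with a variation along a curve. -/
theorem hasDerivAt_velPairing_momentum (hL : ContMDiff 𝓘(ℝ, Fin (n + 1 + 1) → E) 𝓘(ℝ, ℝ) ∞ L)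
    (hγ : SmoothNear I γ τ) (hδ : SmoothNear I.tangent δγ τ)
    (hp : ∀ᶠ t in 𝓝 τ, (δγ t).proj = γ t) :
    HasDerivAt (fun σ => velPairing (k := n) (momentum L γ σ) (jet n I.tangent δγ σ))
      (pairing (differential L (jet (n + 1) I γ τ)) (variation (n + 1) δγ τ)
        - pairing (force L γ τ) (δγ τ)) τ := by
  have hx := mem_extChartAt_source (I := I) (γ τ)
  have hφ := contDiffNear_pairingCoord hL hγ hx hδ hp.self_of_nhds
  have h0 : HasDerivAt (fun σ => ∑ j ∈ Finset.range (n + 1),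
      ((-1) ^ j * ((n + 1).choose (j + 1) : ℝ)) •
        dirDerivs (biDirs j (n - j)) (pairingCoord L (γ τ) γ δγ) (σ, 0))
      (∑ j ∈ Finset.range (n + 1), ((-1) ^ j * ((n + 1).choose (j + 1) : ℝ)) •
        dirDerivs (biDirs (j + 1) (n - j)) (pairingCoord L (γ τ) γ δγ) (τ, 0)) τ :=
    HasDerivAt.fun_sum fun j _ => (hasDerivAt_dirDerivs hφ (biDirs j (n - j))).const_mul _
  have h1 : ∑ j ∈ Finset.range (n + 1), ((-1) ^ j * ((n + 1).choose (j + 1) : ℝ)) •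
        dirDerivs (biDirs (j + 1) (n - j)) (pairingCoord L (γ τ) γ δγ) (τ, 0)
      = pairing (differential L (jet (n + 1) I γ τ)) (variation (n + 1) δγ τ)
        - pairing (force L γ τ) (δγ τ) := by
    rw [pairing_variation hL hγ hx hδ hp, pairing_force hL hγ hx hδ hp.self_of_nhds,
      Finset.sum_range_succ' _ (n + 1)]
    simp only [pow_zero, Nat.choose_zero_right, Nat.cast_one, mul_one, one_smul, Nat.sub_zero,
      Nat.add_sub_add_right]
    rw [sub_add_cancel_right, ← Finset.sum_neg_distrib]
    refine Finset.sum_congr rfl fun j _ => ?_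
    rw [pow_succ, ← neg_smul]
    congr 1
    ring
  rw [h1] at h0
  refine h0.congr_of_eventuallyEq ?_
  filter_upwards [hγ.eventually, hγ.eventually_mem_source hx, hδ.eventually, hp.eventually_nhds]
    with σ h1 h2 h3 h4
  exact velPairing_momentum hL h1 h2 h3 h4

end FirstVariationSucc

end HigherVar

end

open HigherVar

theorem mainTheorem3 {E : Type*} [NormedAddCommGroup E] [NormedSpace ℝ E] [FiniteDimensional ℝ E]
    {H : Type*} [TopologicalSpace H] (I : ModelWithCorners ℝ E H) [I.Boundaryless]
    {M : Type*} [TopologicalSpace M] [ChartedSpace H M] [IsManifold I ∞ M]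
    (k : ℕ) (hk : 1 ≤ k)
    (L : Vel k I M → ℝ) (hL : ContMDiff 𝓘(ℝ, Fin (k + 1) → E) 𝓘(ℝ, ℝ) ∞ L)
    (t₀ t₁ : ℝ) (ht : t₀ ≤ t₁) (U : Set ℝ) (hU : IsOpen U) (hIU : Icc t₀ t₁ ⊆ U)
    (γ : ℝ → M) (hγ : ContMDiffOn 𝓘(ℝ, ℝ) I ∞ γ U)
    (δγ : ℝ → TangentBundle I M) (hδγ : ContMDiffOn 𝓘(ℝ, ℝ) I.tangent ∞ δγ U)
    (hproj : ∀ t ∈ U, (δγ t).proj = γ t) :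
    (∀ t ∈ Icc t₀ t₁,
      (variation k δγ t).proj = jet k I γ t ∧
      (force L γ t).proj = γ t ∧
      (momentum L γ t).map I coTau = jet (k - 1) I γ t) ∧
    IntervalIntegrable (fun t => pairing
      (differential L (jet k I γ t)) (variation k δγ t))
      MeasureTheory.volume t₀ t₁ ∧
    IntervalIntegrable (fun t => pairing (force L γ t) (δγ t))
      MeasureTheory.volume t₀ t₁ ∧
    actionDifferential L t₀ t₁ γ (variation k δγ)
      = (∫ t in t₀..t₁, pairing (force L γ t) (δγ t))
        + (velPairing (momentum L γ t₁)
              (jet (k - 1) I.tangent δγ t₁)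
            - velPairing (momentum L γ t₀)
              (jet (k - 1) I.tangent δγ t₀)) := by
  obtain ⟨n, rfl⟩ : ∃ n, k = n + 1 := ⟨k - 1, by omega⟩
  have sγ : ∀ t ∈ U, SmoothNear I γ t := fun t h =>
    (hU.mem_nhds h |> eventually_mem_set.2).mono fun s hs => hγ.contMDiffAt (hU.mem_nhds hs)
  have sδ : ∀ t ∈ U, SmoothNear I.tangent δγ t := fun t h =>
    (hU.mem_nhds h |> eventually_mem_set.2).mono fun s hs => hδγ.contMDiffAt (hU.mem_nhds hs)
  have sp : ∀ t ∈ U, ∀ᶠ s in 𝓝 t, (δγ s).proj = γ s := fun t h =>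
    (hU.mem_nhds h |> eventually_mem_set.2).mono hproj
  have hu : uIcc t₀ t₁ ⊆ U := by rwa [uIcc_of_le ht]
  have i1 : IntervalIntegrable (fun t => pairing (differential L (jet (n + 1) I γ t))
      (variation (n + 1) δγ t)) MeasureTheory.volume t₀ t₁ :=
    ContinuousOn.intervalIntegrable fun t h => (continuousAt_pairing_variation hL (sγ t (hu h))
      (sδ t (hu h)) (sp t (hu h))).continuousWithinAt
  have i2 : IntervalIntegrable (fun t => pairing (force L γ t) (δγ t))
      MeasureTheory.volume t₀ t₁ :=
    ContinuousOn.intervalIntegrable fun t h => (continuousAt_pairing_force hL (sγ t (hu h))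
      (sδ t (hu h)) (sp t (hu h))).continuousWithinAt
  refine ⟨fun t h => ⟨variation_proj (sγ t (hIU h)) (sδ t (hIU h)) (sp t (hIU h)), ?_,
    map_momentum hL (sγ t (hIU h))⟩, i1, i2, ?_⟩
  · rw [force_eq hL (sγ t (hIU h)) (mem_extChartAt_source _)]
    rfl
  · have h1 := intervalIntegral.integral_eq_sub_of_hasDerivAt (fun t h =>
      hasDerivAt_velPairing_momentum hL (sγ t (hu h)) (sδ t (hu h)) (sp t (hu h))) (i1.sub i2)
    rw [intervalIntegral.integral_sub i1 i2] at h1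
    rw [actionDifferential]
    exact (sub_eq_iff_eq_add'.1 h1)
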